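/- **Setting.** Let $G=(V,E,E_r)$ be a finite connected undirected multigraph with a set $E_r\subseteq E$ of required edges. Each $e\in E$ has two opposite arcs $a_e,\bar a_e$ (write $\bar{\bar a}=a$); let $\mathcal A$ be the set of all arcs. Each arc $a$ has a real deadhead cost $c_d(a)>0$, and each arc $a$ of a required edge has a real service cost $c_s(a)\ge c_d(a)$; costs may depend on the direction. A *coverage tour* is a closed walk in $G$, each of whose traversals is marked as a service or as a deadheading, such that each required edge is serviced exactly once and no other edge is serviced (edges may be deadheaded any number of times). Its cost is the sum of the service costs of its serviced arcs and the deadhead costs of its deadheaded arcs. The required graph $G_r=(V_r,E_r)$ consists of the required edges and their end vertices; it is *Eulerian* if it is connected and every vertex has even degree in it (a loop counting twice; $E_r=\emptyset$ is allowed). **Algorithm LP-Solve.** (1) For each $e\in E_r$ select the arc $a\in\{a_e,\bar a_e\}$ of smaller service cost ($a_e$ in case of a tie); let $A_m$ be the set of selected arcs. (2) Build the flow digraph $D_f$ on $V$: every arc $a\in\mathcal A$, with unit cost $c_d(a)$ and infinite capacity (deadheading), and for every $a\in A_m$ an arc $a'$ directed as $\bar a$, with unit cost $(c_s(\bar a)-c_s(a))/2$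 and capacity $2$ (service reversal). The demand (inflow minus outflow) at $v$ is the outdegree minus the indegree of $v$ in $(V,A_m)$. (3) Compute a minimum cost flow $f$ in $D_f$. (4) For each $a\in A_m$, put a service copy of $a$ into $A_b$ if $f_{a'}=0$, a service copy of $\bar a$ if $f_{a'}=2$, and put $a$ into the set $A_u$ of ambiguous arcs if $f_{a'}=1$. For every $a\in\mathcal A$ put $f_a$ deadheading copies of $a$ into $A_b$. Output $D_b=(V,A_b)$ and $A_u$. Say that LP-Solve *succeeds* with the minimum cost flow $f$ if $r_a=f_{a'}\in\{0,2\}$ for all $a\in A_m$; $d_a=f_a\in\mathbb N\cup\{0\}$ for all $a\in\mathcal A$; $A_u=\emptyset$; and $D_b$ has an Euler tour (a closed diwalk that uses each arc of $A_b$ exactly once, in its role of service or deadheading) which is a coverage tour of minimum cost among all coverage tours of $G$. **Theorem.** (i) LP-Solve has an implementation that runs in polynomial time and succeeds whenever $G_r$ is Eulerian. Precisely: there are a program for a structured random access machine (with registers and arrays of natural and of real numbers; unit cost addition, subtraction, comparison and indexed access; no multiplication, and no conversion of reals to naturals) and constants $C,k\in\mathbb N$ such that on every connected input $G$ with $n$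 vertices and $m$ edges the program halts after at most $C(n+m+1)^k$ steps with the output of LP-Solve for some integral minimum cost flow $f$ of $D_f$; and if $G_r$ is Eulerian, LP-Solve succeeds with this $f$. (ii) If $G$ is connected and $G_r$ is Eulerian, LP-Solve succeeds with every basic minimum cost flow $f$ in step (3), that is, with every minimum cost flow that is a vertex (extreme point) of the polyhedron of feasible flows. -/

import Mathlib

noncomputable section

/-! ## The single robot line coverage problem -/

/-- The arc `(e, true)` is the direction `a_e` of the edge `e` (from `src e` to `tgt e`),
`(e, false)` is the opposite direction `ā_e`. -/
abbrev Arc (m : ℕ) : Type := Fin m × Bool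

/-- The oppositely directed arc. -/
def Arc.rev {m : ℕ} (a : Arc m) : Arc m := (a.1, !a.2)

/-- An input graph `G = (V, E, E_r)`: a finite undirected multigraph on the vertices `Fin n` with
edges `Fin m` (parallel edges allowed), a set `req` of required edges, and direction dependent
service and deadhead costs. The ends of `e` are `src e` and `tgt e`; their order only names the two
directions of `e`. Only the service costs of required edges matter. -/
structure LineCoverage (n m : ℕ) where
  src : Fin m → Fin n
  tgt : Fin m → Fin n
  req : Finset (Fin m)
  serviceCost : Arc m → ℝ
  deadheadCost : Arc m → ℝ
  deadheadCost_pos : ∀ a, 0 < deadheadCost a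
  deadheadCost_le_serviceCost : ∀ a : Arc m, a.1 ∈ req → deadheadCost a ≤ serviceCost a

namespace LineCoverage

variable {n m : ℕ}

def tail (G : LineCoverage n m) (a : Arc m) : Fin n := if a.2 then G.src a.1 else G.tgt a.1

def head (G : LineCoverage n m) (a : Arc m) : Fin n := if a.2 then G.tgt a.1 else G.src a.1

/-- `G` is connected (in particular it has a vertex). -/
def Connected (G : LineCoverage n m) : Prop :=
  (SimpleGraph.fromRel (fun u v => ∃ e, G.src e = u ∧ G.tgt e = v)).Connected

/-- `v` is a vertex of the required graph: some required edge is incident on it. -/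
def IsRequiredVertex (G : LineCoverage n m) (v : Fin n) : Prop :=
  ∃ e ∈ G.req, G.src e = v ∨ G.tgt e = v

/-- The degree of `v` in the required graph (a loop counts twice). -/
def requiredDegree (G : LineCoverage n m) (v : Fin n) : ℕ :=
  (G.req.filter (fun e => G.src e = v)).card + (G.req.filter (fun e => G.tgt e = v)).card

/-- The required graph `G_r = (V_r, E_r)` is Eulerian: it is connected and the degree of each of its
vertices is even. -/
def RequiredEulerian (G : LineCoverage n m) : Prop :=
  (∀ u v, G.IsRequiredVertex u → G.IsRequiredVertex v →
    (SimpleGraph.fromRel (fun x y => ∃ e ∈ G.req, G.src e = x ∧ G.tgt e = y)).Reachable u v) ∧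
  ∀ v, G.IsRequiredVertex v → Even (G.requiredDegree v)

/-! ### Coverage tours -/

/-- The list of traversals `l` is a diwalk from `u` to `v`. A traversal is an arc together with a
flag that tells whether the arc is serviced (`true`) or deadheaded (`false`). -/
def IsDiwalk (G : LineCoverage n m) : Fin n → List (Arc m × Bool) → Fin n → Prop
  | u, [], v => u = v
  | u, x :: l, v => G.tail x.1 = u ∧ G.IsDiwalk (G.head x.1) l v

/-- A coverage tour: a closed walk on which each required edge is serviced exactly once (in one of
its directions), and no other edge is serviced. Every edge may be deadheaded any number of times. -/
def IsCoverageTour (G : LineCoverage n m) (l : List (Arc m × Bool)) : Prop :=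
  (∃ v, G.IsDiwalk v l v) ∧
  ∀ e, l.countP (fun x => x.1.1 = e ∧ x.2 = true) = if e ∈ G.req then 1 else 0

/-- The cost of a walk: the service costs of its serviced arcs plus the deadhead costs of its
deadheaded arcs. -/
def tourCost (G : LineCoverage n m) (l : List (Arc m × Bool)) : ℝ :=
  (l.map (fun x => if x.2 then G.serviceCost x.1 else G.deadheadCost x.1)).sum

/-- An optimal coverage tour: a coverage tour of minimum cost. -/
def IsOptimalTour (G : LineCoverage n m) (l : List (Arc m × Bool)) : Prop :=
  G.IsCoverageTour l ∧ ∀ l', G.IsCoverageTour l' → G.tourCost l ≤ G.tourCost l'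

end LineCoverage

/-! ## Minimum cost flow -/

/-- A flow digraph with vertices `V` and arcs `A`: unit flow costs, capacities (`⊤` is infinite
capacity) and node flow demands. -/
structure FlowDigraph (V A : Type) where
  tail : A → V
  head : A → V
  cost : A → ℝ
  cap : A → WithTop ℝ
  demand : V → ℝ

namespace FlowDigraph

variable {V A : Type} [DecidableEq V] [Fintype A]

/-- The feasible flows: they respect the capacities and satisfy the demand
(inflow minus outflow) of every vertex. -/
def feasible (D : FlowDigraph V A) : Set (A → ℝ) :=
  {f | (∀ a, 0 ≤ f a ∧ (f a : WithTop ℝ) ≤ D.cap a) ∧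
    ∀ v, (∑ a with D.head a = v, f a) - (∑ a with D.tail a = v, f a) = D.demand v}

def flowCost (D : FlowDigraph V A) (f : A → ℝ) : ℝ := ∑ a, D.cost a * f a

/-- `f` is a minimum cost flow. -/
def IsMinCostFlow (D : FlowDigraph V A) (f : A → ℝ) : Prop :=
  f ∈ D.feasible ∧ ∀ g ∈ D.feasible, D.flowCost f ≤ D.flowCost g

/-- `f` is a basic minimum cost flow: an optimal solution of the minimum cost flow problem that is
a vertex of the polyhedron of feasible flows. -/
def IsBasicMinCostFlow (D : FlowDigraph V A) (f : A → ℝ) : Prop :=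
  D.IsMinCostFlow f ∧ f ∈ Set.extremePoints ℝ D.feasible

end FlowDigraph

/-! ## The algorithm LP-Solve -/

/-- The output of LP-Solve. The digraph `D_b` is given by the numbers of copies of each arc: `service`
counts the service copies, `deadhead` the deadheading copies. `ambiguous` is the set `A_u`. -/
structure LPOutput (m : ℕ) where
  service : Arc m → ℕ
  deadhead : Arc m → ℕ
  ambiguous : Finset (Arc m)

/-- The walk `l` is an Euler tour of the output digraph: it uses every arc exactly as often, and
in the same role, as the digraph contains it. -/
def LPOutput.IsEulerTour {m : ℕ} (D : LPOutput m) (l : List (Arc m × Bool)) : Prop :=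
  ∀ a, l.count (a, true) = D.service a ∧ l.count (a, false) = D.deadhead a

namespace LineCoverage

variable {n m : ℕ}

open Classical in
/-- The arc that MinCostDigraph selects for the edge `e`. -/
def minArc (G : LineCoverage n m) (e : Fin m) : Arc m :=
  if G.serviceCost (e, true) ≤ G.serviceCost (e, false) then (e, true) else (e, false)

/-- The arc set `A_m` of the minimum cost digraph. -/
def minCostDigraph (G : LineCoverage n m) : Finset (Arc m) := G.req.image G.minArc

/-- The imbalance (outdegree minus indegree) of an arc set at `v`. -/
def imbalance (G : LineCoverage n m) (S : Finset (Arc m)) (v : Fin n) : ℤ :=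
  ((S.filter (fun a => G.tail a = v)).card : ℤ) - ((S.filter (fun a => G.head a = v)).card : ℤ)

/-- The arcs of the flow digraph: `inl a` is the deadheading arc of `a`, one for each direction of
each edge, and `inr e` is the service reversal arc `a'` for the arc `a = minArc e` of a required
edge `e`. -/
abbrev FlowArc (G : LineCoverage n m) : Type := Arc m ⊕ {e : Fin m // e ∈ G.req}

/-- ConstructFlowDigraph. The reversal arc `a'` is directed oppositely to `a`. -/
def flowDigraph (G : LineCoverage n m) : FlowDigraph (Fin n) G.FlowArc where
  tail := Sum.elim G.tail (fun e => G.head (G.minArc e))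
  head := Sum.elim G.head (fun e => G.tail (G.minArc e))
  cost := Sum.elim G.deadheadCost
    (fun e => (G.serviceCost (G.minArc e).rev - G.serviceCost (G.minArc e)) / 2)
  cap := Sum.elim (fun _ => ⊤) (fun _ => ((2 : ℝ) : WithTop ℝ))
  demand := fun v => (G.imbalance G.minCostDigraph v : ℝ)

open Classical in
/-- The output of LP-Solve when its minimum cost flow step returned `f`: a required edge is serviced
in the direction of `a = minArc e` if `f a' = 0`, in the opposite direction if `f a' = 2`, and `a` is
ambiguous if `f a' = 1`; each arc `a` is deadheaded `f a` times. -/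
def lpOutput (G : LineCoverage n m) (f : G.FlowArc → ℝ) : LPOutput m where
  service := fun a =>
    if h : a.1 ∈ G.req then
      if a = G.minArc a.1 then
        if f (Sum.inr ⟨a.1, h⟩) = 0 then 1 else 0
      else
        if f (Sum.inr ⟨a.1, h⟩) = 2 then 1 else 0
    else 0
  deadhead := fun a => ⌊f (Sum.inl a)⌋₊
  ambiguous := G.minCostDigraph.filter (fun a => ∃ h : a.1 ∈ G.req, f (Sum.inr ⟨a.1, h⟩) = 1)

/-- With the flow `f`, LP-Solve succeeds: all reversal variables are `0` or `2`, all deadhead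
variables are nonnegative integers (and are the numbers of deadheading copies in the output), no arc
is ambiguous, and the output digraph is the Eulerian digraph of an optimal coverage tour. -/
def SolvedBy (G : LineCoverage n m) (f : G.FlowArc → ℝ) : Prop :=
  (∀ e, f (Sum.inr e) = 0 ∨ f (Sum.inr e) = 2) ∧
  (∀ a, f (Sum.inl a) = ((G.lpOutput f).deadhead a : ℝ)) ∧
  (G.lpOutput f).ambiguous = ∅ ∧
  ∃ l, (G.lpOutput f).IsEulerTour l ∧ G.IsOptimalTour l

end LineCoverage

/-! ## The machine model

Programs of a structured random access machine, with registers and arrays of natural numbers and of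
real numbers. It can add, subtract and compare (no multiplication, so numbers cannot grow faster than
by doubling in a step, and no conversion of reals into naturals). Every operation costs one step. -/

/-- The contents of the memory: registers and arrays, by name. -/
structure Store where
  natReg : ℕ → ℕ
  natArr : ℕ → ℕ → ℕ
  realReg : ℕ → ℝ
  realArr : ℕ → ℕ → ℝ

namespace Store

def writeNat (s : Store) (x v : ℕ) : Store :=
  { s with natReg := Function.update s.natReg x v }

def writeNatArr (s : Store) (x i v : ℕ) : Store :=
  { s with natArr := Function.update s.natArr x (Function.update (s.natArr x) i v) }

def writeReal (s : Store) (x : ℕ) (v : ℝ) : Store :=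
  { s with realReg := Function.update s.realReg x v }

def writeRealArr (s : Store) (x i : ℕ) (v : ℝ) : Store :=
  { s with realArr := Function.update s.realArr x (Function.update (s.realArr x) i v) }

end Store

inductive NatExpr : Type
  | const (c : ℕ)
  | reg (x : ℕ)
  | arr (x : ℕ) (i : NatExpr)
  | add (a b : NatExpr)
  | sub (a b : NatExpr)

namespace NatExpr

/-- The value of an expression; subtraction is truncated. -/
def eval (s : Store) : NatExpr → ℕ
  | const c => c
  | reg x => s.natReg x
  | arr x i => s.natArr x (i.eval s)
  | add a b => a.eval s + b.eval s
  | sub a b => a.eval s - b.eval s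

/-- The number of steps for the evaluation. -/
def size : NatExpr → ℕ
  | const _ => 1
  | reg _ => 1
  | arr _ i => i.size + 1
  | add a b => a.size + b.size + 1
  | sub a b => a.size + b.size + 1

end NatExpr

inductive RealExpr : Type
  | zero
  | reg (x : ℕ)
  | arr (x : ℕ) (i : NatExpr)
  | add (a b : RealExpr)
  | sub (a b : RealExpr)

namespace RealExpr

def eval (s : Store) : RealExpr → ℝ
  | zero => 0
  | reg x => s.realReg x
  | arr x i => s.realArr x (i.eval s)
  | add a b => a.eval s + b.eval s
  | sub a b => a.eval s - b.eval s

def size : RealExpr → ℕ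
  | zero => 1
  | reg _ => 1
  | arr _ i => i.size + 1
  | add a b => a.size + b.size + 1
  | sub a b => a.size + b.size + 1

end RealExpr

inductive Test : Type
  | natLe (a b : NatExpr)
  | realLe (a b : RealExpr)
  | neg (t : Test)
  | both (t u : Test)

namespace Test

def eval (s : Store) : Test → Prop
  | natLe a b => a.eval s ≤ b.eval s
  | realLe a b => a.eval s ≤ b.eval s
  | neg t => ¬ t.eval s
  | both t u => t.eval s ∧ u.eval s

def size : Test → ℕ
  | natLe a b => a.size + b.size + 1
  | realLe a b => a.size + b.size + 1
  | neg t => t.size + 1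
  | both t u => t.size + u.size + 1

end Test

/-- Programs: assignments to registers and to array entries, sequencing, branching, while loops. -/
inductive Program : Type
  | skip
  | setNat (x : ℕ) (v : NatExpr)
  | setNatArr (x : ℕ) (i v : NatExpr)
  | setReal (x : ℕ) (v : RealExpr)
  | setRealArr (x : ℕ) (i : NatExpr) (v : RealExpr)
  | seq (p q : Program)
  | branch (t : Test) (p q : Program)
  | loop (t : Test) (p : Program)

namespace Program

/-- `Exec p s k s'`: the program `p`, started in `s`, halts in `s'` after exactly `k` steps. -/
inductive Exec : Program → Store → ℕ → Store → Prop
  | skip (s : Store) : Exec skip s 1 s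
  | setNat (s : Store) (x : ℕ) (v : NatExpr) :
      Exec (setNat x v) s (v.size + 1)
        (s.writeNat x (v.eval s))
  | setNatArr (s : Store) (x : ℕ) (i v : NatExpr) :
      Exec (setNatArr x i v) s (i.size + v.size + 1)
        (s.writeNatArr x (i.eval s) (v.eval s))
  | setReal (s : Store) (x : ℕ) (v : RealExpr) :
      Exec (setReal x v) s (v.size + 1)
        (s.writeReal x (v.eval s))
  | setRealArr (s : Store) (x : ℕ) (i : NatExpr) (v : RealExpr) :
      Exec (setRealArr x i v) s (i.size + v.size + 1)
        (s.writeRealArr x (i.eval s) (v.eval s))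
  | seq {p q : Program} {s s' s'' : Store} {j k : ℕ} :
      Exec p s j s' → Exec q s' k s'' → Exec (seq p q) s (j + k) s''
  | branch_true {t : Test} {p q : Program} {s s' : Store} {k : ℕ} :
      t.eval s → Exec p s k s' → Exec (branch t p q) s (t.size + k) s'
  | branch_false {t : Test} {p q : Program} {s s' : Store} {k : ℕ} :
      ¬ t.eval s → Exec q s k s' → Exec (branch t p q) s (t.size + k) s'
  | loop_true {t : Test} {p : Program} {s s' s'' : Store} {j k : ℕ} :
      t.eval s → Exec p s j s' → Exec (loop t p) s' k s'' →
        Exec (loop t p) s (t.size + j + k) s''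
  | loop_false {t : Test} {p : Program} {s : Store} :
      ¬ t.eval s → Exec (loop t p) s t.size s

end Program

namespace LineCoverage

variable {n m : ℕ}

/-- The input of a program. Registers 0 and 1 hold the numbers of vertices and of edges; the
arrays of naturals 0, 1, 2 hold the two ends of the edges and the flags of the required edges; the
arrays of reals 0, 1 hold the service costs of the arcs `(e, true)` and `(e, false)`, and 2, 3 their
deadhead costs. All other memory is zero. -/
def input (G : LineCoverage n m) : Store where
  natReg := fun x => if x = 0 then n else if x = 1 then m else 0
  natArr := fun x i =>
    if h : i < m then
      if x = 0 then (G.src ⟨i, h⟩ : ℕ)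
      else if x = 1 then (G.tgt ⟨i, h⟩ : ℕ)
      else if x = 2 then (if (⟨i, h⟩ : Fin m) ∈ G.req then 1 else 0)
      else 0
    else 0
  realReg := fun _ => 0
  realArr := fun x i =>
    if h : i < m then
      if x = 0 then G.serviceCost (⟨i, h⟩, true)
      else if x = 1 then G.serviceCost (⟨i, h⟩, false)
      else if x = 2 then G.deadheadCost (⟨i, h⟩, true)
      else if x = 3 then G.deadheadCost (⟨i, h⟩, false)
      else 0
    else 0

end LineCoverage

/-- The store holds the output `D` in the arrays of naturals 3 to 8: the service copies, the
deadheading copies and the flags of the ambiguous arcs, each for the arcs `(e, true)` and then for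
the arcs `(e, false)`. -/
def Store.Holds {m : ℕ} (s : Store) (D : LPOutput m) : Prop :=
  ∀ e : Fin m,
    s.natArr 3 e = D.service (e, true) ∧ s.natArr 4 e = D.service (e, false) ∧
    s.natArr 5 e = D.deadhead (e, true) ∧ s.natArr 6 e = D.deadhead (e, false) ∧
    s.natArr 7 e = (if (e, true) ∈ D.ambiguous then 1 else 0) ∧
    s.natArr 8 e = (if (e, false) ∈ D.ambiguous then 1 else 0)

end

/-! The multiset of traversals of a coverage tour is balanced at every vertex. Turning a selected
arc around changes the imbalance at its ends by two, so two units on the reversal arc for each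
reversed service, together with the deadheadings, form a feasible flow of the flow digraph
(`ServicesOnce.flowOf_mem_feasible`). The halved reversal cost makes the tour cost equal to the flow
cost plus the constant sum of the service costs of the selected arcs (`ServicesOnce.cost`). Hence a
minimum cost flow bounds every tour from below. Conversely, a minimum cost flow with reversal values
in {0, 2} and natural deadhead values gives a balanced multigraph of the matching cost. It is
connected: the required edges hang together, and a component away from them would be a circulation
of deadheadings, which could be deleted at a profit because deadheading costs are positive. Euler's
theorem (`exists_eulerian_diwalk`) then yields an optimal tour; this is `solvedBy_of_isMinCostFlow`.
What remains is parity. The imbalance of the selected arcs at a vertex has the parity of the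
required degree, so for an Eulerian required graph all demands are even, and the finite capacities
are 2. For a vertex of the flow polyhedron, the arcs whose flow is not an even integer would support
a circulation along which the flow moves both ways; so all its values are even
(`mem_zmultiples_of_mem_extremePoints`). This gives the second part. For the first part the program
runs a primal-dual method of successive shortest paths. It keeps residual capacities and a node
potential under which every available residual arc has nonnegative reduced cost (`Net.Good`). A
round grows a tree of tight arcs from a vertex with missing outflow to one with missing inflow, as
in Dijkstra's algorithm, and sends `u` units along the tree path. The unit `u` is 2 if all demands
are even and 1 otherwise, and divisibility by `u` is invariant, so evenness holds by construction.
The demands are bounded by the number of arcs, so single-unit augmentations are affordable. Costs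
are doubled to avoid the division by 2, and the potential at the end certifies optimality
(`isMinCostFlow_of_potential`). -/

namespace LineCoverage

variable {n m : ℕ}

/-! ### Diwalks and Euler's theorem for directed multigraphs -/

theorem isDiwalk_append (G : LineCoverage n m) (l₁ l₂ : List (Arc m × Bool)) (u w : Fin n) :
    G.IsDiwalk u (l₁ ++ l₂) w ↔ ∃ v, G.IsDiwalk u l₁ v ∧ G.IsDiwalk v l₂ w := by
  induction l₁ generalizing u with
  | nil => simp [IsDiwalk]
  | cons x l ih =>
    simp only [List.cons_append, IsDiwalk, ih]
    constructor
    · rintro ⟨h, v, h1, h2⟩; exact ⟨v, ⟨h, h1⟩, h2⟩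
    · rintro ⟨v, ⟨h, h1⟩, h2⟩; exact ⟨h, v, h1, h2⟩

theorem list_sum_map_eq_sum_count {X : Type*} [Fintype X] [BEq X] [LawfulBEq X] (l : List X)
    (w : X → ℝ) : (l.map w).sum = ∑ x, (l.count x : ℝ) * w x := by
  induction l with
  | nil => simp
  | cons y l ih =>
    simp only [List.map_cons, List.sum_cons, ih, List.count_cons, Nat.cast_add, add_mul,
      Finset.sum_add_distrib, beq_iff_eq]
    rw [add_comm, add_left_cancel_iff, Finset.sum_eq_single y (fun b _ hb => by simp [hb.symm]) (by simp)]
    simp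

theorem list_length_eq_sum_count {X : Type*} [Fintype X] [BEq X] [LawfulBEq X] (l : List X) :
    l.length = ∑ x, l.count x := by
  induction l with
  | nil => simp
  | cons y l ih =>
    simp only [List.length_cons, ih, List.count_cons, Finset.sum_add_distrib, beq_iff_eq]
    rw [add_left_cancel_iff, Finset.sum_eq_single y (fun b _ hb => by simp [hb.symm]) (by simp)]
    simp

/-- The potential difference along a diwalk telescopes. -/
theorem IsDiwalk.sum_count {G : LineCoverage n m} {l : List (Arc m × Bool)} {u v : Fin n}
    (h : G.IsDiwalk u l v) (φ : Fin n → ℝ) :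
    ∑ x, (l.count x : ℝ) * (φ (G.head x.1) - φ (G.tail x.1)) = φ v - φ u := by
  rw [← list_sum_map_eq_sum_count]
  induction l generalizing u with
  | nil => simp only [IsDiwalk] at h; simp [h]
  | cons x l ih => obtain ⟨h1, h2⟩ := h; rw [List.map_cons, List.sum_cons, ih h2, h1]; ring

/-- Both ends of a used arc cut the walk in two; a closed walk can then be rotated to start there.
-/
theorem IsDiwalk.ends_mem {G : LineCoverage n m} {l : List (Arc m × Bool)} {u v : Fin n}
    (h : G.IsDiwalk u l v) {x : Arc m × Bool} (hx : x ∈ l) :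
    (∃ l₁ l₂, l = l₁ ++ l₂ ∧ G.IsDiwalk u l₁ (G.tail x.1) ∧ G.IsDiwalk (G.tail x.1) l₂ v) ∧
    ∃ l₁ l₂, l = l₁ ++ l₂ ∧ G.IsDiwalk u l₁ (G.head x.1) ∧ G.IsDiwalk (G.head x.1) l₂ v := by
  obtain ⟨l₁, l₂, rfl⟩ := List.append_of_mem hx
  obtain ⟨w, h1, h2, h3⟩ := (G.isDiwalk_append _ _ _ _).1 h
  subst h2
  refine ⟨⟨l₁, x :: l₂, rfl, h1, rfl, h3⟩, ⟨l₁ ++ [x], l₂, by simp, ?_, h3⟩⟩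
  exact (G.isDiwalk_append _ _ _ _).2 ⟨_, h1, rfl, rfl⟩

/-- Euler's theorem for directed multigraphs; the multigraph contains `μ x` copies of the
traversal `x`. -/
theorem exists_eulerian_diwalk (G : LineCoverage n m) (μ : Arc m × Bool → ℕ)
    (hb : ∀ φ : Fin n → ℝ, ∑ x, (μ x : ℝ) * (φ (G.head x.1) - φ (G.tail x.1)) = 0)
    (hc : ∀ W : Set (Fin n), (∀ x, 0 < μ x → (G.tail x.1 ∈ W ↔ G.head x.1 ∈ W)) →
      (∃ x, 0 < μ x ∧ G.tail x.1 ∈ W) → ∀ x, 0 < μ x → G.tail x.1 ∈ W) (v₀ : Fin n) :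
    ∃ v l, G.IsDiwalk v l v ∧ ∀ x, l.count x = μ x := by
  classical
  let P : ℕ → Prop := fun k => ∃ u v l, G.IsDiwalk u l v ∧ (∀ x, l.count x ≤ μ x) ∧ l.length = k
  have hP0 : P 0 := ⟨v₀, v₀, [], rfl, by simp, rfl⟩
  have hbd : ∀ k, P k → k ≤ ∑ x, μ x := by
    rintro k ⟨u, v, l, -, h, rfl⟩
    rw [list_length_eq_sum_count]
    exact Finset.sum_le_sum fun x _ => h x
  obtain ⟨u, v, l, hl, hcount, hlen⟩ := Nat.findGreatest_spec (Nat.zero_le (∑ x, μ x)) hP0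
  have hmax : ∀ u v l', G.IsDiwalk u l' v → (∀ x, l'.count x ≤ μ x) → l'.length ≤ l.length := by
    intro u v l' h1 h2
    rw [hlen]
    exact Nat.le_findGreatest (hbd _ ⟨u, v, l', h1, h2, rfl⟩) ⟨u, v, l', h1, h2, rfl⟩
  -- The balance of the unused copies is that of a path from `v` back to `u`.
  have hν : ∀ φ : Fin n → ℝ, ∑ x, ((μ x : ℝ) - l.count x) *
      (φ (G.head x.1) - φ (G.tail x.1)) = φ u - φ v := by
    intro φ
    simp only [sub_mul, Finset.sum_sub_distrib, hb φ, hl.sum_count φ]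
    ring
  have hν0 : ∀ x, (0 : ℝ) ≤ (μ x : ℝ) - l.count x := fun x =>
    sub_nonneg.2 (Nat.cast_le.2 (hcount x))
  -- An unused copy leaving the last vertex `v` would extend the longest trail.
  have hext : ∀ x, G.tail x.1 = v → l.count x = μ x := by
    intro x hx
    by_contra hne
    have h1 := hmax u (G.head x.1) (l ++ [x])
      ((G.isDiwalk_append _ _ _ _).2 ⟨v, hl, hx, rfl⟩) (fun y => by
        have := hcount y
        have := hcount x
        by_cases hxy : x = y
        · subst hxy; simp; omega
        · simp [hxy]; omega)
    simp at h1
  have huv : u = v := by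
    by_contra hne
    -- Tested with the indicator of `v`: no unused copy leaves `v`, so the sum is nonnegative, but
    -- it would be -1 if `u ≠ v`.
    have h1 := hν (fun w => if w = v then 1 else 0)
    have h2 : (0 : ℝ) ≤ ∑ x, ((μ x : ℝ) - l.count x) *
        ((if G.head x.1 = v then 1 else 0) - (if G.tail x.1 = v then 1 else 0)) := by
      refine Finset.sum_nonneg fun x _ => ?_
      by_cases hx : G.tail x.1 = v
      · simp [hext x hx]
      · have := hν0 x
        simp only [hx, if_false, sub_zero]
        split_ifs <;> linarith
    rw [h1] at h2
    simp [hne] at h2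
    linarith
  subst huv
  -- The trail is closed, so it may be rotated to end at any of its vertices `w` and extended there.
  have hrot : ∀ l₁ l₂ w, l = l₁ ++ l₂ → G.IsDiwalk u l₁ w → G.IsDiwalk w l₂ u →
      ∀ x, G.tail x.1 = w → l.count x = μ x := by
    intro l₁ l₂ w hll h1 h2 x hx
    by_contra hne
    have h3 := hmax w (G.head x.1) ((l₂ ++ l₁) ++ [x])
      ((G.isDiwalk_append _ _ _ _).2 ⟨w, (G.isDiwalk_append _ _ _ _).2 ⟨u, h2, h1⟩, hx, rfl⟩)
      (fun y => by
        have := hcount y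
        have := hcount x
        rw [hll] at this hne
        subst hll
        by_cases hxy : x = y
        · subst hxy; simp at *; omega
        · simp [hxy] at *; omega)
    rw [hll] at h3
    simp at h3
    omega
  let W : Set (Fin n) := {w | ∃ l₁ l₂, l = l₁ ++ l₂ ∧ G.IsDiwalk u l₁ w ∧ G.IsDiwalk w l₂ u}
  have hWt : ∀ x, G.tail x.1 ∈ W → l.count x = μ x := by
    rintro x ⟨l₁, l₂, h1, h2, h3⟩
    exact hrot l₁ l₂ _ h1 h2 h3 x rfl
  have hWh : ∀ x, G.head x.1 ∈ W → l.count x = μ x := by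
    -- No unused copy leaves the set `W` of vertices on the trail; by balance none enters it either.
    have h1 := hν (fun w => if w ∈ W then 1 else 0)
    rw [sub_self] at h1
    have h2 : ∀ x ∈ Finset.univ, (0 : ℝ) ≤ ((μ x : ℝ) - l.count x) *
        ((if G.head x.1 ∈ W then 1 else 0) - (if G.tail x.1 ∈ W then 1 else 0)) := by
      intro x _
      by_cases hx : G.tail x.1 ∈ W
      · simp [hWt x hx]
      · have := hν0 x
        simp only [hx, if_false, sub_zero]
        split_ifs <;> linarith
    intro x hx
    have h3 := (Finset.sum_eq_zero_iff_of_nonneg h2).1 h1 x (Finset.mem_univ x)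
    by_cases hx' : G.tail x.1 ∈ W
    · exact hWt x hx'
    · simp [hx, hx'] at h3
      exact_mod_cast (sub_eq_zero.1 h3).symm
  refine ⟨u, l, hl, fun x => ?_⟩
  by_contra hne
  have hxpos : 0 < μ x := by have := hcount x; omega
  -- The connectivity hypothesis needs some arc inside `W`, which an empty trail would not supply.
  have hlpos : l ≠ [] := by
    rintro rfl
    have := hmax (G.tail x.1) (G.head x.1) [x] ⟨rfl, rfl⟩ (fun y => by
      by_cases hxy : x = y
      · subst hxy; simp; omega
      · simp [hxy])
    simp at this
  obtain ⟨y, hy⟩ := List.exists_mem_of_ne_nil l hlpos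
  refine hne (hWt x (hc W (fun z hz => ?_) ⟨y, ?_, (hl.ends_mem hy).1⟩ x hxpos))
  · by_cases hzl : z ∈ l
    · exact iff_of_true (hl.ends_mem hzl).1 (hl.ends_mem hzl).2
    · have h0 : l.count z ≠ μ z := by rw [List.count_eq_zero_of_not_mem hzl]; omega
      exact iff_of_false (fun h => h0 (hWt z h)) (fun h => h0 (hWh z h))
  · exact lt_of_lt_of_le (List.count_pos_iff.2 hy) (hcount y)

end LineCoverage

/-! ### Coverage tours as flows -/

/-- Conservation at all vertices is a family of linear equations; their combinations with weights
`φ` are the tests against potentials, and indicators recover the single equations. In this form no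
sums over the arcs at a vertex have to be handled later. -/
theorem FlowDigraph.mem_feasible_iff {V A : Type} [DecidableEq V] [Fintype V] [Fintype A]
    (D : FlowDigraph V A) (f : A → ℝ) :
    f ∈ D.feasible ↔ (∀ a, 0 ≤ f a ∧ (f a : WithTop ℝ) ≤ D.cap a) ∧
      ∀ φ : V → ℝ, ∑ a, f a * (φ (D.head a) - φ (D.tail a)) = ∑ v, D.demand v * φ v := by
  have key : ∀ (q : A → V) (φ : V → ℝ),
      ∑ a, f a * φ (q a) = ∑ v, (∑ a with q a = v, f a) * φ v := by
    intro q φ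
    rw [← Finset.sum_fiberwise_of_maps_to (s := Finset.univ) (t := Finset.univ) (g := q)
      (fun _ _ => Finset.mem_univ _)]
    refine Finset.sum_congr rfl fun v _ => ?_
    rw [Finset.sum_mul]
    refine Finset.sum_congr rfl fun a ha => ?_
    rw [(Finset.mem_filter.1 ha).2]
  refine and_congr_right fun _ => ⟨fun h φ => ?_, fun h v => ?_⟩
  · simp only [mul_sub, Finset.sum_sub_distrib, key]
    rw [← Finset.sum_sub_distrib]
    refine Finset.sum_congr rfl fun v _ => ?_
    rw [← sub_mul, h]
  · have h1 := h (fun w => if w = v then 1 else 0)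
    simp only [mul_sub, Finset.sum_sub_distrib, key D.head (fun w => if w = v then 1 else 0),
      key D.tail (fun w => if w = v then 1 else 0)] at h1
    simpa using h1

namespace LineCoverage

variable {n m : ℕ}

@[simp] theorem minArc_fst (G : LineCoverage n m) (e : Fin m) : (G.minArc e).1 = e := by
  unfold minArc; split_ifs <;> rfl

@[simp] theorem tail_rev (G : LineCoverage n m) (a : Arc m) : G.tail a.rev = G.head a := by
  rcases a with ⟨e, _ | _⟩ <;> simp [tail, head, Arc.rev]

@[simp] theorem head_rev (G : LineCoverage n m) (a : Arc m) : G.head a.rev = G.tail a := by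
  rcases a with ⟨e, _ | _⟩ <;> simp [tail, head, Arc.rev]

theorem minArc_rev_ne (G : LineCoverage n m) (e : Fin m) : (G.minArc e).rev ≠ G.minArc e := by
  intro h; have := congrArg Prod.snd h; simp [Arc.rev] at this

/-- A sum over the arcs, split by edges into the selected arcs and their opposites. -/
theorem sum_arc (G : LineCoverage n m) {M : Type*} [AddCommMonoid M] (w : Arc m → M) :
    ∑ a, w a = ∑ e, (w (G.minArc e) + w (G.minArc e).rev) := by
  rw [Fintype.sum_prod_type]
  refine Finset.sum_congr rfl fun e _ => ?_
  unfold minArc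
  split_ifs <;> simp [Arc.rev, add_comm]

theorem eq_minArc_or (G : LineCoverage n m) (a : Arc m) :
    a = G.minArc a.1 ∨ a = (G.minArc a.1).rev := by
  rcases a with ⟨e, _ | _⟩ <;> unfold minArc <;> split_ifs <;> simp [Arc.rev]

theorem sum_minCostDigraph (G : LineCoverage n m) (w : Arc m → ℝ) :
    ∑ a ∈ G.minCostDigraph, w a = ∑ e ∈ G.req, w (G.minArc e) :=
  Finset.sum_image fun e _ e' _ h => by
    have := congrArg Prod.fst h
    simpa using this

theorem sum_imbalance_mul (G : LineCoverage n m) (φ : Fin n → ℝ) :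
    ∑ v, (G.imbalance G.minCostDigraph v : ℝ) * φ v =
      ∑ e ∈ G.req, (φ (G.tail (G.minArc e)) - φ (G.head (G.minArc e))) := by
  rw [← G.sum_minCostDigraph (fun a => φ (G.tail a) - φ (G.head a))]
  have key : ∀ q : Arc m → Fin n, ∑ v, ((G.minCostDigraph.filter (fun a => q a = v)).card : ℝ) * φ v
      = ∑ a ∈ G.minCostDigraph, φ (q a) := by
    intro q
    rw [← Finset.sum_fiberwise_of_maps_to (t := Finset.univ) (g := q)
      (fun _ _ => Finset.mem_univ _)]
    refine Finset.sum_congr rfl fun v _ => ?_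
    rw [Finset.sum_congr rfl (g := fun _ => φ v) fun a ha => by rw [(Finset.mem_filter.1 ha).2]]
    simp
  simp only [imbalance, Int.cast_sub, Int.cast_natCast, sub_mul, Finset.sum_sub_distrib, key]

/-- The feasible flows of the flow digraph, in terms of node potentials. -/
theorem mem_feasible_flowDigraph_iff (G : LineCoverage n m) (f : G.FlowArc → ℝ) :
    f ∈ G.flowDigraph.feasible ↔ (∀ a, 0 ≤ f (Sum.inl a)) ∧
      (∀ e, 0 ≤ f (Sum.inr e) ∧ f (Sum.inr e) ≤ 2) ∧
      ∀ φ : Fin n → ℝ, ∑ a, f (Sum.inl a) * (φ (G.head a) - φ (G.tail a)) +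
        ∑ e : {e // e ∈ G.req}, f (Sum.inr e) *
          (φ (G.tail (G.minArc e)) - φ (G.head (G.minArc e))) =
        ∑ e : {e // e ∈ G.req}, (φ (G.tail (G.minArc e)) - φ (G.head (G.minArc e))) := by
  rw [FlowDigraph.mem_feasible_iff]
  simp only [Sum.forall, Fintype.sum_sum_type, flowDigraph, Sum.elim_inl, Sum.elim_inr, le_top,
    and_true, WithTop.coe_le_coe, sum_imbalance_mul, and_assoc]
  simp only [← Finset.sum_coe_sort G.req]

theorem flowCost_flowDigraph (G : LineCoverage n m) (f : G.FlowArc → ℝ) :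
    G.flowDigraph.flowCost f = ∑ a, G.deadheadCost a * f (Sum.inl a) +
      ∑ e : {e // e ∈ G.req}, (G.serviceCost (G.minArc e).rev - G.serviceCost (G.minArc e)) / 2 *
        f (Sum.inr e) := by
  simp [FlowDigraph.flowCost, flowDigraph, Fintype.sum_sum_type]

/-- The flow of a multiset of traversals: the deadheadings, and two units for each reversed
service. -/
noncomputable def flowOf (G : LineCoverage n m) (μ : Arc m × Bool → ℕ) : G.FlowArc → ℝ :=
  Sum.elim (fun a => (μ (a, false) : ℝ)) (fun e => 2 * (μ ((G.minArc e).rev, true) : ℝ))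

/-- Each required edge is serviced once by the multiset `μ` of traversals, and no other edge. -/
def ServicesOnce (G : LineCoverage n m) (μ : Arc m × Bool → ℕ) : Prop :=
  ∀ e, μ (G.minArc e, true) + μ ((G.minArc e).rev, true) = if e ∈ G.req then 1 else 0

/-- Balance and cost are both such sums. On a required edge the count of the selected direction is 1
minus that of the reversed one, which leaves the reversed count as the only variable. -/
theorem ServicesOnce.sum {G : LineCoverage n m} {μ : Arc m × Bool → ℕ} (h : G.ServicesOnce μ)
    (w : Arc m × Bool → ℝ) :
    ∑ x, (μ x : ℝ) * w x = ∑ a, (μ (a, false) : ℝ) * w (a, false) +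
      ∑ e : {e // e ∈ G.req}, (w (G.minArc e, true) + (μ ((G.minArc e).rev, true) : ℝ) *
        (w ((G.minArc e).rev, true) - w (G.minArc e, true))) := by
  have h1 : ∑ x, (μ x : ℝ) * w x = ∑ a, (μ (a, false) : ℝ) * w (a, false) +
      ∑ a, (μ (a, true) : ℝ) * w (a, true) := by
    rw [Fintype.sum_prod_type, ← Finset.sum_add_distrib]
    simp [add_comm]
  rw [h1, G.sum_arc (fun a => (μ (a, true) : ℝ) * w (a, true)),
    Finset.sum_coe_sort G.req (fun e => w (G.minArc e, true) + (μ ((G.minArc e).rev, true) : ℝ) *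
        (w ((G.minArc e).rev, true) - w (G.minArc e, true))),
    ← Finset.sum_filter_add_sum_filter_not Finset.univ (· ∈ G.req), Finset.filter_univ_mem,
    Finset.sum_eq_zero (s := Finset.filter (fun e => ¬ e ∈ G.req) Finset.univ), add_zero]
  · congr 1
    refine Finset.sum_congr rfl fun e he => ?_
    have h2 := h e
    rw [if_pos he] at h2
    have h3 : (μ (G.minArc e, true) : ℝ) = 1 - μ ((G.minArc e).rev, true) := by
      rw [eq_sub_iff_add_eq]; exact_mod_cast h2
    rw [h3]; ring
  · intro e he
    have h2 := h e
    rw [if_neg (Finset.mem_filter.1 he).2] at h2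
    have h3 : μ (G.minArc e, true) = 0 := by omega
    have h4 : μ ((G.minArc e).rev, true) = 0 := by omega
    simp [h3, h4]

/-- Service in the selected direction contributes minus the share of the edge in the demand; a
reversed service cancels this and contributes its opposite, which is two units on the reversal arc.
-/
theorem ServicesOnce.flowOf_mem_feasible {G : LineCoverage n m} {μ : Arc m × Bool → ℕ}
    (h : G.ServicesOnce μ) : G.flowOf μ ∈ G.flowDigraph.feasible ↔
      ∀ φ : Fin n → ℝ, ∑ x, (μ x : ℝ) * (φ (G.head x.1) - φ (G.tail x.1)) = 0 := by
  rw [mem_feasible_flowDigraph_iff]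
  have h1 : ∀ e, (μ ((G.minArc e).rev, true) : ℝ) ≤ 1 := by
    intro e
    have h2 := h e
    split_ifs at h2 <;> norm_cast <;> omega
  refine ⟨fun ⟨_, _, h3⟩ φ => ?_, fun h3 => ⟨fun a => by simp [flowOf], fun e => ⟨by simp [flowOf], ?_⟩,
    fun φ => ?_⟩⟩
  · have := h3 φ
    rw [← sub_eq_zero] at this
    rw [← this, h.sum, add_sub_assoc, ← Finset.sum_sub_distrib]
    simp only [flowOf, Sum.elim_inl, Sum.elim_inr]
    congr 1
    refine Finset.sum_congr rfl fun e _ => ?_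
    simp only [head_rev, tail_rev]; ring
  · have := h1 e; simp only [flowOf, Sum.elim_inr]; linarith
  · have := h3 φ
    rw [← sub_eq_zero]
    rw [← this, h.sum, add_sub_assoc, ← Finset.sum_sub_distrib]
    simp only [flowOf, Sum.elim_inl, Sum.elim_inr]
    congr 1
    refine Finset.sum_congr rfl fun e _ => ?_
    simp only [head_rev, tail_rev]; ring

/-- The factor 2 in `flowOf` cancels the factor 1/2 in the reversal costs. -/
theorem ServicesOnce.cost {G : LineCoverage n m} {μ : Arc m × Bool → ℕ} (h : G.ServicesOnce μ) :
    ∑ x, (μ x : ℝ) * (if x.2 then G.serviceCost x.1 else G.deadheadCost x.1) =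
      G.flowDigraph.flowCost (G.flowOf μ) + ∑ e : {e // e ∈ G.req}, G.serviceCost (G.minArc e) := by
  rw [h.sum, flowCost_flowDigraph, add_assoc, ← Finset.sum_add_distrib]
  simp only [flowOf, Sum.elim_inl, Sum.elim_inr, if_true]
  congr 1
  · exact Finset.sum_congr rfl fun a _ => by simp [mul_comm]
  · exact Finset.sum_congr rfl fun a _ => by ring

end LineCoverage

/-! ### From minimum cost flows to optimal tours -/

namespace LineCoverage

variable {n m : ℕ}

theorem countP_service (G : LineCoverage n m) (l : List (Arc m × Bool)) (e : Fin m) :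
    l.countP (fun x => x.1.1 = e ∧ x.2 = true) =
      l.count (G.minArc e, true) + l.count ((G.minArc e).rev, true) := by
  induction l with
  | nil => simp
  | cons x l ih =>
    rw [List.countP_cons, ih, List.count_cons, List.count_cons]
    have key : (if (decide (x.1.1 = e ∧ x.2 = true)) = true then 1 else 0) =
        (if (x == (G.minArc e, true)) = true then 1 else 0) +
        (if (x == ((G.minArc e).rev, true)) = true then 1 else 0) := by
      rcases x with ⟨a, _ | _⟩
      · simp
      · by_cases hae : a.1 = e
        · subst hae
          rcases G.eq_minArc_or a with h | h
          · have := G.minArc_rev_ne a.1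
            simp [← h]
            intro h'; rw [← h, ← h'] at this; exact this rfl
          · have h2 := G.minArc_rev_ne a.1
            simp [← h]
            rw [← h] at h2
            exact h2
        · have h1 : a ≠ G.minArc e := fun h => hae (by rw [h, minArc_fst])
          have h2 : a ≠ (G.minArc e).rev := fun h => hae (by rw [h]; simp [Arc.rev])
          simp [hae, h1, h2]
    rw [key]; ring

theorem isCoverageTour_iff (G : LineCoverage n m) (l : List (Arc m × Bool)) :
    G.IsCoverageTour l ↔ (∃ v, G.IsDiwalk v l v) ∧ G.ServicesOnce (fun x => l.count x) := by
  simp only [IsCoverageTour, ServicesOnce, G.countP_service]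

theorem tourCost_eq (G : LineCoverage n m) {l : List (Arc m × Bool)}
    (h : G.ServicesOnce (fun x => l.count x)) :
    G.tourCost l = G.flowDigraph.flowCost (G.flowOf (fun x => l.count x)) +
      ∑ e : {e // e ∈ G.req}, G.serviceCost (G.minArc e) := by
  rw [← h.cost, tourCost, list_sum_map_eq_sum_count]

/-- A component of the support of a minimum cost flow contains a required vertex, or no flow. -/
theorem IsMinCostFlow.zero_of_closed {G : LineCoverage n m} {f : G.FlowArc → ℝ}
    (hf : G.flowDigraph.IsMinCostFlow f) (W : Set (Fin n))
    (hW : ∀ a, 0 < f (Sum.inl a) → (G.tail a ∈ W ↔ G.head a ∈ W))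
    (hr : ∀ e ∈ G.req, G.tail (G.minArc e) ∉ W ∧ G.head (G.minArc e) ∉ W) (a : Arc m)
    (ha : G.tail a ∈ W) : f (Sum.inl a) = 0 := by
  classical
  obtain ⟨hfeas, hmin⟩ := hf
  obtain ⟨h1, h2, h3⟩ := (G.mem_feasible_flowDigraph_iff f).1 hfeas
  -- The competitor drops all deadheading inside `W`.
  let g : G.FlowArc → ℝ :=
    Sum.elim (fun a => if G.tail a ∈ W then 0 else f (Sum.inl a)) (fun e => f (Sum.inr e))
  have hg : g ∈ G.flowDigraph.feasible := by
    rw [mem_feasible_flowDigraph_iff]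
    refine ⟨fun a => ?_, h2, fun φ => ?_⟩
    · simp only [g, Sum.elim_inl]; split_ifs
      · exact le_rfl
      · exact h1 a
    -- Conservation for `g` against `φ` is conservation for `f` against `φ` cut off to 0 on `W`,
    -- since arcs with flow lie inside `W` or outside, and required edges lie outside.
    · have h4 := h3 (fun v => if v ∈ W then 0 else φ v)
      convert h4 using 2
      · refine Finset.sum_congr rfl fun a _ => ?_
        rcases (h1 a).eq_or_lt with h0 | h0
        · simp [g, ← h0]
        · have := hW a h0
          by_cases hta : G.tail a ∈ W
          · simp [g, hta, this.1 hta]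
          · simp [g, hta, mt this.2 hta]
      · refine Finset.sum_congr rfl fun e _ => ?_
        simp [g, (hr e e.2).1, (hr e e.2).2]
      · simp [(hr _ (Subtype.prop _)).1, (hr _ (Subtype.prop _)).2]
  have h5 := hmin g hg
  rw [flowCost_flowDigraph, flowCost_flowDigraph] at h5
  simp only [g, Sum.elim_inl, Sum.elim_inr, add_le_add_iff_right] at h5
  have h6 : ∀ b ∈ Finset.univ, 0 ≤ G.deadheadCost b * f (Sum.inl b) -
      G.deadheadCost b * (if G.tail b ∈ W then 0 else f (Sum.inl b)) := by
    intro b _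
    have := mul_nonneg (G.deadheadCost_pos b).le (h1 b)
    split_ifs <;> simp [this]
  have h7 : ∑ b, (G.deadheadCost b * f (Sum.inl b) -
      G.deadheadCost b * (if G.tail b ∈ W then 0 else f (Sum.inl b))) = 0 := by
    refine le_antisymm ?_ (Finset.sum_nonneg h6)
    rw [Finset.sum_sub_distrib]; linarith
  have h8 := (Finset.sum_eq_zero_iff_of_nonneg h6).1 h7 a (Finset.mem_univ a)
  simpa [ha, (G.deadheadCost_pos a).ne'] using h8

/-- Connectivity in the form used below: a vertex set that no required edge crosses contains all
required vertices or none. -/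
theorem RequiredEulerian.mem_iff {G : LineCoverage n m} (hE : G.RequiredEulerian)
    (W : Set (Fin n)) (hW : ∀ e ∈ G.req, (G.src e ∈ W ↔ G.tgt e ∈ W)) {u v : Fin n}
    (hu : G.IsRequiredVertex u) (hv : G.IsRequiredVertex v) : u ∈ W ↔ v ∈ W := by
  have h := hE.1 u v hu hv
  rw [SimpleGraph.reachable_iff_reflTransGen] at h
  induction h with
  | refl => rfl
  | @tail x y _ h2 ih =>
    rw [SimpleGraph.fromRel_adj] at h2
    have hx : G.IsRequiredVertex x ∧ (x ∈ W ↔ y ∈ W) := by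
      rcases h2.2 with ⟨e, he, h3, h4⟩ | ⟨e, he, h3, h4⟩
      · subst h3 h4; exact ⟨⟨e, he, Or.inl rfl⟩, hW e he⟩
      · subst h3 h4; exact ⟨⟨e, he, Or.inr rfl⟩, (hW e he).symm⟩
    exact (ih hx.1).trans hx.2

theorem minArc_ends (G : LineCoverage n m) (e : Fin m) (p : Fin n → Fin n → Prop)
    (hp : ∀ u v, p u v → p v u) :
    p (G.tail (G.minArc e)) (G.head (G.minArc e)) ↔ p (G.src e) (G.tgt e) := by
  unfold minArc
  split_ifs
  · rfl
  · exact ⟨hp _ _, hp _ _⟩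

/-- The flow prescribes a multiset of traversals whose `flowOf` is the flow itself. It is balanced
by conservation and connected by minimality, so it has an Euler tour; any other tour gives a
feasible flow of no smaller cost. -/
theorem solvedBy_of_isMinCostFlow {G : LineCoverage n m} (hG : G.Connected)
    (hE : G.RequiredEulerian) {f : G.FlowArc → ℝ} (hf : G.flowDigraph.IsMinCostFlow f)
    (hr : ∀ e, f (Sum.inr e) = 0 ∨ f (Sum.inr e) = 2)
    (hd : ∀ a, ∃ j : ℕ, f (Sum.inl a) = (j : ℝ)) : G.SolvedBy f := by
  classical
  have hdead : ∀ a, f (Sum.inl a) = ((G.lpOutput f).deadhead a : ℝ) := by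
    intro a
    obtain ⟨j, hj⟩ := hd a
    simp [lpOutput, hj]
  have hamb : (G.lpOutput f).ambiguous = ∅ := by
    simp only [lpOutput, Finset.filter_eq_empty_iff]
    rintro a - ⟨h, h1⟩
    rcases hr ⟨a.1, h⟩ with h2 | h2 <;> rw [h1] at h2 <;> norm_num at h2
  let μ : Arc m × Bool → ℕ := fun x =>
    if x.2 then (G.lpOutput f).service x.1 else (G.lpOutput f).deadhead x.1
  have hμt : ∀ a, μ (a, true) = (G.lpOutput f).service a := fun a => rfl
  have hμf : ∀ a, μ (a, false) = (G.lpOutput f).deadhead a := fun a => rfl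
  have hμ : G.ServicesOnce μ := by
    intro e
    rw [hμt, hμt]
    simp only [lpOutput, minArc_fst, show (G.minArc e).rev.1 = e from G.minArc_fst e,
      if_neg (G.minArc_rev_ne e), if_true]
    split_ifs with h1 h2 h3 <;> try rfl
    · rw [h2] at h3; norm_num at h3
    · rcases hr ⟨e, h1⟩ with h | h <;> contradiction
  have hflow : G.flowOf μ = f := by
    funext a
    rcases a with a | ⟨e, he⟩
    · rw [hdead]; rfl
    · simp only [flowOf, Sum.elim_inr, hμt, lpOutput,
        show (G.minArc e).rev.1 = e from G.minArc_fst e, if_neg (G.minArc_rev_ne e), he, dif_pos]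
      rcases hr ⟨e, he⟩ with h | h <;> rw [h] <;> norm_num
  have hreq : ∀ e ∈ G.req, ∃ x, 0 < μ x ∧ x.1.1 = e := by
    intro e he
    have h1 := hμ e
    rw [if_pos he] at h1
    by_cases h2 : 0 < μ (G.minArc e, true)
    · exact ⟨_, h2, G.minArc_fst e⟩
    · exact ⟨((G.minArc e).rev, true), by omega, G.minArc_fst e⟩
  have hserv : ∀ a, 0 < μ (a, true) → a.1 ∈ G.req := by
    intro a ha
    by_contra h
    rw [hμt] at ha
    simp [lpOutput, h] at ha
  have hconn : ∀ W : Set (Fin n), (∀ x, 0 < μ x → (G.tail x.1 ∈ W ↔ G.head x.1 ∈ W)) →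
      (∃ x, 0 < μ x ∧ G.tail x.1 ∈ W) → ∀ x, 0 < μ x → G.tail x.1 ∈ W := by
    intro W hW hx
    have hWd : ∀ a, 0 < f (Sum.inl a) → (G.tail a ∈ W ↔ G.head a ∈ W) := fun a ha =>
      hW (a, false) (by rw [hdead] at ha; exact_mod_cast ha)
    have hWr : ∀ e ∈ G.req, (G.src e ∈ W ↔ G.tgt e ∈ W) := by
      intro e he
      obtain ⟨⟨⟨e', d⟩, b⟩, h1, rfl⟩ := hreq e he
      have h2 := hW _ h1
      cases d
      · exact h2.symm
      · exact h2
    -- A region without required vertices contains no traversal: services have required ends, and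
    -- deadheadings are excluded by `IsMinCostFlow.zero_of_closed`.
    have hzero : ∀ W' : Set (Fin n),
        (∀ a, 0 < f (Sum.inl a) → (G.tail a ∈ W' ↔ G.head a ∈ W')) →
        (∀ v ∈ W', ¬ G.IsRequiredVertex v) → ∀ x, 0 < μ x → G.tail x.1 ∉ W' := by
      rintro W' h1 h2 ⟨a, b⟩ h3 h4
      cases b
      · have h5 := IsMinCostFlow.zero_of_closed hf W' h1 (fun e he =>
          (G.minArc_ends e (fun u v => u ∉ W' ∧ v ∉ W') (fun _ _ h => h.symm)).2
            ⟨fun h => h2 _ h ⟨e, he, Or.inl rfl⟩, fun h => h2 _ h ⟨e, he, Or.inr rfl⟩⟩) a h4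
        rw [hdead] at h5
        have h6 : μ (a, false) = 0 := by exact_mod_cast h5
        omega
      · refine h2 _ h4 ⟨a.1, hserv a h3, ?_⟩
        rcases a with ⟨e, _ | _⟩
        · exact Or.inr rfl
        · exact Or.inl rfl
    -- If `W` meets the required vertices it contains all of them and the complement is empty of
    -- traversals; otherwise `W` itself is, against the assumption.
    by_cases hne : ∃ v ∈ W, G.IsRequiredVertex v
    · obtain ⟨v, hvW, hv⟩ := hne
      intro x hx
      by_contra h
      refine hzero Wᶜ (fun a ha => not_congr (hWd a ha)) (fun u hu hu' => hu ?_) x hx h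
      exact (hE.mem_iff W hWr hv hu').1 hvW
    · push Not at hne
      obtain ⟨x, hx, hxW⟩ := hx
      exact absurd hxW (hzero W hWd hne x hx)
  have hbal : ∀ φ : Fin n → ℝ, ∑ x, (μ x : ℝ) * (φ (G.head x.1) - φ (G.tail x.1)) = 0 :=
    hμ.flowOf_mem_feasible.1 (by rw [hflow]; exact hf.1)
  obtain ⟨v, l, hl, hcount⟩ := G.exists_eulerian_diwalk μ hbal hconn hG.nonempty.some
  have hcount' : (fun x => l.count x) = μ := funext hcount
  have hserv1 : G.ServicesOnce (fun x => l.count x) := by rw [hcount']; exact hμ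
  refine ⟨hr, hdead, hamb, l, fun a => ⟨hcount _, hcount _⟩,
    (G.isCoverageTour_iff l).2 ⟨⟨v, hl⟩, hserv1⟩, fun l' hl' => ?_⟩
  obtain ⟨⟨v', hw⟩, h1⟩ := (G.isCoverageTour_iff l').1 hl'
  rw [G.tourCost_eq hserv1, G.tourCost_eq h1, hcount', hflow]
  have h2 := hf.2 _ (h1.flowOf_mem_feasible.2 fun φ => by rw [hw.sum_count, sub_self])
  linarith

end LineCoverage

/-! ### Vertices of the flow polyhedron -/

open Filter Topology in
/-- A feasible flow that is not extreme: it can be moved in both directions along a circulation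
that vanishes where the flow is at a bound. -/
theorem FlowDigraph.not_mem_extremePoints_of_circulation {V A : Type} [DecidableEq V] [Fintype A]
    (D : FlowDigraph V A) {f : A → ℝ} (hf : f ∈ D.feasible) (x : A → ℝ) (hx0 : x ≠ 0)
    (hx : ∀ v, (∑ a with D.head a = v, x a) - (∑ a with D.tail a = v, x a) = 0)
    (hint : ∀ a, x a ≠ 0 → 0 < f a ∧ (f a : WithTop ℝ) < D.cap a) :
    f ∉ Set.extremePoints ℝ D.feasible := by
  intro hext
  -- One small `ε` serves all of the finitely many arcs; the absolute value covers both signs of the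
  -- shift.
  have hev : ∀ᶠ ε : ℝ in 𝓝[>] 0, ∀ a, 0 ≤ f a - ε * |x a| ∧
      ((f a + ε * |x a| : ℝ) : WithTop ℝ) ≤ D.cap a := by
    rw [eventually_all]
    intro a
    by_cases hxa : x a = 0
    · simp only [hxa, abs_zero, mul_zero, sub_zero, add_zero]
      exact Eventually.of_forall fun _ => hf.1 a
    · obtain ⟨h1, h2⟩ := hint a hxa
      have ht1 : Tendsto (fun ε : ℝ => f a - ε * |x a|) (𝓝[>] 0) (𝓝 (f a)) := by
        have : Tendsto (fun ε : ℝ => f a - ε * |x a|) (𝓝 0) (𝓝 (f a - 0 * |x a|)) :=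
          Continuous.tendsto (by fun_prop) 0
        simpa using this.mono_left nhdsWithin_le_nhds
      have ht2 : Tendsto (fun ε : ℝ => f a + ε * |x a|) (𝓝[>] 0) (𝓝 (f a)) := by
        have : Tendsto (fun ε : ℝ => f a + ε * |x a|) (𝓝 0) (𝓝 (f a + 0 * |x a|)) :=
          Continuous.tendsto (by fun_prop) 0
        simpa using this.mono_left nhdsWithin_le_nhds
      cases hc : D.cap a with
      | top => filter_upwards [ht1.eventually_const_le h1] with ε h; exact ⟨h, le_top⟩
      | coe c =>
        rw [hc, WithTop.coe_lt_coe] at h2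
        filter_upwards [ht1.eventually_const_le h1, ht2.eventually_le_const h2] with ε h h'
        exact ⟨h, WithTop.coe_le_coe.2 h'⟩
  obtain ⟨ε, h1, hε⟩ := (hev.and self_mem_nhdsWithin).exists
  have hmem : ∀ δ : ℝ, |δ| = ε → (fun a => f a + δ * x a) ∈ D.feasible := by
    intro δ hδ
    refine ⟨fun a => ?_, fun v => ?_⟩
    · have h2 : |δ * x a| = ε * |x a| := by rw [abs_mul, hδ]
      have h3 := abs_le.1 h2.le
      exact ⟨by have := (h1 a).1; linarith [h3.1],
        (WithTop.coe_le_coe.2 (by linarith [h3.2])).trans (h1 a).2⟩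
    · have h2 := hf.2 v
      have h3 := hx v
      simp only [Finset.sum_add_distrib, ← Finset.mul_sum]
      linear_combination h2 + δ * h3
  -- `f` is the midpoint of its two shifts, so extremality makes the shift zero.
  have h2 := hext.2 (hmem ε (abs_of_pos hε)) (hmem (-ε) (by rw [abs_neg, abs_of_pos hε]))
    ⟨1 / 2, 1 / 2, by norm_num, by norm_num, by norm_num, by
      funext a
      simp only [Pi.add_apply, Pi.smul_apply, smul_eq_mul]; ring⟩
  refine hx0 (funext fun a => ?_)
  have h3 := congrFun h2 a
  simpa [hε.ne'] using h3

/-- A nonempty set of arcs without vertices of degree one supports a circulation. -/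
theorem FlowDigraph.exists_circulation {V A : Type} [DecidableEq V] [Fintype V] [Fintype A]
    (D : FlowDigraph V A) (F : Finset A) (hF : F.Nonempty)
    (hdeg : ∀ v, (F.filter (fun a => D.head a = v)).card +
      (F.filter (fun a => D.tail a = v)).card ≠ 1) :
    ∃ x : A → ℝ, x ≠ 0 ∧ (∀ a, x a ≠ 0 → a ∈ F) ∧
      ∀ v, (∑ a with D.head a = v, x a) - (∑ a with D.tail a = v, x a) = 0 := by
  classical
  let VF := F.image D.head ∪ F.image D.tail
  -- Every vertex touched by `F` has degree at least 2, and the degrees sum to twice the number of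
  -- arcs.
  have hcard : VF.card ≤ F.card := by
    have h1 : ∑ v ∈ VF, 2 ≤ ∑ v ∈ VF, ((F.filter (fun a => D.head a = v)).card +
        (F.filter (fun a => D.tail a = v)).card) := by
      refine Finset.sum_le_sum fun v hv => ?_
      have h2 := hdeg v
      have h3 : (F.filter (fun a => D.head a = v)).card +
          (F.filter (fun a => D.tail a = v)).card ≠ 0 := by
        intro h0
        rw [Nat.add_eq_zero_iff, Finset.card_eq_zero, Finset.card_eq_zero,
          Finset.filter_eq_empty_iff, Finset.filter_eq_empty_iff] at h0
        rcases Finset.mem_union.1 hv with h | h <;> obtain ⟨a, ha, rfl⟩ := Finset.mem_image.1 h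
        · exact h0.1 ha rfl
        · exact h0.2 ha rfl
      omega
    rw [Finset.sum_add_distrib,
      ← Finset.card_eq_sum_card_fiberwise (fun a ha =>
        Finset.mem_union_left _ (Finset.mem_image_of_mem _ ha)),
      ← Finset.card_eq_sum_card_fiberwise (fun a ha =>
        Finset.mem_union_right _ (Finset.mem_image_of_mem _ ha)), Finset.sum_const,
      smul_eq_mul] at h1
    omega
  obtain ⟨a₀, ha₀⟩ := hF
  have hv₀ : D.head a₀ ∈ VF := Finset.mem_union_left _ (Finset.mem_image_of_mem _ ha₀)
  -- Conservation at one touched vertex follows from the others, since all net inflows sum to 0.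
  -- Without it there are fewer equations than arcs, so the kernel is nontrivial.
  let L : (F → ℝ) →ₗ[ℝ] ((VF.erase (D.head a₀) : Finset V) → ℝ) :=
    { toFun := fun x v => ∑ a, x a * ((if D.head a = v then 1 else 0) -
        (if D.tail a = v then 1 else 0))
      map_add' := fun x y => by funext v; simp [add_mul, Finset.sum_add_distrib]
      map_smul' := fun c x => by funext v; simp [mul_assoc, Finset.mul_sum] }
  have hker : LinearMap.ker L ≠ ⊥ := by
    refine LinearMap.ker_ne_bot_of_finrank_lt ?_
    rw [Module.finrank_fintype_fun_eq_card, Module.finrank_fintype_fun_eq_card, Fintype.card_coe,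
      Fintype.card_coe, Finset.card_erase_of_mem hv₀]
    have := Finset.card_pos.2 ⟨_, hv₀⟩
    omega
  obtain ⟨y, hy, hy0⟩ := (Submodule.ne_bot_iff _).1 hker
  let x : A → ℝ := fun a => if h : a ∈ F then y ⟨a, h⟩ else 0
  have hxF : ∀ a, x a ≠ 0 → a ∈ F := by
    intro a ha; by_contra h; simp [x, h] at ha
  have hnet : ∀ v, (∑ a with D.head a = v, x a) - (∑ a with D.tail a = v, x a) =
      ∑ a : F, y a * ((if D.head a = v then 1 else 0) - (if D.tail a = v then 1 else 0)) := by
    intro v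
    rw [Finset.sum_filter, Finset.sum_filter, ← Finset.sum_sub_distrib,
      ← Finset.sum_subset (Finset.subset_univ F), ← Finset.sum_coe_sort F]
    · refine Finset.sum_congr rfl fun a _ => ?_
      have : x a = y a := by simp [x]
      rw [this]
      split_ifs <;> simp
    · intro a _ ha
      have : x a = 0 := by simp [x, ha]
      simp [this]
  have hnet0 : ∀ v, v ≠ D.head a₀ →
      (∑ a with D.head a = v, x a) - (∑ a with D.tail a = v, x a) = 0 := by
    intro v hv
    rw [hnet]
    by_cases hVF : v ∈ VF
    · exact congrFun (LinearMap.mem_ker.1 hy) ⟨v, Finset.mem_erase.2 ⟨hv, hVF⟩⟩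
    · refine Finset.sum_eq_zero fun a _ => ?_
      have h1 : D.head a ≠ v := fun h => hVF (h ▸ Finset.mem_union_left _
        (Finset.mem_image_of_mem _ a.2))
      have h2 : D.tail a ≠ v := fun h => hVF (h ▸ Finset.mem_union_right _
        (Finset.mem_image_of_mem _ a.2))
      simp [h1, h2]
  refine ⟨x, fun h => hy0 (funext fun a => ?_), hxF, fun v => ?_⟩
  · have := congrFun h a
    simpa [x] using this
  · by_cases hv : v = D.head a₀
    · have htot : ∑ v, ((∑ a with D.head a = v, x a) - (∑ a with D.tail a = v, x a)) = 0 := by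
        rw [Finset.sum_sub_distrib, Finset.sum_fiberwise, Finset.sum_fiberwise, sub_self]
      rw [Finset.sum_eq_single (D.head a₀) (fun w _ hw => hnet0 w hw) (by simp)] at htot
      rw [hv, htot]
    · exact hnet0 v hv

/-- If the capacities and demands are multiples of `c`, then so are the flows of the vertices of the
flow polyhedron. -/
theorem FlowDigraph.mem_zmultiples_of_mem_extremePoints {V A : Type} [DecidableEq V] [Fintype V]
    [Fintype A] (D : FlowDigraph V A) {f : A → ℝ} (hf : f ∈ Set.extremePoints ℝ D.feasible) (c : ℝ)
    (hcap : ∀ a, D.cap a = ⊤ ∨ ∃ z ∈ AddSubgroup.zmultiples c, D.cap a = (z : ℝ))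
    (hdem : ∀ v, D.demand v ∈ AddSubgroup.zmultiples c) (a : A) :
    f a ∈ AddSubgroup.zmultiples c := by
  classical
  by_contra ha
  let F := Finset.univ.filter (fun a => f a ∉ AddSubgroup.zmultiples c)
  have hmemF : ∀ b, b ∈ F ↔ f b ∉ AddSubgroup.zmultiples c := fun b => by simp [F]
  have hsum : ∀ (q : A → V) (v : V), (∑ b with q b = v, f b) -
      ∑ b ∈ F.filter (fun b => q b = v), f b ∈ AddSubgroup.zmultiples c := by
    intro q v
    have h1 : F.filter (fun b => q b = v) =
        (Finset.univ.filter (fun b => q b = v)).filter (fun b => b ∈ F) := by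
      ext b; simp [and_comm]
    rw [h1, ← Finset.sum_filter_add_sum_filter_not (Finset.univ.filter (fun b => q b = v))
      (fun b => b ∈ F), add_sub_cancel_left]
    refine sum_mem fun b hb => ?_
    have := (Finset.mem_filter.1 hb).2
    rw [hmemF, not_not] at this
    exact this
  have hnet : ∀ v, (∑ b ∈ F.filter (fun b => D.head b = v), f b) -
      ∑ b ∈ F.filter (fun b => D.tail b = v), f b ∈ AddSubgroup.zmultiples c := by
    intro v
    have h1 := hdem v
    rw [← hf.1.2 v] at h1
    have h2 := add_mem (sub_mem h1 (hsum D.head v)) (hsum D.tail v)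
    convert h2 using 1
    ring
  -- If only one arc at `v` had a flow off the lattice, conservation would put that flow on the
  -- lattice as well.
  obtain ⟨x, hx0, hxF, hx⟩ := D.exists_circulation F ⟨a, (hmemF a).2 ha⟩ (fun v hv => by
    have h1 := hnet v
    rcases Nat.add_eq_one_iff.1 hv with ⟨h2, h3⟩ | ⟨h2, h3⟩
    · obtain ⟨b, hb⟩ := Finset.card_eq_one.1 h3
      rw [Finset.card_eq_zero.1 h2, hb, Finset.sum_empty, Finset.sum_singleton, zero_sub,
        neg_mem_iff] at h1
      have : b ∈ F.filter (fun b => D.tail b = v) := by rw [hb]; exact Finset.mem_singleton_self b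
      exact (hmemF b).1 (Finset.mem_filter.1 this).1 h1
    · obtain ⟨b, hb⟩ := Finset.card_eq_one.1 h2
      rw [Finset.card_eq_zero.1 h3, hb, Finset.sum_empty, Finset.sum_singleton, sub_zero] at h1
      have : b ∈ F.filter (fun b => D.head b = v) := by rw [hb]; exact Finset.mem_singleton_self b
      exact (hmemF b).1 (Finset.mem_filter.1 this).1 h1)
  refine D.not_mem_extremePoints_of_circulation hf.1 x hx0 hx (fun b hb => ?_) hf
  have h1 := (hmemF b).1 (hxF b hb)
  obtain ⟨h2, h3⟩ := hf.1.1 b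
  -- The bounds are multiples of `c`, so a flow off the lattice lies strictly between them.
  refine ⟨h2.lt_of_ne fun h => h1 (h ▸ zero_mem _), h3.lt_of_ne fun h => h1 ?_⟩
  rcases hcap b with h4 | ⟨z, hz, h4⟩
  · rw [h4] at h; exact absurd h (WithTop.coe_ne_top)
  · rw [h4] at h
    rw [WithTop.coe_eq_coe.1 h]
    exact hz

/-! ### Parity of the demands -/

namespace LineCoverage

variable {n m : ℕ}

/-- Outdegree minus indegree is the degree minus twice the indegree; a loop counts in both. -/
theorem imbalance_add_requiredDegree (G : LineCoverage n m) (v : Fin n) :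
    ∃ j : ℤ, G.imbalance G.minCostDigraph v = G.requiredDegree v + 2 * j := by
  have hinj : Set.InjOn G.minArc G.req := fun e _ e' _ h => by
    have := congrArg Prod.fst h
    simpa using this
  have h1 : ∀ q : Arc m → Fin n, (G.minCostDigraph.filter (fun a => q a = v)).card =
      ∑ e ∈ G.req, if q (G.minArc e) = v then 1 else 0 := by
    intro q
    rw [Finset.card_filter, minCostDigraph, Finset.sum_image hinj]
  refine ⟨-∑ e ∈ G.req, (if G.head (G.minArc e) = v then 1 else 0 : ℕ), ?_⟩
  rw [imbalance, requiredDegree, h1, h1, Finset.card_filter, Finset.card_filter,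
    ← Finset.sum_add_distrib]
  have h2 : ∑ e ∈ G.req, ((if G.src e = v then 1 else 0) + (if G.tgt e = v then 1 else 0)) =
      ∑ e ∈ G.req, ((if G.tail (G.minArc e) = v then 1 else 0) +
        (if G.head (G.minArc e) = v then 1 else 0)) := by
    refine Finset.sum_congr rfl fun e _ => ?_
    unfold minArc
    split_ifs <;> simp_all [tail, head]
  rw [h2, Finset.sum_add_distrib]
  push_cast
  ring

theorem RequiredEulerian.even_imbalance {G : LineCoverage n m} (hE : G.RequiredEulerian)
    (v : Fin n) : Even (G.imbalance G.minCostDigraph v) := by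
  obtain ⟨j, hj⟩ := G.imbalance_add_requiredDegree v
  have h : Even (G.requiredDegree v) := by
    by_cases hv : G.IsRequiredVertex v
    · exact hE.2 v hv
    · have h0 : G.requiredDegree v = 0 := by
        simp only [requiredDegree, Nat.add_eq_zero_iff, Finset.card_eq_zero,
          Finset.filter_eq_empty_iff]
        exact ⟨fun e he h => hv ⟨e, he, Or.inl h⟩, fun e he h => hv ⟨e, he, Or.inr h⟩⟩
      rw [h0]; exact Even.zero
  rw [hj]
  exact ((Int.even_coe_nat _).2 h).add (even_two_mul j)

/-- Flows with even values on the flow digraph have deadhead flows in `ℕ` and reversal flows in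
`{0, 2}`. -/
theorem solvedBy_of_even {G : LineCoverage n m} (hG : G.Connected)
    (hE : G.RequiredEulerian) {f : G.FlowArc → ℝ} (hf : G.flowDigraph.IsMinCostFlow f)
    (h2 : ∀ a, f a ∈ AddSubgroup.zmultiples (2 : ℝ)) : G.SolvedBy f := by
  obtain ⟨h3, h4, -⟩ := (G.mem_feasible_flowDigraph_iff f).1 hf.1
  refine solvedBy_of_isMinCostFlow hG hE hf (fun e => ?_) (fun a => ?_)
  · obtain ⟨j, hj⟩ := AddSubgroup.mem_zmultiples_iff.1 (h2 (Sum.inr e))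
    obtain ⟨h5, h6⟩ := h4 e
    rw [← hj, zsmul_eq_mul] at h5 h6 ⊢
    have h7 : 0 ≤ j := by have : (0:ℝ) ≤ j := by linarith
                          exact_mod_cast this
    have h8 : j ≤ 1 := by have : (j:ℝ) ≤ 1 := by linarith
                          exact_mod_cast this
    interval_cases j <;> norm_num
  · obtain ⟨j, hj⟩ := AddSubgroup.mem_zmultiples_iff.1 (h2 (Sum.inl a))
    have h5 := h3 a
    rw [← hj, zsmul_eq_mul] at h5 ⊢
    have h7 : 0 ≤ j := by have : (0:ℝ) ≤ j := by linarith
                          exact_mod_cast this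
    lift j to ℕ using h7
    exact ⟨j * 2, by push_cast; ring⟩

/-- Lattice values of vertices with `c = 2`: capacities are infinite or 2, and demands are even. -/
theorem solvedBy_of_isBasicMinCostFlow {G : LineCoverage n m} (hG : G.Connected)
    (hE : G.RequiredEulerian) {f : G.FlowArc → ℝ} (hf : G.flowDigraph.IsBasicMinCostFlow f) :
    G.SolvedBy f := by
  refine solvedBy_of_even hG hE hf.1 (G.flowDigraph.mem_zmultiples_of_mem_extremePoints hf.2 2 ?_ ?_)
  · rintro (a | e)
    · exact Or.inl rfl
    · exact Or.inr ⟨2, AddSubgroup.mem_zmultiples 2, rfl⟩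
  · intro v
    obtain ⟨j, hj⟩ := hE.even_imbalance v
    refine AddSubgroup.mem_zmultiples_iff.2 ⟨j, ?_⟩
    simp only [flowDigraph, hj]
    push_cast
    simp only [zsmul_eq_mul]
    ring

end LineCoverage

/-! ### Reasoning about programs -/

namespace Program

/-- `p`, started in `s`, halts after at most `T` steps in a store that satisfies `Q`. -/
def Runs (p : Program) (s : Store) (T : ℕ) (Q : Store → Prop) : Prop :=
  ∃ k s', k ≤ T ∧ p.Exec s k s' ∧ Q s'

/-- Boolean and syntactic, so that for a concrete program the claim that a memory cell is untouched
is proved by `rfl`. -/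
def writesNat : Program → ℕ → Bool
  | setNat y _, x => x == y
  | seq p q, x => p.writesNat x || q.writesNat x
  | branch _ p q, x => p.writesNat x || q.writesNat x
  | loop _ p, x => p.writesNat x
  | _, _ => false

def writesNatArr : Program → ℕ → Bool
  | setNatArr y _ _, x => x == y
  | seq p q, x => p.writesNatArr x || q.writesNatArr x
  | branch _ p q, x => p.writesNatArr x || q.writesNatArr x
  | loop _ p, x => p.writesNatArr x
  | _, _ => false

def writesReal : Program → ℕ → Bool
  | setReal y _, x => x == y
  | seq p q, x => p.writesReal x || q.writesReal x
  | branch _ p q, x => p.writesReal x || q.writesReal x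
  | loop _ p, x => p.writesReal x
  | _, _ => false

def writesRealArr : Program → ℕ → Bool
  | setRealArr y _ _, x => x == y
  | seq p q, x => p.writesRealArr x || q.writesRealArr x
  | branch _ p q, x => p.writesRealArr x || q.writesRealArr x
  | loop _ p, x => p.writesRealArr x
  | _, _ => false

/-- The stores `s` and `s'` agree on all the memory that does not occur as a target in `p`. -/
structure Frame (p : Program) (s s' : Store) : Prop where
  natReg : ∀ x, p.writesNat x = false → s'.natReg x = s.natReg x
  natArr : ∀ x, p.writesNatArr x = false → s'.natArr x = s.natArr x
  realReg : ∀ x, p.writesReal x = false → s'.realReg x = s.realReg x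
  realArr : ∀ x, p.writesRealArr x = false → s'.realArr x = s.realArr x

theorem Frame.refl (p : Program) (s : Store) : Frame p s s :=
  ⟨fun _ _ => rfl, fun _ _ => rfl, fun _ _ => rfl, fun _ _ => rfl⟩

theorem Frame.trans {p : Program} {s s' s'' : Store} (h : Frame p s s') (h' : Frame p s' s'') :
    Frame p s s'' :=
  ⟨fun x hx => (h'.natReg x hx).trans (h.natReg x hx),
    fun x hx => (h'.natArr x hx).trans (h.natArr x hx),
    fun x hx => (h'.realReg x hx).trans (h.realReg x hx),
    fun x hx => (h'.realArr x hx).trans (h.realArr x hx)⟩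

theorem Frame.mono {p q : Program} {s s' : Store} (h : Frame p s s')
    (h1 : ∀ x, q.writesNat x = false → p.writesNat x = false)
    (h2 : ∀ x, q.writesNatArr x = false → p.writesNatArr x = false)
    (h3 : ∀ x, q.writesReal x = false → p.writesReal x = false)
    (h4 : ∀ x, q.writesRealArr x = false → p.writesRealArr x = false) : Frame q s s' :=
  ⟨fun x hx => h.natReg x (h1 x hx), fun x hx => h.natArr x (h2 x hx),
    fun x hx => h.realReg x (h3 x hx), fun x hx => h.realArr x (h4 x hx)⟩

theorem Frame.seq_left {p q : Program} {s s' : Store} (h : Frame p s s') : Frame (seq p q) s s' :=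
  h.mono (by simp +contextual [writesNat]) (by simp +contextual [writesNatArr])
    (by simp +contextual [writesReal]) (by simp +contextual [writesRealArr])

theorem Frame.seq_right {p q : Program} {s s' : Store} (h : Frame q s s') :
    Frame (seq p q) s s' :=
  h.mono (by simp +contextual [writesNat]) (by simp +contextual [writesNatArr])
    (by simp +contextual [writesReal]) (by simp +contextual [writesRealArr])

theorem Exec.frame {p : Program} {s s' : Store} {k : ℕ} (h : p.Exec s k s') : Frame p s s' := by
  induction h with
  | skip => exact Frame.refl _ _
  | setNat s x v =>
    exact ⟨fun y hy => by simp [writesNat] at hy; simp [Store.writeNat, hy], fun _ _ => rfl,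
      fun _ _ => rfl, fun _ _ => rfl⟩
  | setNatArr s x i v =>
    exact ⟨fun _ _ => rfl, fun y hy => by simp [writesNatArr] at hy; simp [Store.writeNatArr, hy],
      fun _ _ => rfl, fun _ _ => rfl⟩
  | setReal s x v =>
    exact ⟨fun _ _ => rfl, fun _ _ => rfl,
      fun y hy => by simp [writesReal] at hy; simp [Store.writeReal, hy], fun _ _ => rfl⟩
  | setRealArr s x i v =>
    exact ⟨fun _ _ => rfl, fun _ _ => rfl, fun _ _ => rfl,
      fun y hy => by simp [writesRealArr] at hy; simp [Store.writeRealArr, hy]⟩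
  | seq _ _ ih1 ih2 => exact ih1.seq_left.trans ih2.seq_right
  | branch_true _ _ ih =>
    exact ih.mono (by simp +contextual [writesNat]) (by simp +contextual [writesNatArr])
      (by simp +contextual [writesReal]) (by simp +contextual [writesRealArr])
  | branch_false _ _ ih =>
    exact ih.mono (by simp +contextual [writesNat]) (by simp +contextual [writesNatArr])
      (by simp +contextual [writesReal]) (by simp +contextual [writesRealArr])
  | loop_true _ _ _ ih1 ih2 =>
    exact Frame.trans (ih1.mono (fun _ h => h) (fun _ h => h) (fun _ h => h) (fun _ h => h)) ih2
  | loop_false => exact Frame.refl _ _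

def loopFree : Program → Bool
  | seq p q => p.loopFree && q.loopFree
  | branch _ p q => p.loopFree && q.loopFree
  | loop _ _ => false
  | _ => true

/-- A bound for the number of steps of a program without loops. -/
def cost : Program → ℕ
  | skip => 1
  | setNat _ v => v.size + 1
  | setNatArr _ i v => i.size + v.size + 1
  | setReal _ v => v.size + 1
  | setRealArr _ i v => i.size + v.size + 1
  | seq p q => p.cost + q.cost
  | branch t p q => t.size + (p.cost + q.cost)
  | loop _ _ => 0

open Classical in
/-- The effect of a program without loops. -/
noncomputable def effect : Program → Store → Store
  | skip, s => s
  | setNat x v, s => s.writeNat x (v.eval s)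
  | setNatArr x i v, s => s.writeNatArr x (i.eval s) (v.eval s)
  | setReal x v, s => s.writeReal x (v.eval s)
  | setRealArr x i v, s => s.writeRealArr x (i.eval s) (v.eval s)
  | seq p q, s => q.effect (p.effect s)
  | branch t p q, s => if t.eval s then p.effect s else q.effect s
  | loop _ _, s => s

theorem exec_effect (p : Program) (hp : p.loopFree = true) (s : Store) :
    ∃ k ≤ p.cost, p.Exec s k (p.effect s) := by
  induction p generalizing s with
  | skip => exact ⟨_, le_rfl, .skip s⟩
  | setNat x v => exact ⟨_, le_rfl, .setNat s x v⟩
  | setNatArr x i v => exact ⟨_, le_rfl, .setNatArr s x i v⟩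
  | setReal x v => exact ⟨_, le_rfl, .setReal s x v⟩
  | setRealArr x i v => exact ⟨_, le_rfl, .setRealArr s x i v⟩
  | seq p q ihp ihq =>
    simp only [loopFree, Bool.and_eq_true] at hp
    obtain ⟨j, hj, h1⟩ := ihp hp.1 s
    obtain ⟨k, hk, h2⟩ := ihq hp.2 (p.effect s)
    exact ⟨j + k, by simp only [cost]; omega, .seq h1 h2⟩
  | branch t p q ihp ihq =>
    simp only [loopFree, Bool.and_eq_true] at hp
    by_cases ht : t.eval s
    · obtain ⟨j, hj, h1⟩ := ihp hp.1 s
      exact ⟨t.size + j, by simp only [cost]; omega, by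
        simp only [effect, if_pos ht]; exact .branch_true ht h1⟩
    · obtain ⟨j, hj, h1⟩ := ihq hp.2 s
      exact ⟨t.size + j, by simp only [cost]; omega, by
        simp only [effect, if_neg ht]; exact .branch_false ht h1⟩
  | loop t p => simp [loopFree] at hp

theorem Runs.mono {p : Program} {s : Store} {T T' : ℕ} {Q Q' : Store → Prop} (h : p.Runs s T Q)
    (hT : T ≤ T') (hQ : ∀ s', Q s' → Frame p s s' → Q' s') : p.Runs s T' Q' := by
  obtain ⟨k, s', h1, h2, h3⟩ := h
  exact ⟨k, s', h1.trans hT, h2, hQ s' h3 h2.frame⟩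

/-- For concrete loop-free code the first two hypotheses are closed computations, and the
postcondition is about an explicit store. -/
theorem Runs.of_effect {p : Program} {s : Store} {T : ℕ} {Q : Store → Prop}
    (hp : p.loopFree = true) (hT : p.cost ≤ T) (hQ : Q (p.effect s)) : p.Runs s T Q := by
  obtain ⟨k, hk, h⟩ := p.exec_effect hp s
  exact ⟨k, _, hk.trans hT, h, hQ⟩

theorem Runs.seq {p q : Program} {s : Store} {T₁ T₂ : ℕ} {R Q : Store → Prop}
    (hp : p.Runs s T₁ R) (hq : ∀ s', R s' → Frame p s s' → q.Runs s' T₂ Q) :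
    (seq p q).Runs s (T₁ + T₂) Q := by
  obtain ⟨j, s', h1, h2, h3⟩ := hp
  obtain ⟨k, s'', h4, h5, h6⟩ := hq s' h3 h2.frame
  exact ⟨j + k, s'', by omega, .seq h2 h5, h6⟩

/-- The rule for loops, with an invariant and a variant. -/
theorem Runs.loop {t : Test} {p : Program} {s₀ : Store} {Inv : Store → Prop} {μ : Store → ℕ}
    {B : ℕ} (h0 : Inv s₀) (hstep : ∀ s, Inv s → Frame (loop t p) s₀ s → t.eval s →
      p.Runs s B (fun s' => Inv s' ∧ μ s' < μ s)) :
    (loop t p).Runs s₀ (μ s₀ * (B + t.size) + t.size) (fun s' => Inv s' ∧ ¬ t.eval s') := by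
  -- The induction carries the frame from the initial store, so that the loop body may use
  -- everything that the loop never writes.
  suffices H : ∀ j s, μ s ≤ j → Inv s → Frame (Program.loop t p) s₀ s →
      (Program.loop t p).Runs s (j * (B + t.size) + t.size) (fun s' => Inv s' ∧ ¬ t.eval s') from
    H _ s₀ le_rfl h0 (Frame.refl _ _)
  intro j
  induction j with
  | zero =>
    intro s hj hs hf
    by_cases ht : t.eval s
    · obtain ⟨k, s', -, -, -, h⟩ := hstep s hs hf ht; omega
    · exact ⟨_, s, by simp, .loop_false ht, hs, ht⟩
  | succ j ih =>
    intro s hj hs hf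
    by_cases ht : t.eval s
    · obtain ⟨k, s', h1, h2, h3, h4⟩ := hstep s hs hf ht
      obtain ⟨k', s'', h5, h6, h7⟩ := ih s' (by omega) h3 (hf.trans
        (h2.frame.mono (fun _ h => h) (fun _ h => h) (fun _ h => h) (fun _ h => h)))
      exact ⟨t.size + k + k', s'', by rw [Nat.succ_mul]; omega, .loop_true ht h2 h6, h7⟩
    · exact ⟨_, s, by omega, .loop_false ht, hs, ht⟩

/-- `for x = 0, …, b - 1 do p`. -/
def forLoop (x : ℕ) (b : NatExpr) (p : Program) : Program :=
  seq (setNat x (.const 0)) (loop (.neg (.natLe b (.reg x)))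
    (seq p (setNat x (.add (.reg x) (.const 1)))))

/-- The invariant is asserted after the counter was advanced. An iteration pays `B` for the body, 4
for the increment and `b.size + 3` for the test; initialization costs 2 and the failing test `b.size
+ 3`. -/
theorem Runs.forLoop {x : ℕ} {b : NatExpr} {p : Program} {s₀ : Store} {Inv : ℕ → Store → Prop}
    {B N : ℕ} (hx : p.writesNat x = false) (hb : ∀ s, Frame (forLoop x b p) s₀ s → b.eval s = N)
    (h0 : Inv 0 (s₀.writeNat x 0))
    (hstep : ∀ i s, i < N → Inv i s → s.natReg x = i → Frame (forLoop x b p) s₀ s →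
      p.Runs s B (fun s' => Inv (i + 1) (s'.writeNat x (i + 1)))) :
    (forLoop x b p).Runs s₀ (N * (B + b.size + 7) + b.size + 5) (fun s' => Inv N s') := by
  have hf0 : Frame (Program.forLoop x b p) s₀ (s₀.writeNat x 0) :=
    (Exec.setNat s₀ x (.const 0)).frame.seq_left
  have h1 : (setNat x (.const 0)).Runs s₀ 2 (fun s' => s' = s₀.writeNat x 0) :=
    ⟨_, _, by simp [NatExpr.size], .setNat s₀ x (.const 0), rfl⟩
  refine (h1.seq (T₂ := N * (B + 4 + (b.size + 3)) + (b.size + 3)) (Q := fun s' => Inv N s') ?_).mono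
    (by rw [show B + 4 + (b.size + 3) = B + b.size + 7 by ring]; omega) (fun s' h _ => h)
  rintro _ rfl -
  refine (Runs.loop (Inv := fun s => s.natReg x ≤ N ∧ Inv (s.natReg x) s)
    (μ := fun s => N - s.natReg x) (B := B + 4) ?_ ?_).mono ?_ ?_
  · refine ⟨by simp [Store.writeNat], ?_⟩
    simpa [Store.writeNat] using h0
  · intro s ⟨hs1, hs2⟩ hf ht
    have hf' := hf0.trans hf.seq_right
    have hbs := hb s hf'
    simp only [Test.eval, hbs, NatExpr.eval, not_le] at ht
    refine ((hstep _ s ht hs2 rfl hf').seq (T₂ := 4) (Q := fun s' => (s'.natReg x ≤ N ∧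
      Inv (s'.natReg x) s') ∧ N - s'.natReg x < N - s.natReg x) ?_)
    intro s' h2 hf2
    refine ⟨_, _, ?_, .setNat _ _ _, ?_⟩
    · simp [NatExpr.size]
    · have h3 := hf2.natReg x hx
      simp only [NatExpr.eval, h3]
      refine ⟨⟨?_, ?_⟩, ?_⟩
      · simp only [Store.writeNat, Function.update_self]; omega
      · simpa [Store.writeNat] using h2
      · simp only [Store.writeNat, Function.update_self]; omega
  · simp [Store.writeNat, Test.size, NatExpr.size]
  · rintro s' ⟨⟨h2, h3⟩, h4⟩ hf
    have hbs := hb s' (hf0.trans hf.seq_right)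
    simp only [Test.eval, hbs, NatExpr.eval, not_le, not_lt] at h4
    rwa [le_antisymm h2 h4] at h3

end Program

/-! ### Residual networks -/

/-- A network with the vertices `0, …, n - 1` and the arcs `0, …, A - 1`. The residual arcs are
`0, …, 2A - 1`; `A + j` is the opposite of the arc `j`. The arcs `0, …, F - 1` have infinite
capacity, and `b` is the demand. -/
structure Net where
  n : ℕ
  A : ℕ
  F : ℕ
  tl : ℕ → ℕ
  hd : ℕ → ℕ
  co : ℕ → ℝ
  cap : ℕ → ℕ
  b : ℕ → ℤ
  F_le : F ≤ A
  tl_lt : ∀ r < A + A, tl r < n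
  hd_lt : ∀ r < A + A, hd r < n
  tl_opp : ∀ j < A, tl (A + j) = hd j
  hd_opp : ∀ j < A, hd (A + j) = tl j
  co_opp : ∀ j < A, co (A + j) = - co j
  conn : ∀ S : ℕ → Prop, (∃ w < n, S w) → (∃ w < n, ¬ S w) → ∃ r < F, S (tl r) ∧ ¬ S (hd r)

namespace Net

variable (N : Net)

/-- The opposite residual arc. -/
def opp (r : ℕ) : ℕ := if r < N.A then N.A + r else r - N.A

/-- The reduced cost of a residual arc. -/
def rc (π : ℕ → ℝ) (r : ℕ) : ℝ := N.co r + π (N.tl r) - π (N.hd r)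

/-- `r` has residual capacity, when the residual capacities of the arcs that are not free are `K`. -/
def Avail (K : ℕ → ℕ) (r : ℕ) : Prop := r < N.F ∨ 0 < K r

/-- The net inflow at `v`. The flow of the arc `j` is the residual capacity of its opposite. -/
def net (K : ℕ → ℕ) (v : ℕ) : ℤ :=
  ∑ j ∈ Finset.range N.A,
    (K (N.A + j) : ℤ) * ((if N.hd j = v then 1 else 0) - (if N.tl j = v then 1 else 0))

/-- The residual capacities `K` are those of a flow of multiples of `u` with excess `d`, and the
node potential `π` proves its optimality. -/
structure Good (u : ℕ) (K : ℕ → ℕ) (d : ℕ → ℤ) (π : ℕ → ℝ) : Prop where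
  slack : ∀ r < N.A + N.A, N.Avail K r → 0 ≤ N.rc π r
  dvd : ∀ r < N.A + N.A, u ∣ K r
  cap : ∀ j, N.F ≤ j → j < N.A → K j + K (N.A + j) = N.cap j
  bal : ∀ v < N.n, N.net K v + d v = N.b v

/-- The residual capacities after `u` units were sent along `r`. -/
def push (u : ℕ) (K : ℕ → ℕ) (r : ℕ) : ℕ → ℕ :=
  Function.update (Function.update K r (K r - u)) (N.opp r)
    (Function.update K r (K r - u) (N.opp r) + u)

variable {N}

theorem opp_ne {r : ℕ} (hr : r < N.A + N.A) : N.opp r ≠ r := by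
  unfold opp; split_ifs <;> omega

theorem rc_opp (π : ℕ → ℝ) {r : ℕ} (hr : r < N.A + N.A) : N.rc π (N.opp r) = - N.rc π r := by
  unfold opp rc
  split_ifs with h
  · rw [N.tl_opp r h, N.hd_opp r h, N.co_opp r h]; ring
  · obtain ⟨j, rfl⟩ := Nat.exists_eq_add_of_le (not_lt.1 h)
    have hj : j < N.A := by omega
    rw [Nat.add_sub_cancel_left, N.tl_opp j hj, N.hd_opp j hj, N.co_opp j hj]; ring

theorem push_apply {u : ℕ} {K : ℕ → ℕ} {r : ℕ} (hr : r < N.A + N.A) (q : ℕ) :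
    N.push u K r q = if q = r then K r - u else if q = N.opp r then K q + u else K q := by
  have h := opp_ne hr
  unfold push
  by_cases h1 : q = r
  · subst h1
    rw [if_pos rfl, Function.update_of_ne h.symm, Function.update_self]
  · rw [if_neg h1, Function.update_of_ne h]
    by_cases h2 : q = N.opp r
    · subst h2; rw [Function.update_self, if_pos rfl]
    · rw [Function.update_of_ne h2, Function.update_of_ne h1, if_neg h2]

theorem push_ge {u : ℕ} {K : ℕ → ℕ} {r : ℕ} (hr : r < N.A + N.A) {q : ℕ} (hq : q ≠ r) :
    K q ≤ N.push u K r q := by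
  rw [push_apply hr, if_neg hq]; split_ifs <;> omega

/-- Only the entries `A + j` count as flow. Decreasing such an entry needs exact subtraction, and
there `u ≤ K r` holds because free arcs lie below `A`; the entry of a free arc may be truncated
harmlessly. -/
theorem net_push {u : ℕ} {K : ℕ → ℕ} {r : ℕ} (hr : r < N.A + N.A) (hK : r < N.F ∨ u ≤ K r)
    (v : ℕ) : N.net (N.push u K r) v = N.net K v +
      u * ((if N.hd r = v then 1 else 0) - (if N.tl r = v then 1 else 0)) := by
  have hF := N.F_le
  rcases lt_or_ge r N.A with h | h
  · have h1 : ∀ j, (N.push u K r (N.A + j) : ℤ) = K (N.A + j) + if r = j then (u : ℤ) else 0 := by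
      intro j
      have h2 : N.opp r = N.A + r := if_pos h
      rw [push_apply hr, if_neg (by omega), h2]
      by_cases hj : r = j
      · simp [hj]
      · rw [if_neg (by omega), if_neg hj, add_zero]
    simp only [net, h1, add_mul, Finset.sum_add_distrib, ite_mul, zero_mul]
    rw [Finset.sum_ite_eq, if_pos (Finset.mem_range.2 h)]
  · obtain ⟨i, rfl⟩ := Nat.exists_eq_add_of_le h
    have hi : i < N.A := by omega
    have hK' : u ≤ K (N.A + i) := hK.resolve_left (by omega)
    have h1 : ∀ j, (N.push u K (N.A + i) (N.A + j) : ℤ) =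
        K (N.A + j) - if i = j then (u : ℤ) else 0 := by
      intro j
      have h2 : N.opp (N.A + i) = i := by rw [opp, if_neg (by omega), Nat.add_sub_cancel_left]
      rw [push_apply hr, h2]
      by_cases hj : i = j
      · subst hj; rw [if_pos rfl, if_pos rfl, Nat.cast_sub hK']
      · rw [if_neg (by omega), if_neg (by omega), if_neg hj, sub_zero]
    simp only [net, h1, sub_mul, Finset.sum_sub_distrib, ite_mul, zero_mul]
    rw [Finset.sum_ite_eq, if_pos (Finset.mem_range.2 hi), N.tl_opp i hi, N.hd_opp i hi]
    ring

/-- Sending `u` units along a tight residual arc. -/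
theorem Good.push {u : ℕ} {K : ℕ → ℕ} {d : ℕ → ℤ} {π : ℕ → ℝ} (h : N.Good u K d π) {r : ℕ}
    (hr : r < N.A + N.A) (hav : N.Avail K r) (htight : N.rc π r = 0) (d' : ℕ → ℤ)
    (hd' : ∀ v, d' v + u * ((if N.hd r = v then 1 else 0) - (if N.tl r = v then 1 else 0)) = d v) :
    N.Good u (N.push u K r) d' π := by
  have hK : r < N.F ∨ u ≤ K r := hav.imp_right fun h0 => Nat.le_of_dvd h0 (h.dvd r hr)
  have hF := N.F_le
  refine ⟨fun q hq hqa => ?_, fun q hq => ?_, fun j hj hjA => ?_, fun v hv => ?_⟩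
  · by_cases h1 : q = r
    · rw [h1, htight]
    · by_cases h2 : q = N.opp r
      -- The only arc that can become available is the opposite of a tight one, hence tight.
      · rw [h2, rc_opp π hr, htight, neg_zero]
      · refine h.slack q hq (hqa.imp_right fun h3 => ?_)
        rwa [push_apply hr, if_neg h1, if_neg h2] at h3
  · rw [push_apply hr]
    split_ifs
    -- On a free arc the subtraction may truncate to 0, which `u` divides too.
    · exact Nat.dvd_sub (h.dvd r hr) dvd_rfl
    · exact dvd_add (h.dvd q hq) dvd_rfl
    · exact h.dvd q hq
  · have h1 := h.cap j hj hjA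
    rw [push_apply hr, push_apply hr, opp]
    by_cases h2 : j = r
    · subst h2
      have h3 : u ≤ K j := hK.resolve_left (by omega)
      have h4 : ¬ N.A + j = j := by omega
      simp only [hjA, if_true, h4, if_false]; omega
    · by_cases h3 : N.A + j = r
      · subst h3
        have h4 : u ≤ K (N.A + j) := hK.resolve_left (by omega)
        have h5 : ¬ N.A + j < N.A := by omega
        simp only [h2, if_false, h5, Nat.add_sub_cancel_left, if_true]; omega
      · have h4 : ¬ j = if r < N.A then N.A + r else r - N.A := by split_ifs <;> omega
        have h5 : ¬ N.A + j = if r < N.A then N.A + r else r - N.A := by split_ifs <;> omega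
        simp only [h2, h3, h4, h5, if_false]; omega
  · have h1 := h.bal v hv
    have h2 := hd' v
    rw [net_push hr hK]; linarith

/-- The residual arc `r` leaves the set of the vertices with a positive label. -/
def Leaves (N : Net) (K ord : ℕ → ℕ) (r : ℕ) : Prop :=
  N.Avail K r ∧ 0 < ord (N.tl r) ∧ ord (N.hd r) = 0

/-- A search tree with root `s` of tight residual arcs: the labels `ord` number the reached vertices
from `1` to `c` in the order of their discovery, `v` is the last one. -/
structure Tree (N : Net) (K need : ℕ → ℕ) (π : ℕ → ℝ) (ord pred : ℕ → ℕ) (s v c : ℕ) : Prop where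
  s_lt : s < N.n
  v_lt : v < N.n
  ord_s : 0 < ord s
  ord_v : 0 < ord v
  ord_le : ∀ w < N.n, ord w ≤ c
  pred : ∀ w < N.n, 0 < ord w → w ≠ s → pred w < N.A + N.A ∧ N.Avail K (pred w) ∧
    N.hd (pred w) = w ∧ N.rc π (pred w) = 0 ∧ 0 < ord (N.tl (pred w)) ∧
    ord (N.tl (pred w)) < ord w
  need : ∀ w < N.n, 0 < ord w → w ≠ v → need w = 0
  count : c + ((Finset.range N.n).filter (fun w => ord w = 0)).card ≤ N.n

/-- Inflow is missing somewhere but at no reached vertex, so some vertex is unreached; the free arcs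
alone connect the network, so the search never gets stuck. -/
theorem Tree.exists_leaves {K need : ℕ → ℕ} {π : ℕ → ℝ} {ord pred : ℕ → ℕ} {s v c : ℕ}
    (h : N.Tree K need π ord pred s v c) (hv : need v = 0)
    (hn : 0 < ∑ w ∈ Finset.range N.n, need w) : ∃ r < N.A + N.A, N.Leaves K ord r := by
  obtain ⟨w, hw, hw0⟩ := Finset.exists_ne_zero_of_sum_ne_zero hn.ne'
  have hwn := Finset.mem_range.1 hw
  have h1 : ¬ 0 < ord w := fun h0 => hw0 (by
    by_cases hwv : w = v
    · rw [hwv, hv]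
    · exact h.need w hwn h0 hwv)
  obtain ⟨r, hr, h2, h3⟩ := N.conn (fun x => 0 < ord x) ⟨s, h.s_lt, h.ord_s⟩ ⟨w, hwn, h1⟩
  exact ⟨r, by have := N.F_le; omega, Or.inl hr, h2, by omega⟩

/-- Raising the potential of the vertices not yet reached keeps the reduced costs nonnegative. -/
theorem Good.raise {u : ℕ} {K : ℕ → ℕ} {d : ℕ → ℤ} {π : ℕ → ℝ} (h : N.Good u K d π)
    {ord : ℕ → ℕ} {δ : ℝ} (hδ0 : 0 ≤ δ) (hδ : ∀ r < N.A + N.A, N.Leaves K ord r → δ ≤ N.rc π r)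
    {π' : ℕ → ℝ} (hπ' : ∀ w < N.n, π' w = if ord w = 0 then π w + δ else π w) :
    N.Good u K d π' := by
  refine ⟨fun r hr hav => ?_, h.dvd, h.cap, h.bal⟩
  have h1 := h.slack r hr hav
  have h2 := hδ r hr
  rw [rc, hπ' _ (N.tl_lt r hr), hπ' _ (N.hd_lt r hr)]
  rw [rc] at h1
  split_ifs with h3 h4 h4
  · linarith
  · linarith
  · have := h2 ⟨hav, by omega, h4⟩
    rw [rc] at this
    linarith
  · linarith

/-- Raising the unreached vertices by the reduced cost of `r` makes `r` tight, while tree arcs have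
both ends reached and keep their reduced cost. The new label exceeds all others. -/
theorem Tree.grow {K need : ℕ → ℕ} {π : ℕ → ℝ} {ord pred : ℕ → ℕ} {s v c : ℕ}
    (h : N.Tree K need π ord pred s v c) (hv : need v = 0) {r : ℕ} (hr : r < N.A + N.A)
    (hl : N.Leaves K ord r) {π' : ℕ → ℝ}
    (hπ' : ∀ w < N.n, π' w = if ord w = 0 then π w + N.rc π r else π w) :
    N.Tree K need π' (Function.update ord (N.hd r) (c + 1)) (Function.update pred (N.hd r) r) s
      (N.hd r) (c + 1) := by
  obtain ⟨hav, ht, hh⟩ := hl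
  have htn : N.tl r ≠ N.hd r := by intro h0; rw [h0] at ht; omega
  have hne : ∀ w, 0 < ord w → w ≠ N.hd r := by rintro w h0 rfl; omega
  refine ⟨h.s_lt, N.hd_lt r hr, ?_, by simp, fun w hw => ?_, fun w hw h0 hws => ?_,
    fun w hw h0 hwv => ?_, ?_⟩
  · rw [Function.update_of_ne (hne s h.ord_s)]; exact h.ord_s
  · rw [Function.update_apply]
    have := h.ord_le w hw
    split_ifs <;> omega
  · by_cases hwr : w = N.hd r
    · subst hwr
      simp only [Function.update_self, Function.update_of_ne htn]
      refine ⟨hr, hav, trivial, ?_, ht, ?_⟩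
      · rw [rc, hπ' _ (N.tl_lt r hr), hπ' _ hw, if_neg ht.ne', if_pos hh, rc]; ring
      · have := h.ord_le _ (N.tl_lt r hr); omega
    · rw [Function.update_of_ne hwr] at h0
      obtain ⟨h1, h2, h3, h4, h5, h6⟩ := h.pred w hw h0 hws
      rw [Function.update_of_ne hwr, Function.update_of_ne hwr, Function.update_of_ne (hne _ h5)]
      refine ⟨h1, h2, h3, ?_, h5, h6⟩
      rw [← h4, rc, rc, hπ' _ (N.tl_lt _ h1), if_neg h5.ne', h3, hπ' _ hw, if_neg h0.ne']
  · rw [Function.update_of_ne hwv] at h0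
    by_cases hwv' : w = v
    · rw [hwv', hv]
    · exact h.need w hw h0 hwv'
  · have h1 : (Finset.range N.n).filter (fun w => Function.update ord (N.hd r) (c + 1) w = 0) ⊂
        (Finset.range N.n).filter (fun w => ord w = 0) := by
      rw [Finset.ssubset_iff_of_subset]
      · exact ⟨N.hd r, by simp [hh, N.hd_lt r hr], by simp⟩
      · intro w hw
        simp only [Finset.mem_filter, Function.update_apply] at hw ⊢
        split_ifs at hw <;> simp_all
    have := Finset.card_lt_card h1
    have := h.count
    omega

/-- The invariant of the augmentation: `u` units were sent from `w` to `v`, and the residual arcs of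
the tree up to `w` are still available. -/
structure Augment (N : Net) (u : ℕ) (K : ℕ → ℕ) (d : ℕ → ℤ) (π : ℕ → ℝ) (ord pred : ℕ → ℕ)
    (s v w : ℕ) : Prop where
  w_lt : w < N.n
  ord_w : 0 < ord w
  good : N.Good u K
    (fun x => d x - u * ((if v = x then 1 else 0) - (if w = x then 1 else 0))) π
  avail : ∀ x < N.n, 0 < ord x → ord x ≤ ord w → x ≠ s → N.Avail K (pred x)

/-- The path is traversed backwards from `v`; at `w = v` nothing has been sent and the correction of
the excess vanishes. -/
theorem Tree.augment {u : ℕ} {K need : ℕ → ℕ} {d : ℕ → ℤ} {π : ℕ → ℝ} {ord pred : ℕ → ℕ}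
    {s v c : ℕ} (h : N.Tree K need π ord pred s v c) (hg : N.Good u K d π) :
    N.Augment u K d π ord pred s v v :=
  ⟨h.v_lt, h.ord_v, by simpa using hg, fun x hx h0 _ hs => (h.pred x hx h0 hs).2.1⟩

/-- Labels decrease strictly towards the root. So the walk ends there, and a push cannot exhaust the
tree arcs of vertices with smaller labels. -/
theorem Augment.push {u : ℕ} {K₀ K need : ℕ → ℕ} {d : ℕ → ℤ} {π : ℕ → ℝ} {ord pred : ℕ → ℕ}
    {s v c w : ℕ} (h : N.Tree K₀ need π ord pred s v c) (ha : N.Augment u K d π ord pred s v w)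
    (hw : w ≠ s) : N.Augment u (N.push u K (pred w)) d π ord pred s v (N.tl (pred w)) ∧
      ord (N.tl (pred w)) < ord w := by
  obtain ⟨h1, -, h3, h4, h5, h6⟩ := h.pred w ha.w_lt ha.ord_w hw
  refine ⟨⟨N.tl_lt _ h1, h5, ?_, fun x hx h0 hxo hs => ?_⟩, h6⟩
  · refine ha.good.push h1 (ha.avail w ha.w_lt ha.ord_w le_rfl hw) h4 _ fun x => ?_
    rw [h3]; ring
  · refine (ha.avail x hx h0 (by omega) hs).imp_right fun h7 => h7.trans_le (push_ge h1 ?_)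
    -- Equal predecessor arcs have equal heads, which would make `x` the vertex just left.
    intro heq
    have h8 := (h.pred x hx h0 hs).2.2.1
    rw [heq, h3] at h8
    subst h8
    omega

/-- The invariant of the computation of the minimum cost flow: `sup` and `need` are the outflows and
the inflows that are missing. -/
structure State (N : Net) (u M : ℕ) (K sup need : ℕ → ℕ) (π : ℕ → ℝ) : Prop where
  good : N.Good u K (fun x => (need x : ℤ) - sup x) π
  dvd_sup : ∀ w < N.n, u ∣ sup w
  dvd_need : ∀ w < N.n, u ∣ need w
  sum_eq : ∑ w ∈ Finset.range N.n, sup w = ∑ w ∈ Finset.range N.n, need w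
  sup_le : ∀ w < N.n, sup w ≤ M

theorem sum_update_sub {n : ℕ} {g : ℕ → ℕ} {i u : ℕ} (hi : i < n) (hu : u ≤ g i) :
    ∑ w ∈ Finset.range n, Function.update g i (g i - u) w + u = ∑ w ∈ Finset.range n, g w := by
  rw [Finset.sum_update_of_mem (Finset.mem_range.2 hi),
    Finset.sum_eq_add_sum_sdiff_singleton_of_mem (Finset.mem_range.2 hi) g]
  omega

/-- Divisibility turns a positive missing amount into one of at least `u`, so the subtractions at
both ends of the path are exact. -/
theorem State.augmented {u M : ℕ} {K K' sup need : ℕ → ℕ} {π π' : ℕ → ℝ} {s v : ℕ}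
    (h : N.State u M K sup need π) (hs : s < N.n) (hv : v < N.n) (hs0 : 0 < sup s)
    (hv0 : 0 < need v) (hg : N.Good u K' (fun x => (need x : ℤ) - sup x -
      u * ((if v = x then 1 else 0) - (if s = x then 1 else 0))) π') :
    N.State u M K' (Function.update sup s (sup s - u)) (Function.update need v (need v - u)) π' := by
  have h1 := Nat.le_of_dvd hs0 (h.dvd_sup s hs)
  have h2 := Nat.le_of_dvd hv0 (h.dvd_need v hv)
  refine ⟨⟨hg.slack, hg.dvd, hg.cap, fun x hx => ?_⟩, fun w hw => ?_, fun w hw => ?_, ?_,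
    fun w hw => ?_⟩
  · rw [← hg.bal x hx]
    simp only [Function.update_apply, eq_comm (a := v), eq_comm (a := s)]
    split_ifs with h3 h4 h4 <;> try subst h3 <;> try subst h4
    all_goals subst_vars
    all_goals push_cast [Nat.cast_sub h1, Nat.cast_sub h2]
    all_goals ring
  · rw [Function.update_apply]
    split_ifs
    · exact Nat.dvd_sub (h.dvd_sup s hs) dvd_rfl
    · exact h.dvd_sup w hw
  · rw [Function.update_apply]
    split_ifs
    · exact Nat.dvd_sub (h.dvd_need v hv) dvd_rfl
    · exact h.dvd_need w hw
  · have h3 := sum_update_sub hs h1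
    have h4 := sum_update_sub hv h2
    have h5 := h.sum_eq
    omega
  · rw [Function.update_apply]
    have := h.sup_le s hs
    have := h.sup_le w hw
    split_ifs <;> omega

end Net

/-! ### The program for the minimum cost flow

Registers: 0 vertices, 1 edges, 2 arcs, 3 residual arcs, 4 free arcs, 5 unit, 6 source, 7 last
reached vertex, 8 label, 9 residual arc, 10 flag, 11 best residual arc, 12 vertex, 13 auxiliary,
14 edge. Arrays of naturals: 10 tails, 11 heads, 12 opposites, 13 residual capacities, 14 missing
outflow, 15 missing inflow, 16 labels, 17 predecessors, 18 parities. Arrays of reals: 10 costs,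
11 potentials. -/

namespace Program

/-- The reduced cost of the residual arc in register 9. -/
def rcExpr : RealExpr :=
  .sub (.add (.arr 10 (.reg 9)) (.arr 11 (.arr 10 (.reg 9)))) (.arr 11 (.arr 11 (.reg 9)))

/-- Register 10 tells whether a candidate exists and thus replaces an infinite initial minimum; real
register 0 keeps the least reduced cost, which is then the amount of the raise. -/
def scanBody : Program :=
  branch (.both (.both (.neg (.both (.natLe (.reg 4) (.reg 9))
      (.natLe (.arr 13 (.reg 9)) (.const 0)))) (.both (.natLe (.const 1) (.arr 16 (.arr 10 (.reg 9))))
      (.natLe (.arr 16 (.arr 11 (.reg 9))) (.const 0))))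
      (.neg (.both (.natLe (.const 1) (.reg 10)) (.realLe (.reg 0) rcExpr))))
    (seq (setNat 10 (.const 1)) (seq (setNat 11 (.reg 9)) (setReal 0 rcExpr))) skip

/-- Find the residual arc of least reduced cost that leaves the tree. -/
def scan : Program := seq (setNat 10 (.const 0)) (forLoop 9 (.reg 3) scanBody)

def raiseBody : Program :=
  branch (.natLe (.arr 16 (.reg 12)) (.const 0))
    (setRealArr 11 (.reg 12) (.add (.arr 11 (.reg 12)) (.reg 0))) skip

def raise : Program := forLoop 12 (.reg 0) raiseBody

def attach : Program :=
  seq (setNat 7 (.arr 11 (.reg 11))) (seq (setNat 8 (.add (.reg 8) (.const 1)))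
    (seq (setNatArr 16 (.reg 7) (.reg 8)) (setNatArr 17 (.reg 7) (.reg 11))))

def grow : Program := seq scan (seq raise attach)

def clear : Program := forLoop 12 (.reg 0) (setNatArr 16 (.reg 12) (.const 0))

def plant : Program :=
  seq (setNatArr 16 (.reg 6) (.const 1)) (seq (setNat 7 (.reg 6)) (setNat 8 (.const 1)))

def search : Program := loop (.neg (.natLe (.const 1) (.arr 15 (.reg 7)))) grow

def pushBody : Program :=
  seq (setNat 13 (.arr 17 (.reg 12)))
    (seq (setNatArr 13 (.reg 13) (.sub (.arr 13 (.reg 13)) (.reg 5)))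
    (seq (setNatArr 13 (.arr 12 (.reg 13)) (.add (.arr 13 (.arr 12 (.reg 13))) (.reg 5)))
      (setNat 12 (.arr 10 (.reg 13)))))

def pushLoop : Program :=
  loop (.neg (.both (.natLe (.reg 12) (.reg 6)) (.natLe (.reg 6) (.reg 12)))) pushBody

def settle : Program :=
  seq (setNatArr 14 (.reg 6) (.sub (.arr 14 (.reg 6)) (.reg 5)))
    (setNatArr 15 (.reg 7) (.sub (.arr 15 (.reg 7)) (.reg 5)))

def round : Program :=
  seq clear (seq plant (seq search (seq (setNat 12 (.reg 7)) (seq pushLoop settle))))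

def drain : Program := loop (.natLe (.const 1) (.arr 14 (.reg 6))) round

def solve : Program := forLoop 6 (.reg 0) drain

/-- `p` does not change the description of the network. -/
def keepsNet (p : Program) : Bool :=
  !p.writesNat 0 && !p.writesNat 3 && !p.writesNat 4 && !p.writesNat 5 && !p.writesNatArr 10 &&
    !p.writesNatArr 11 && !p.writesNatArr 12 && !p.writesRealArr 10

end Program

/-! ### Correctness and running time of the flow program -/

namespace Net

open Program

/-- The memory describes the network `N`. -/
structure Static (N : Net) (u : ℕ) (s : Store) : Prop where
  n : s.natReg 0 = N.n
  A : s.natReg 3 = N.A + N.A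
  F : s.natReg 4 = N.F
  u : s.natReg 5 = u
  tl : ∀ r < N.A + N.A, s.natArr 10 r = N.tl r
  hd : ∀ r < N.A + N.A, s.natArr 11 r = N.hd r
  opp : ∀ r < N.A + N.A, s.natArr 12 r = N.opp r
  co : ∀ r < N.A + N.A, s.realArr 10 r = N.co r

variable {N : Net} {u : ℕ}

theorem Static.frame {p : Program} {s s' : Store} (h : N.Static u s) (hf : Frame p s s')
    (hp : p.keepsNet = true) : N.Static u s' := by
  simp only [keepsNet, Bool.and_eq_true, Bool.not_eq_true'] at hp
  obtain ⟨⟨⟨⟨⟨⟨⟨h0, h3⟩, h4⟩, h5⟩, h10⟩, h11⟩, h12⟩, hr⟩ := hp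
  constructor
  · rw [hf.natReg _ h0]; exact h.n
  · rw [hf.natReg _ h3]; exact h.A
  · rw [hf.natReg _ h4]; exact h.F
  · rw [hf.natReg _ h5]; exact h.u
  · rw [hf.natArr _ h10]; exact h.tl
  · rw [hf.natArr _ h11]; exact h.hd
  · rw [hf.natArr _ h12]; exact h.opp
  · rw [hf.realArr _ hr]; exact h.co

/-- The size of the network, for time bounds. -/
def size (N : Net) (M : ℕ) : ℕ := N.n + N.A + N.A + M + 1

theorem runs_scan {s : Store} (hs : N.Static u s)
    (hex : ∃ r < N.A + N.A, N.Leaves (s.natArr 13) (s.natArr 16) r) :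
    scan.Runs s ((N.A + N.A) * 70 + 10) (fun s' => s'.natReg 11 < N.A + N.A ∧
      N.Leaves (s.natArr 13) (s.natArr 16) (s'.natReg 11) ∧
      s'.realReg 0 = N.rc (s.realArr 11) (s'.natReg 11) ∧
      ∀ r < N.A + N.A, N.Leaves (s.natArr 13) (s.natArr 16) r →
        s'.realReg 0 ≤ N.rc (s.realArr 11) r) := by
  let Inv : ℕ → Store → Prop := fun i s' =>
    (s'.natReg 10 = 0 ∧ ∀ r < i, ¬ N.Leaves (s.natArr 13) (s.natArr 16) r) ∨
    (s'.natReg 10 = 1 ∧ s'.natReg 11 < i ∧ N.Leaves (s.natArr 13) (s.natArr 16) (s'.natReg 11) ∧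
      s'.realReg 0 = N.rc (s.realArr 11) (s'.natReg 11) ∧
      ∀ r < i, N.Leaves (s.natArr 13) (s.natArr 16) r → s'.realReg 0 ≤ N.rc (s.realArr 11) r)
  refine (Runs.seq (T₁ := 2) (R := fun s' => s' = s.writeNat 10 0)
    ⟨_, _, by simp [NatExpr.size], .setNat s 10 (.const 0), rfl⟩ fun s₁ h₁ hf₁ =>
    Runs.forLoop (Inv := Inv) (N := N.A + N.A) (B := 60) rfl (fun s' hf => ?_) ?_ ?_).mono ?_ ?_
  · rw [NatExpr.eval, ← ((hs.frame hf₁ rfl).frame hf rfl).A]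
  · exact Or.inl ⟨by rw [h₁]; rfl, fun r hr => absurd hr (Nat.not_lt_zero r)⟩
  · intro i s₂ hi hinv hreg hf₂
    have hs₂ := (hs.frame hf₁ rfl).frame hf₂ rfl
    have e13 : s₂.natArr 13 = s.natArr 13 := (hf₂.natArr 13 rfl).trans (hf₁.natArr 13 rfl)
    have e16 : s₂.natArr 16 = s.natArr 16 := (hf₂.natArr 16 rfl).trans (hf₁.natArr 16 rfl)
    have eπ : s₂.realArr 11 = s.realArr 11 := (hf₂.realArr 11 rfl).trans (hf₁.realArr 11 rfl)
    refine Runs.of_effect rfl (by decide) ?_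
    have hrc : rcExpr.eval s₂ = N.rc (s.realArr 11) i := by
      simp only [rcExpr, RealExpr.eval, NatExpr.eval, hreg, hs₂.tl i hi, hs₂.hd i hi, hs₂.co i hi,
        eπ, rc]
    have htest : ∀ t, (Test.eval s₂ (.both (.both (.neg (.both (.natLe (.reg 4) (.reg 9))
      (.natLe (.arr 13 (.reg 9)) (.const 0)))) (.both (.natLe (.const 1) (.arr 16 (.arr 10 (.reg 9))))
      (.natLe (.arr 16 (.arr 11 (.reg 9))) (.const 0)))) t)) ↔
        N.Leaves (s.natArr 13) (s.natArr 16) i ∧ t.eval s₂ := by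
      intro t
      simp only [Test.eval, NatExpr.eval, hreg, hs₂.tl i hi, hs₂.hd i hi, hs₂.F, e13, e16, Leaves,
        Avail]
      refine and_congr_left fun _ => and_congr ?_ (and_congr Iff.rfl (by omega))
      omega
    by_cases ht : N.Leaves (s.natArr 13) (s.natArr 16) i ∧
        ¬ (1 ≤ s₂.natReg 10 ∧ s₂.realReg 0 ≤ N.rc (s.realArr 11) i)
    · rw [scanBody, effect, if_pos ((htest _).2 (by
        simpa only [Test.eval, NatExpr.eval, RealExpr.eval, hrc] using ht))]
      refine Or.inr ⟨rfl, ?_, ?_, ?_, ?_⟩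
      · show s₂.natReg 9 < i + 1
        omega
      · show N.Leaves _ _ (s₂.natReg 9)
        rw [hreg]; exact ht.1
      · show rcExpr.eval s₂ = N.rc _ (s₂.natReg 9)
        rw [hrc, hreg]
      · show ∀ r < i + 1, _ → rcExpr.eval s₂ ≤ _
        intro r hr hl
        rw [hrc]
        rcases Nat.lt_succ_iff_lt_or_eq.1 hr with h | h
        · rcases hinv with ⟨-, h2⟩ | ⟨h1, -, -, -, h5⟩
          · exact absurd hl (h2 r h)
          · have h6 := h5 r h hl
            have h7 : ¬ s₂.realReg 0 ≤ N.rc (s.realArr 11) i := fun h8 => ht.2 ⟨h1.ge, h8⟩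
            linarith
        · rw [h]
    · rw [scanBody, effect, if_neg (fun h => ht (by
        simpa only [Test.eval, NatExpr.eval, RealExpr.eval, hrc] using (htest _).1 h))]
      rw [not_and_not_right] at ht
      rcases hinv with ⟨h1, h2⟩ | ⟨h1, h2, h3, h4, h5⟩
      · refine Or.inl ⟨h1, fun r hr hl => ?_⟩
        rcases Nat.lt_succ_iff_lt_or_eq.1 hr with h | h
        · exact h2 r h hl
        · have := (ht (h ▸ hl)).1
          omega
      · refine Or.inr ⟨h1, Nat.lt_succ_of_lt h2, h3, h4, fun r hr hl => ?_⟩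
        rcases Nat.lt_succ_iff_lt_or_eq.1 hr with h | h
        · exact h5 r h hl
        · rw [h]; exact (ht (h ▸ hl)).2
  · simp only [NatExpr.size]; omega
  · rintro s' (⟨-, h⟩ | ⟨-, h⟩) -
    · obtain ⟨r, hr, hl⟩ := hex
      exact absurd hl (h r hr)
    · exact h

theorem runs_raise {s : Store} (hs : N.Static u s) :
    raise.Runs s (N.n * 30 + 10) (fun s' => ∀ w < N.n, s'.realArr 11 w =
      if s.natArr 16 w = 0 then s.realArr 11 w + s.realReg 0 else s.realArr 11 w) := by
  let Inv : ℕ → Store → Prop := fun i s' => ∀ w, s'.realArr 11 w =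
    if w < i ∧ s.natArr 16 w = 0 then s.realArr 11 w + s.realReg 0 else s.realArr 11 w
  refine (Runs.forLoop (Inv := Inv) (N := N.n) (B := 20) rfl (fun s' hf => by exact (hs.frame hf rfl).n) ?_
    ?_).mono ?_ ?_
  · intro w
    simp [Store.writeNat]
  · intro i s₂ hi hinv hreg hf₂
    have e16 : s₂.natArr 16 = s.natArr 16 := hf₂.natArr 16 rfl
    have e0 : s₂.realReg 0 = s.realReg 0 := hf₂.realReg 0 rfl
    refine Runs.of_effect rfl (by decide) ?_
    intro w
    by_cases h0 : s.natArr 16 i = 0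
    · rw [raiseBody, effect, if_pos (by simp [Test.eval, NatExpr.eval, hreg, e16, h0])]
      simp only [effect, Store.writeNat, Store.writeRealArr, NatExpr.eval, RealExpr.eval, hreg,
        Function.update_self, e0]
      by_cases hw : w = i
      · subst hw
        rw [Function.update_self, hinv w, if_neg (by omega), if_pos ⟨by omega, h0⟩]
      · rw [Function.update_of_ne hw, hinv w]
        exact if_congr (and_congr_left' (by omega)) rfl rfl
    · rw [raiseBody, effect, if_neg (by simp [Test.eval, NatExpr.eval, hreg, e16, h0])]
      refine (hinv w).trans (if_congr ⟨fun h => ⟨by omega, h.2⟩, fun h => ⟨?_, h.2⟩⟩ rfl rfl)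
      have : w ≠ i := by rintro rfl; exact h0 h.2
      omega
  · simp only [NatExpr.size]; omega
  · intro s' h _ w hw
    rw [h w]
    simp [hw]

theorem runs_clear {s : Store} (hs : N.Static u s) :
    clear.Runs s (N.n * 20 + 10) (fun s' => ∀ w < N.n, s'.natArr 16 w = 0) := by
  refine (Runs.forLoop (Inv := fun i s' => ∀ w < i, s'.natArr 16 w = 0) (N := N.n) (B := 10) rfl
    (fun s' hf => by exact (hs.frame hf rfl).n) (fun w hw => absurd hw (Nat.not_lt_zero w)) ?_).mono ?_
    (fun s' h _ => h)
  · intro i s₂ hi hinv hreg hf₂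
    refine Runs.of_effect rfl (by decide) ?_
    intro w hw
    simp only [effect, Store.writeNat, Store.writeNatArr, NatExpr.eval, hreg, Function.update_self]
    by_cases hwi : w = i
    · rw [hwi, Function.update_self]
    · rw [Function.update_of_ne hwi]
      exact hinv w (by omega)
  · simp only [NatExpr.size]; omega

end Net

namespace Net

open Program

variable {N : Net} {u M : ℕ}

theorem runs_grow {s : Store} (hs : N.Static u s) {d : ℕ → ℤ}
    (hg : N.Good u (s.natArr 13) d (s.realArr 11))
    (ht : N.Tree (s.natArr 13) (s.natArr 15) (s.realArr 11) (s.natArr 16) (s.natArr 17) (s.natReg 6)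
      (s.natReg 7) (s.natReg 8))
    (hv : s.natArr 15 (s.natReg 7) = 0) (hn : 0 < ∑ w ∈ Finset.range N.n, s.natArr 15 w) :
    grow.Runs s (100 * N.size M) (fun s' => N.Good u (s'.natArr 13) d (s'.realArr 11) ∧
      N.Tree (s'.natArr 13) (s'.natArr 15) (s'.realArr 11) (s'.natArr 16) (s'.natArr 17)
        (s'.natReg 6) (s'.natReg 7) (s'.natReg 8) ∧ s'.natReg 8 = s.natReg 8 + 1) := by
  refine (Runs.seq (runs_scan hs (ht.exists_leaves hv hn)) fun s₁ h₁ hf₁ =>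
    Runs.seq (runs_raise (hs.frame hf₁ rfl)) fun s₂ h₂ hf₂ =>
      Runs.of_effect (T := 30) rfl (by decide) ?_).mono (by unfold size; omega) (fun s' h _ => h)
  obtain ⟨hr, hl, hδ, hmin⟩ := h₁
  have e : s₂.natReg 11 = s₁.natReg 11 := hf₂.natReg 11 rfl
  have ehd : s₂.natArr 11 (s₂.natReg 11) = N.hd (s₁.natReg 11) := by
    rw [((hs.frame hf₁ rfl).frame hf₂ rfl).hd _ (e ▸ hr), e]
  have e6 : s₂.natReg 6 = s.natReg 6 := (hf₂.natReg 6 rfl).trans (hf₁.natReg 6 rfl)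
  have e8 : s₂.natReg 8 = s.natReg 8 := (hf₂.natReg 8 rfl).trans (hf₁.natReg 8 rfl)
  have e13 : s₂.natArr 13 = s.natArr 13 := (hf₂.natArr 13 rfl).trans (hf₁.natArr 13 rfl)
  have e15 : s₂.natArr 15 = s.natArr 15 := (hf₂.natArr 15 rfl).trans (hf₁.natArr 15 rfl)
  have e16 : s₂.natArr 16 = s.natArr 16 := (hf₂.natArr 16 rfl).trans (hf₁.natArr 16 rfl)
  have e17 : s₂.natArr 17 = s.natArr 17 := (hf₂.natArr 17 rfl).trans (hf₁.natArr 17 rfl)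
  have e16' : s₁.natArr 16 = s.natArr 16 := hf₁.natArr 16 rfl
  have e11' : s₁.realArr 11 = s.realArr 11 := hf₁.realArr 11 rfl
  rw [e16', e11', hδ] at h₂
  rw [hδ] at hmin
  -- The raise is nonnegative because the chosen arc is available, and no larger than any reduced
  -- cost leaving the tree.
  have hgood := hg.raise (hg.slack _ hr hl.1) hmin h₂
  have htree := ht.grow hv hr hl h₂
  have E13 : (attach.effect s₂).natArr 13 = s.natArr 13 := e13
  have E15 : (attach.effect s₂).natArr 15 = s.natArr 15 := e15
  have E11 : (attach.effect s₂).realArr 11 = s₂.realArr 11 := rfl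
  have E6 : (attach.effect s₂).natReg 6 = s.natReg 6 := e6
  have E7 : (attach.effect s₂).natReg 7 = N.hd (s₁.natReg 11) := ehd
  have E8 : (attach.effect s₂).natReg 8 = s.natReg 8 + 1 := by rw [← e8]; rfl
  have E16 : (attach.effect s₂).natArr 16 =
      Function.update (s.natArr 16) (N.hd (s₁.natReg 11)) (s.natReg 8 + 1) := by
    rw [← e16, ← ehd, ← e8]; rfl
  have E17 : (attach.effect s₂).natArr 17 =
      Function.update (s.natArr 17) (N.hd (s₁.natReg 11)) (s₁.natReg 11) := by
    rw [← e17, ← ehd, ← e]; rfl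
  rw [E13, E15, E11, E6, E7, E8, E16, E17]
  exact ⟨hgood, htree, rfl⟩

/-- Each growth increases the last label, and labels never exceed the number of vertices. -/
theorem runs_search {s : Store} (hs : N.Static u s) {d : ℕ → ℤ}
    (hg : N.Good u (s.natArr 13) d (s.realArr 11))
    (ht : N.Tree (s.natArr 13) (s.natArr 15) (s.realArr 11) (s.natArr 16) (s.natArr 17) (s.natReg 6)
      (s.natReg 7) (s.natReg 8))
    (hn : 0 < ∑ w ∈ Finset.range N.n, s.natArr 15 w) :
    search.Runs s (110 * N.size M ^ 2) (fun s' => N.Good u (s'.natArr 13) d (s'.realArr 11) ∧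
      N.Tree (s'.natArr 13) (s'.natArr 15) (s'.realArr 11) (s'.natArr 16) (s'.natArr 17)
        (s'.natReg 6) (s'.natReg 7) (s'.natReg 8) ∧ 0 < s'.natArr 15 (s'.natReg 7)) := by
  refine (Runs.loop (Inv := fun s' => N.Good u (s'.natArr 13) d (s'.realArr 11) ∧
      N.Tree (s'.natArr 13) (s'.natArr 15) (s'.realArr 11) (s'.natArr 16) (s'.natArr 17)
        (s'.natReg 6) (s'.natReg 7) (s'.natReg 8)) (μ := fun s' => N.n - s'.natReg 8)
      (B := 100 * N.size M) ⟨hg, ht⟩ ?_).mono ?_ ?_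
  · rintro s₁ ⟨hg₁, ht₁⟩ hf htest
    have e15 : s₁.natArr 15 = s.natArr 15 := hf.natArr 15 rfl
    refine (runs_grow (hs.frame hf rfl) hg₁ ht₁ ?_ (by rwa [e15])).mono le_rfl ?_
    · simp only [Test.eval, NatExpr.eval] at htest; omega
    · rintro s₂ ⟨h1, h2, h3⟩ -
      refine ⟨⟨h1, h2⟩, ?_⟩
      have := h2.count
      omega
  · simp only [Test.size, NatExpr.size]
    have h1 : N.n - s.natReg 8 + 1 ≤ N.size M := by unfold size; omega
    generalize N.n - s.natReg 8 = a at *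
    generalize N.size M = X at *
    nlinarith
  · rintro s' ⟨⟨h1, h2⟩, h3⟩ -
    simp only [Test.eval, NatExpr.eval] at h3
    exact ⟨h1, h2, by omega⟩

/-- The variant is the label of the current vertex. The tree refers to the old capacities `K₀`;
`Augment` tracks the changed ones. -/
theorem runs_pushLoop {s : Store} (hs : N.Static u s) {K₀ need : ℕ → ℕ} {d : ℕ → ℤ} {c : ℕ}
    (ht : N.Tree K₀ need (s.realArr 11) (s.natArr 16) (s.natArr 17) (s.natReg 6) (s.natReg 7) c)
    (ha : N.Augment u (s.natArr 13) d (s.realArr 11) (s.natArr 16) (s.natArr 17) (s.natReg 6)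
      (s.natReg 7) (s.natReg 12)) :
    pushLoop.Runs s (60 * N.size M) (fun s' => N.Augment u (s'.natArr 13) d (s.realArr 11)
      (s.natArr 16) (s.natArr 17) (s.natReg 6) (s.natReg 7) (s.natReg 6)) := by
  refine (Runs.loop (Inv := fun s' => N.Augment u (s'.natArr 13) d (s.realArr 11)
      (s.natArr 16) (s.natArr 17) (s.natReg 6) (s.natReg 7) (s'.natReg 12))
      (μ := fun s' => s.natArr 16 (s'.natReg 12)) (B := 40) ha ?_).mono ?_ ?_
  · rintro s₁ ha₁ hf htest
    have hs₁ := hs.frame hf rfl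
    have e6 : s₁.natReg 6 = s.natReg 6 := hf.natReg 6 rfl
    have e17 : s₁.natArr 17 = s.natArr 17 := hf.natArr 17 rfl
    have hne : s₁.natReg 12 ≠ s.natReg 6 := by
      simp only [Test.eval, NatExpr.eval, e6] at htest; omega
    refine Runs.of_effect rfl (by decide) ?_
    have hr := (ht.pred _ ha₁.w_lt ha₁.ord_w hne).1
    have hpush := ha₁.push ht hne
    rw [← e17] at hr hpush
    have E12 : (pushBody.effect s₁).natReg 12 = N.tl (s₁.natArr 17 (s₁.natReg 12)) :=
      hs₁.tl _ hr
    have E13 : (pushBody.effect s₁).natArr 13 =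
        N.push u (s₁.natArr 13) (s₁.natArr 17 (s₁.natReg 12)) := by
      -- The nested updates in the definition of `push` mirror the assignments of `pushBody`.
      rw [push, ← hs₁.opp _ hr, ← hs₁.u]; rfl
    rw [E12, E13, ← e17]
    exact hpush
  · simp only [Test.size, NatExpr.size]
    have h1 := ht.ord_le _ ha.w_lt
    have h2 := ht.count
    have h3 : s.natArr 16 (s.natReg 12) + 1 ≤ N.size M := by unfold size; omega
    omega
  · rintro s' ⟨h1, h2⟩ hf
    have e6 : s'.natReg 6 = s.natReg 6 := hf.natReg 6 rfl
    simp only [Test.eval, NatExpr.eval, e6] at h2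
    have h3 : s'.natReg 12 = s.natReg 6 := by omega
    rwa [h3] at h1

theorem runs_round {s : Store} (hs : N.Static u s)
    (hst : N.State u M (s.natArr 13) (s.natArr 14) (s.natArr 15) (s.realArr 11))
    (hi : s.natReg 6 < N.n) (hi0 : 0 < s.natArr 14 (s.natReg 6)) :
    round.Runs s (300 * N.size M ^ 2) (fun s' =>
      N.State u M (s'.natArr 13) (s'.natArr 14) (s'.natArr 15) (s'.realArr 11) ∧
      s'.natArr 14 = Function.update (s.natArr 14) (s.natReg 6)
        (s.natArr 14 (s.natReg 6) - u)) := by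
  refine (Runs.seq (runs_clear hs) fun s₁ h₁ hf₁ =>
    Runs.seq (T₁ := 20) (R := fun s' => s' = plant.effect s₁)
      (Runs.of_effect rfl (by decide) rfl) fun s₂ h₂ hf₂ => ?_).mono
      (T := N.n * 20 + 10 + (20 + (110 * N.size M ^ 2 + (5 + (60 * N.size M + 20))))) ?_
      (fun s' h _ => h)
  · have hs₂ := (hs.frame hf₁ rfl).frame hf₂ rfl
    have e13 : s₂.natArr 13 = s.natArr 13 := (hf₂.natArr 13 rfl).trans (hf₁.natArr 13 rfl)
    have e14 : s₂.natArr 14 = s.natArr 14 := (hf₂.natArr 14 rfl).trans (hf₁.natArr 14 rfl)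
    have e15 : s₂.natArr 15 = s.natArr 15 := (hf₂.natArr 15 rfl).trans (hf₁.natArr 15 rfl)
    have eπ : s₂.realArr 11 = s.realArr 11 := (hf₂.realArr 11 rfl).trans (hf₁.realArr 11 rfl)
    have e6' : s₁.natReg 6 = s.natReg 6 := hf₁.natReg 6 rfl
    have e6 : s₂.natReg 6 = s.natReg 6 := (hf₂.natReg 6 rfl).trans e6'
    have e7 : s₂.natReg 7 = s.natReg 6 := by rw [h₂, ← e6']; rfl
    have e8 : s₂.natReg 8 = 1 := by rw [h₂]; rfl
    have e16 : s₂.natArr 16 = Function.update (s₁.natArr 16) (s.natReg 6) 1 := by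
      rw [h₂, ← e6']; rfl
    have hord : ∀ w < N.n, s₂.natArr 16 w = if w = s.natReg 6 then 1 else 0 := by
      intro w hw
      rw [e16, Function.update_apply, h₁ w hw]
    have hg : N.Good u (s₂.natArr 13) (fun x => (s.natArr 15 x : ℤ) - s.natArr 14 x)
        (s₂.realArr 11) := by
      rw [e13, eπ]; exact hst.good
    -- The initial tree is the source alone, with label 1.
    have htree : N.Tree (s₂.natArr 13) (s₂.natArr 15) (s₂.realArr 11) (s₂.natArr 16)
        (s₂.natArr 17) (s₂.natReg 6) (s₂.natReg 7) (s₂.natReg 8) := by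
      rw [e6, e7, e8]
      refine ⟨hi, hi, ?_, ?_, fun w hw => ?_, fun w hw h0 hws => ?_, fun w hw h0 hws => ?_, ?_⟩
      · rw [hord _ hi, if_pos rfl]; exact one_pos
      · rw [hord _ hi, if_pos rfl]; exact one_pos
      · rw [hord w hw]; split_ifs <;> omega
      · rw [hord w hw, if_neg hws] at h0; omega
      · rw [hord w hw, if_neg hws] at h0; omega
      · have h3 : (Finset.range N.n).filter (fun w => s₂.natArr 16 w = 0) ⊂ Finset.range N.n := by
          rw [Finset.filter_ssubset]
          exact ⟨s.natReg 6, Finset.mem_range.2 hi, by rw [hord _ hi, if_pos rfl]; omega⟩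
        have := Finset.card_lt_card h3
        rw [Finset.card_range] at this
        omega
    have hsum : 0 < ∑ w ∈ Finset.range N.n, s₂.natArr 15 w := by
      rw [e15, ← hst.sum_eq]
      exact hi0.trans_le (Finset.single_le_sum (f := s.natArr 14) (fun _ _ => Nat.zero_le _)
        (Finset.mem_range.2 hi))
    refine Runs.seq (runs_search hs₂ hg htree hsum) fun s₃ h₃ hf₃ =>
      Runs.seq (T₁ := 5) (R := fun s' => s' = s₃.writeNat 12 (s₃.natReg 7))
        (Runs.of_effect rfl (by decide) rfl) fun s₄ h₄ hf₄ => ?_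
    obtain ⟨hg₃, ht₃, hv₃⟩ := h₃
    have hs₄ := (hs₂.frame hf₃ rfl).frame hf₄ rfl
    have haug : N.Augment u (s₄.natArr 13) (fun x => (s.natArr 15 x : ℤ) - s.natArr 14 x)
        (s₄.realArr 11) (s₄.natArr 16) (s₄.natArr 17) (s₄.natReg 6) (s₄.natReg 7)
        (s₄.natReg 12) := by
      rw [h₄]; exact ht₃.augment hg₃
    have ht₄ : N.Tree (s₄.natArr 13) (s₄.natArr 15) (s₄.realArr 11) (s₄.natArr 16)
        (s₄.natArr 17) (s₄.natReg 6) (s₄.natReg 7) (s₄.natReg 8) := by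
      rw [h₄]; exact ht₃
    refine Runs.seq (runs_pushLoop hs₄ ht₄ haug) fun s₅ h₅ hf₅ =>
      Runs.of_effect rfl (by decide) ?_
    have E6 : s₅.natReg 6 = s.natReg 6 := by
      rw [hf₅.natReg 6 rfl, hf₄.natReg 6 rfl, hf₃.natReg 6 rfl, e6]
    have E7 : s₅.natReg 7 = s₄.natReg 7 := hf₅.natReg 7 rfl
    have E7' : s₄.natReg 7 = s₃.natReg 7 := hf₄.natReg 7 rfl
    have E14 : s₅.natArr 14 = s.natArr 14 := by
      rw [hf₅.natArr 14 rfl, hf₄.natArr 14 rfl, hf₃.natArr 14 rfl, e14]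
    have E15' : s₃.natArr 15 = s.natArr 15 := by rw [hf₃.natArr 15 rfl, e15]
    have E15 : s₅.natArr 15 = s.natArr 15 := by
      rw [hf₅.natArr 15 rfl, hf₄.natArr 15 rfl, E15']
    have Eπ : s₅.realArr 11 = s₄.realArr 11 := hf₅.realArr 11 rfl
    have E6' : s₄.natReg 6 = s.natReg 6 := by
      rw [hf₄.natReg 6 rfl, hf₃.natReg 6 rfl, e6]
    have E5 : s₅.natReg 5 = u := (hs₄.frame hf₅ rfl).u
    have F14 : (settle.effect s₅).natArr 14 = Function.update (s.natArr 14) (s.natReg 6)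
        (s.natArr 14 (s.natReg 6) - u) := by
      rw [← E14, ← E6, ← E5]; rfl
    have F15 : (settle.effect s₅).natArr 15 = Function.update (s.natArr 15) (s₄.natReg 7)
        (s.natArr 15 (s₄.natReg 7) - u) := by
      rw [← E15, ← E7, ← E5]; rfl
    have F13 : (settle.effect s₅).natArr 13 = s₅.natArr 13 := rfl
    have Fπ : (settle.effect s₅).realArr 11 = s₄.realArr 11 := Eπ
    rw [F13, F14, F15, Fπ]
    refine ⟨hst.augmented hi ht₄.v_lt hi0 ?_ ?_, rfl⟩
    · rw [E7', ← E15']; exact hv₃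
    · rw [← E6']; exact h₅.good
  · have h1 : N.n + 1 ≤ N.size M := by unfold size; omega
    generalize N.size M = X at *
    nlinarith

/-- Every round lowers the missing outflow of the source by `u > 0`, and it was at most `M`. -/
theorem runs_drain (hu : 0 < u) {s : Store} (hs : N.Static u s)
    (hst : N.State u M (s.natArr 13) (s.natArr 14) (s.natArr 15) (s.realArr 11))
    (hi : s.natReg 6 < N.n) :
    drain.Runs s (310 * N.size M ^ 3) (fun s' =>
      N.State u M (s'.natArr 13) (s'.natArr 14) (s'.natArr 15) (s'.realArr 11) ∧
      s'.natArr 14 (s.natReg 6) = 0 ∧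
      ∀ w, w ≠ s.natReg 6 → s'.natArr 14 w = s.natArr 14 w) := by
  refine (Runs.loop (Inv := fun s' =>
      N.State u M (s'.natArr 13) (s'.natArr 14) (s'.natArr 15) (s'.realArr 11) ∧
      ∀ w, w ≠ s.natReg 6 → s'.natArr 14 w = s.natArr 14 w)
      (μ := fun s' => s'.natArr 14 (s.natReg 6)) (B := 300 * N.size M ^ 2)
      ⟨hst, fun _ _ => rfl⟩ ?_).mono ?_ ?_
  · rintro s₁ ⟨h1, h2⟩ hf htest
    have e6 : s₁.natReg 6 = s.natReg 6 := hf.natReg 6 rfl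
    simp only [Test.eval, NatExpr.eval] at htest
    refine (runs_round (hs.frame hf rfl) h1 (by rwa [e6]) htest).mono le_rfl ?_
    rintro s₂ ⟨h3, h4⟩ -
    rw [e6] at h4 htest
    refine ⟨⟨h3, fun w hw => ?_⟩, ?_⟩
    · rw [h4, Function.update_of_ne hw, h2 w hw]
    · rw [h4, Function.update_self]; omega
  · simp only [Test.size, NatExpr.size]
    have h1 := hst.sup_le _ hi
    have h2 : s.natArr 14 (s.natReg 6) + 1 ≤ N.size M := by unfold size; omega
    generalize s.natArr 14 (s.natReg 6) = a at *
    generalize N.size M = X at *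
    have h3 : 1 ≤ X := by omega
    have h4 : a * (300 * X ^ 2 + (1 + (1 + 1) + 1)) + (1 + (1 + 1) + 1) ≤
        (a + 1) * (310 * X ^ 2) := by nlinarith [Nat.one_le_pow 2 X h3]
    calc _ ≤ (a + 1) * (310 * X ^ 2) := h4
      _ ≤ X * (310 * X ^ 2) := Nat.mul_le_mul_right _ h2
      _ = 310 * X ^ 3 := by ring
  · rintro s' ⟨⟨h1, h2⟩, h3⟩ hf
    have e6 : s'.natReg 6 = s.natReg 6 := hf.natReg 6 rfl
    simp only [Test.eval, NatExpr.eval, e6] at h3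
    exact ⟨h1, by omega, h2⟩

theorem runs_solve (hu : 0 < u) {s : Store} (hs : N.Static u s)
    (hst : N.State u M (s.natArr 13) (s.natArr 14) (s.natArr 15) (s.realArr 11)) :
    solve.Runs s (330 * N.size M ^ 4) (fun s' =>
      N.Good u (s'.natArr 13) (fun _ => 0) (s'.realArr 11)) := by
  refine (Runs.forLoop (Inv := fun i s' =>
      N.State u M (s'.natArr 13) (s'.natArr 14) (s'.natArr 15) (s'.realArr 11) ∧
      ∀ w < i, s'.natArr 14 w = 0) (N := N.n) (B := 310 * N.size M ^ 3) rfl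
      (fun s' hf => by exact (hs.frame hf rfl).n) ⟨hst, fun w hw => absurd hw (Nat.not_lt_zero w)⟩
      ?_).mono ?_ ?_
  · rintro i s₁ hi ⟨h1, h2⟩ hreg hf
    refine (runs_drain hu (hs.frame hf rfl) h1 (by rwa [hreg])).mono le_rfl ?_
    rintro s₂ ⟨h3, h4, h5⟩ -
    rw [hreg] at h4 h5
    refine ⟨h3, fun w hw => ?_⟩
    by_cases hwi : w = i
    · rw [hwi]; exact h4
    · exact (h5 w hwi).trans (h2 w (by omega))
  · simp only [NatExpr.size]
    have h2 : N.n + 1 ≤ N.size M := by unfold size; omega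
    generalize N.n = a at *
    generalize N.size M = X at *
    have h3 : 1 ≤ X := by omega
    have h4 : a * (310 * X ^ 3 + 1 + 7) + 1 + 5 ≤ (a + 1) * (330 * X ^ 3) := by
      nlinarith [Nat.one_le_pow 3 X h3]
    calc _ ≤ (a + 1) * (330 * X ^ 3) := h4
      _ ≤ X * (330 * X ^ 3) := Nat.mul_le_mul_right _ h2
      _ = 330 * X ^ 4 := by ring
  · rintro s' ⟨h1, h2⟩ -
    -- No outflow is missing any more, and the totals agree, so no inflow is missing.
    have h3 : ∑ w ∈ Finset.range N.n, s'.natArr 15 w = 0 := by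
      rw [← h1.sum_eq]
      exact Finset.sum_eq_zero fun w hw => h2 w (Finset.mem_range.1 hw)
    refine ⟨h1.good.slack, h1.good.dvd, h1.good.cap, fun v hv => ?_⟩
    have h4 := h1.good.bal v hv
    have h5 := (Finset.sum_eq_zero_iff.1 h3) v (Finset.mem_range.2 hv)
    rw [← h4]
    simp [h2 v hv, h5]

end Net

/-! ### The construction of the network -/

namespace Store

/-- The tail of the arc `j` of the flow digraph: the arcs are the deadhead arcs `(e, true)`, the
deadhead arcs `(e, false)` and the reversal arcs, in this order. -/
noncomputable def arcTail (s : Store) (m j : ℕ) : ℕ :=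
  open Classical in
  if j < m then s.natArr 0 j else if j < m + m then s.natArr 1 (j - m)
  else if s.realArr 0 (j - (m + m)) ≤ s.realArr 1 (j - (m + m)) then s.natArr 1 (j - (m + m))
  else s.natArr 0 (j - (m + m))

noncomputable def arcHead (s : Store) (m j : ℕ) : ℕ :=
  open Classical in
  if j < m then s.natArr 1 j else if j < m + m then s.natArr 0 (j - m)
  else if s.realArr 0 (j - (m + m)) ≤ s.realArr 1 (j - (m + m)) then s.natArr 0 (j - (m + m))
  else s.natArr 1 (j - (m + m))

/-- Twice the cost of the arc `j`. -/
noncomputable def arcCost (s : Store) (m j : ℕ) : ℝ :=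
  open Classical in
  if j < m then s.realArr 2 j + s.realArr 2 j
  else if j < m + m then s.realArr 3 (j - m) + s.realArr 3 (j - m)
  else if s.realArr 0 (j - (m + m)) ≤ s.realArr 1 (j - (m + m)) then
    s.realArr 1 (j - (m + m)) - s.realArr 0 (j - (m + m))
  else s.realArr 0 (j - (m + m)) - s.realArr 1 (j - (m + m))

/-- Free arcs get the initial entry 0, which is never read as a capacity. Edges that are not
required also get a reversal arc, of capacity 0, so that the numbering stays uniform. -/
def arcCap (s : Store) (m j : ℕ) : ℕ :=
  if j < m + m then 0 else s.natArr 2 (j - (m + m)) + s.natArr 2 (j - (m + m))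

end Store

namespace Program

/-- The unit in register 5 starts as 2 and is lowered by `normalizeBody` as soon as an odd imbalance
is met. -/
def prep : Program :=
  seq (setNat 4 (.add (.reg 1) (.reg 1))) (seq (setNat 2 (.add (.reg 4) (.reg 1)))
    (seq (setNat 3 (.add (.reg 2) (.reg 2))) (setNat 5 (.const 2))))

def loadArc : Program :=
  branch (.neg (.natLe (.reg 1) (.reg 14)))
    (seq (setNat 15 (.arr 0 (.reg 14))) (seq (setNat 16 (.arr 1 (.reg 14)))
      (seq (setNat 17 (.const 0))
        (setReal 1 (.add (.arr 2 (.reg 14)) (.arr 2 (.reg 14)))))))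
    (branch (.neg (.natLe (.reg 4) (.reg 14)))
      (seq (setNat 15 (.arr 1 (.sub (.reg 14) (.reg 1))))
        (seq (setNat 16 (.arr 0 (.sub (.reg 14) (.reg 1)))) (seq (setNat 17 (.const 0))
          (setReal 1 (.add (.arr 3 (.sub (.reg 14) (.reg 1))) (.arr 3 (.sub (.reg 14) (.reg 1))))))))
      (seq (setNat 13 (.sub (.reg 14) (.reg 4)))
        (seq (setNat 17 (.add (.arr 2 (.reg 13)) (.arr 2 (.reg 13))))
          (branch (.realLe (.arr 0 (.reg 13)) (.arr 1 (.reg 13)))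
            (seq (setNat 15 (.arr 1 (.reg 13))) (seq (setNat 16 (.arr 0 (.reg 13)))
              (setReal 1 (.sub (.arr 1 (.reg 13)) (.arr 0 (.reg 13))))))
            (seq (setNat 15 (.arr 0 (.reg 13))) (seq (setNat 16 (.arr 1 (.reg 13)))
              (setReal 1 (.sub (.arr 0 (.reg 13)) (.arr 1 (.reg 13))))))))))

def storeArc : Program :=
  seq (setNatArr 10 (.reg 14) (.reg 15)) (seq (setNatArr 10 (.add (.reg 2) (.reg 14)) (.reg 16))
    (seq (setNatArr 11 (.reg 14) (.reg 16)) (seq (setNatArr 11 (.add (.reg 2) (.reg 14)) (.reg 15))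
      (seq (setNatArr 12 (.reg 14) (.add (.reg 2) (.reg 14)))
        (seq (setNatArr 12 (.add (.reg 2) (.reg 14)) (.reg 14))
          (seq (setRealArr 10 (.reg 14) (.reg 1))
            (seq (setRealArr 10 (.add (.reg 2) (.reg 14)) (.sub .zero (.reg 1)))
              (setNatArr 13 (.reg 14) (.reg 17)))))))))

def build : Program := forLoop 14 (.reg 2) (seq loadArc storeArc)

/-- The arcs with a positive entry are the reversal arcs of required edges. They oppose the selected
arcs, so heads minus tails is the imbalance. Parities are kept by flipping, as the machine cannot
divide. -/
def countBody : Program :=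
  branch (.natLe (.const 1) (.arr 13 (.reg 14)))
    (seq (setNat 15 (.arr 11 (.reg 14))) (seq (setNat 16 (.arr 10 (.reg 14)))
      (seq (setNatArr 15 (.reg 15) (.add (.arr 15 (.reg 15)) (.const 1)))
        (seq (setNatArr 18 (.reg 15) (.sub (.const 1) (.arr 18 (.reg 15))))
          (seq (setNatArr 14 (.reg 16) (.add (.arr 14 (.reg 16)) (.const 1)))
            (setNatArr 18 (.reg 16) (.sub (.const 1) (.arr 18 (.reg 16)))))))))
    skip

def count : Program := forLoop 14 (.reg 2) countBody

/-- The two truncated differences are the positive and negative parts of the demand; register 13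
saves one before its operands change. -/
def subtract : Program :=
  seq (setNat 13 (.sub (.arr 15 (.reg 12)) (.arr 14 (.reg 12))))
    (seq (setNatArr 14 (.reg 12) (.sub (.arr 14 (.reg 12)) (.arr 15 (.reg 12))))
      (setNatArr 15 (.reg 12) (.reg 13)))

def normalizeBody : Program :=
  seq (branch (.natLe (.const 1) (.arr 18 (.reg 12))) (setNat 5 (.const 1)) skip) subtract

def normalize : Program := forLoop 12 (.reg 0) normalizeBody

/-- The arcs, their opposites and their capacities are in the memory. -/
structure Built (S : Store) (m i : ℕ) (s : Store) : Prop where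
  arcs : ∀ j < i, s.natArr 10 j = S.arcTail m j ∧ s.natArr 10 (m + m + m + j) = S.arcHead m j ∧
    s.natArr 11 j = S.arcHead m j ∧ s.natArr 11 (m + m + m + j) = S.arcTail m j ∧
    s.natArr 12 j = m + m + m + j ∧ s.natArr 12 (m + m + m + j) = j ∧
    s.realArr 10 j = S.arcCost m j ∧ s.realArr 10 (m + m + m + j) = - S.arcCost m j ∧
    s.natArr 13 j = S.arcCap m j
  opp : ∀ j, m + m + m ≤ j → s.natArr 13 j = 0

/-- The input is in the memory, and the sizes of the network. -/
structure Prepared (S : Store) (n m : ℕ) (s : Store) : Prop where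
  vertices : s.natReg 0 = n
  edges : s.natReg 1 = m
  arcs : s.natReg 2 = m + m + m
  residualArcs : s.natReg 3 = m + m + m + (m + m + m)
  freeArcs : s.natReg 4 = m + m
  src : s.natArr 0 = S.natArr 0
  tgt : s.natArr 1 = S.natArr 1
  req : s.natArr 2 = S.natArr 2
  service : s.realArr 0 = S.realArr 0
  service' : s.realArr 1 = S.realArr 1
  deadhead : s.realArr 2 = S.realArr 2
  deadhead' : s.realArr 3 = S.realArr 3

def keepsInput (p : Program) : Bool :=
  !p.writesNat 0 && !p.writesNat 1 && !p.writesNat 2 && !p.writesNat 3 && !p.writesNat 4 &&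
    !p.writesNatArr 0 && !p.writesNatArr 1 && !p.writesNatArr 2 && !p.writesRealArr 0 &&
    !p.writesRealArr 1 && !p.writesRealArr 2 && !p.writesRealArr 3

theorem Prepared.frame {p : Program} {S s s' : Store} {n m : ℕ} (h : Prepared S n m s)
    (hf : Frame p s s') (hp : p.keepsInput = true) : Prepared S n m s' := by
  simp only [keepsInput, Bool.and_eq_true, Bool.not_eq_true'] at hp
  obtain ⟨⟨⟨⟨⟨⟨⟨⟨⟨⟨⟨h0, h1⟩, h2⟩, h3⟩, h4⟩, a0⟩, a1⟩, a2⟩, r0⟩, r1⟩, r2⟩, r3⟩ := hp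
  exact ⟨(hf.natReg _ h0).trans h.vertices, (hf.natReg _ h1).trans h.edges, (hf.natReg _ h2).trans h.arcs,
    (hf.natReg _ h3).trans h.residualArcs, (hf.natReg _ h4).trans h.freeArcs, (hf.natArr _ a0).trans h.src,
    (hf.natArr _ a1).trans h.tgt, (hf.natArr _ a2).trans h.req, (hf.realArr _ r0).trans h.service,
    (hf.realArr _ r1).trans h.service', (hf.realArr _ r2).trans h.deadhead,
    (hf.realArr _ r3).trans h.deadhead'⟩

theorem effect_loadArc {S s : Store} {n m j : ℕ} (h : Prepared S n m s) (hj : s.natReg 14 = j) :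
    (loadArc.effect s).natReg 15 = S.arcTail m j ∧ (loadArc.effect s).natReg 16 = S.arcHead m j ∧
      (loadArc.effect s).natReg 17 = S.arcCap m j ∧
      (loadArc.effect s).realReg 1 = S.arcCost m j := by
  have e0 := h.src
  have e1 := h.tgt
  have e2 := h.req
  have e3 := h.service
  have e4 := h.service'
  have e5 := h.deadhead
  have e6 := h.deadhead'
  by_cases h1 : j < m
  · rw [loadArc, effect, if_pos (by simpa [Test.eval, NatExpr.eval, h.edges, hj] using h1)]
    simp [effect, Store.writeNat, Store.writeReal, NatExpr.eval, RealExpr.eval, hj, e0, e1, e5,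
      Store.arcTail, Store.arcHead, Store.arcCost, Store.arcCap, h1,
      show j < m + m by omega]
  · rw [loadArc, effect, if_neg (by simpa [Test.eval, NatExpr.eval, h.edges, hj] using h1), effect]
    by_cases h2 : j < m + m
    · rw [if_pos (by simpa [Test.eval, NatExpr.eval, h.freeArcs, hj] using h2)]
      simp [effect, Store.writeNat, Store.writeReal, NatExpr.eval, RealExpr.eval, hj, e0, e1, e6,
        h.edges, Store.arcTail, Store.arcHead, Store.arcCost, Store.arcCap, h1, h2]
    · rw [if_neg (by simpa [Test.eval, NatExpr.eval, h.freeArcs, hj] using h2)]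
      by_cases h3 : S.realArr 0 (j - (m + m)) ≤ S.realArr 1 (j - (m + m)) <;>
      simp [effect, Store.writeNat, Store.writeReal, NatExpr.eval, RealExpr.eval, Test.eval, hj,
        e0, e1, e2, e3, e4, h.freeArcs, Store.arcTail, Store.arcHead, Store.arcCost, Store.arcCap, h1, h2,
        h3]

theorem runs_build {S s : Store} {n m : ℕ} (h : Prepared S n m s) (h13 : ∀ j, s.natArr 13 j = 0) :
    build.Runs s ((m + m + m) * 230 + 10) (fun s' => Built S m (m + m + m) s') := by
  refine (Runs.forLoop (Inv := fun i s' => Built S m i s') (N := m + m + m) (B := 220) rfl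
    (fun s' hf => by exact (h.frame hf rfl).arcs) ⟨fun j hj => absurd hj (Nat.not_lt_zero j),
      fun j _ => h13 j⟩ ?_).mono ?_ (fun s' h _ => h)
  · intro i s₁ hi hinv hreg hf₁
    have hp₁ := h.frame hf₁ rfl
    obtain ⟨l1, l2, l3, l4⟩ := effect_loadArc hp₁ hreg
    refine Runs.mono (Runs.seq (T₁ := 150) (R := fun s' => s' = loadArc.effect s₁)
      (Runs.of_effect rfl (by decide) rfl) fun s₂ h₂ hf₂ =>
      Runs.of_effect (T := 60) (Q := fun s' => Built S m (i + 1) (s'.writeNat 14 (i + 1))) rfl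
        (by decide) ?_) (by omega) (fun s' h _ => h)
    have hA : s₂.natReg 2 = m + m + m := (hp₁.frame hf₂ rfl).arcs
    have hi₂ : s₂.natReg 14 = i := (hf₂.natReg 14 rfl).trans hreg
    rw [← h₂] at l1 l2 l3 l4
    have e10 : s₂.natArr 10 = s₁.natArr 10 := hf₂.natArr 10 rfl
    have e11 : s₂.natArr 11 = s₁.natArr 11 := hf₂.natArr 11 rfl
    have e12 : s₂.natArr 12 = s₁.natArr 12 := hf₂.natArr 12 rfl
    have e13 : s₂.natArr 13 = s₁.natArr 13 := hf₂.natArr 13 rfl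
    have er : s₂.realArr 10 = s₁.realArr 10 := hf₂.realArr 10 rfl
    have E10 : (storeArc.effect s₂).natArr 10 = Function.update (Function.update (s₁.natArr 10) i
        (S.arcTail m i)) (m + m + m + i) (S.arcHead m i) := by
      rw [← e10, ← l1, ← l2, ← hi₂, ← hA]; rfl
    have E11 : (storeArc.effect s₂).natArr 11 = Function.update (Function.update (s₁.natArr 11) i
        (S.arcHead m i)) (m + m + m + i) (S.arcTail m i) := by
      rw [← e11, ← l1, ← l2, ← hi₂, ← hA]; rfl
    have E12 : (storeArc.effect s₂).natArr 12 = Function.update (Function.update (s₁.natArr 12) i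
        (m + m + m + i)) (m + m + m + i) i := by
      rw [← e12, ← hi₂, ← hA]; rfl
    have E13 : (storeArc.effect s₂).natArr 13 = Function.update (s₁.natArr 13) i
        (S.arcCap m i) := by
      rw [← e13, ← l3, ← hi₂]; rfl
    have Er : (storeArc.effect s₂).realArr 10 = Function.update (Function.update (s₁.realArr 10) i
        (S.arcCost m i)) (m + m + m + i) (0 - S.arcCost m i) := by
      rw [← er, ← l4, ← hi₂, ← hA]; rfl
    refine ⟨fun j hj => ?_, fun j hj => ?_⟩
    · simp only [Store.writeNat, E10, E11, E12, E13, Er, zero_sub]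
      have n1 : j ≠ m + m + m + i := by omega
      by_cases hji : j = i
      · subst hji
        simp only [Function.update_self, Function.update_of_ne n1]
        exact ⟨trivial, trivial, trivial, trivial, trivial, trivial, trivial, trivial, trivial⟩
      · have n2 : m + m + m + j ≠ i := by omega
        have n3 : m + m + m + j ≠ m + m + m + i := by omega
        simp only [Function.update_of_ne n1, Function.update_of_ne n2, Function.update_of_ne n3,
          Function.update_of_ne hji]
        exact hinv.arcs j (by omega)
    · simp only [Store.writeNat, E13]
      rw [Function.update_of_ne (by omega)]
      exact hinv.opp j hj
  · simp only [NatExpr.size]; omega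

end Program

/-! ### The demands, the unit and the initial state -/

namespace Net

open Program

variable {N : Net}

theorem runs_count {s : Store} {u : ℕ} (hs : N.Static u s) (hA : s.natReg 2 = N.A)
    (h14 : ∀ w, s.natArr 14 w = 0) (h15 : ∀ w, s.natArr 15 w = 0) (h18 : ∀ w, s.natArr 18 w = 0) :
    Program.count.Runs s (N.A * 60 + 10) (fun s' => ∀ w,
      s'.natArr 14 w = ((Finset.range N.A).filter
        (fun j => 0 < s.natArr 13 j ∧ N.tl j = w)).card ∧
      s'.natArr 15 w = ((Finset.range N.A).filter
        (fun j => 0 < s.natArr 13 j ∧ N.hd j = w)).card ∧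
      s'.natArr 18 w = (s'.natArr 14 w + s'.natArr 15 w) % 2) := by
  have hcard : ∀ (i : ℕ) (p : ℕ → Prop) [DecidablePred p],
      ((Finset.range (i + 1)).filter p).card =
        ((Finset.range i).filter p).card + if p i then 1 else 0 := by
    intro i p _
    rw [Finset.range_add_one, Finset.filter_insert]
    split_ifs
    · rw [Finset.card_insert_of_notMem (by simp)]
    · simp
  refine (Runs.forLoop (Inv := fun i s' => ∀ w,
      s'.natArr 14 w = ((Finset.range i).filter (fun j => 0 < s.natArr 13 j ∧ N.tl j = w)).card ∧
      s'.natArr 15 w = ((Finset.range i).filter (fun j => 0 < s.natArr 13 j ∧ N.hd j = w)).card ∧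
      s'.natArr 18 w = (s'.natArr 14 w + s'.natArr 15 w) % 2) (N := N.A) (B := 50) rfl
    (fun s' hf => by exact (hf.natReg 2 rfl).trans hA) (fun w => ?_) ?_).mono ?_ (fun s' h _ => h)
  · simp [Store.writeNat, h14, h15, h18]
  · intro i s₁ hi hinv hreg hf₁
    have hs₁ := hs.frame hf₁ rfl
    have e13 : s₁.natArr 13 = s.natArr 13 := hf₁.natArr 13 rfl
    have hi2 : i < N.A + N.A := by omega
    refine Runs.of_effect rfl (by decide) ?_
    by_cases h0 : 0 < s.natArr 13 i
    · rw [countBody, effect, if_pos (by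
        simpa [Test.eval, NatExpr.eval, e13, hreg, Nat.one_le_iff_ne_zero, Nat.pos_iff_ne_zero] using h0)]
      intro w
      obtain ⟨i1, i2, i3⟩ := hinv w
      simp only [hcard, h0, true_and, ← i1, ← i2]
      simp [effect, Store.writeNat, Store.writeNatArr, NatExpr.eval, hreg, hs₁.tl i hi2,
        hs₁.hd i hi2, Function.update_apply]
      -- The parity entries at both ends are 0 or 1, so `1 - x` flips them; at a loop the two flips
      -- cancel.
      obtain ⟨-, -, i4⟩ := hinv (N.hd i)
      obtain ⟨-, -, i5⟩ := hinv (N.tl i)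
      clear i1 i2 hinv
      generalize N.hd i = x at *
      generalize N.tl i = y at *
      grind
    · rw [countBody, effect, if_neg (by
        simpa [Test.eval, NatExpr.eval, e13, hreg, Nat.one_le_iff_ne_zero, Nat.pos_iff_ne_zero] using h0)]
      intro w
      simp only [hcard, h0, false_and, if_false, add_zero]
      exact hinv w
  · simp only [NatExpr.size]; omega

end Net

namespace Program

theorem runs_normalize {s : Store} {n : ℕ} (hn : s.natReg 0 = n) (h5 : s.natReg 5 = 2) :
    normalize.Runs s (n * 50 + 10) (fun s' => (∀ w < n,
      s'.natArr 14 w = s.natArr 14 w - s.natArr 15 w ∧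
      s'.natArr 15 w = s.natArr 15 w - s.natArr 14 w) ∧
      (s'.natReg 5 = 2 ∧ (∀ w < n, s.natArr 18 w = 0) ∨
        s'.natReg 5 = 1 ∧ ∃ w < n, s.natArr 18 w ≠ 0)) := by
  refine (Runs.forLoop (Inv := fun i s' => (∀ w,
      s'.natArr 14 w = (if w < i then s.natArr 14 w - s.natArr 15 w else s.natArr 14 w) ∧
      s'.natArr 15 w = if w < i then s.natArr 15 w - s.natArr 14 w else s.natArr 15 w) ∧
      (s'.natReg 5 = 2 ∧ (∀ w < i, s.natArr 18 w = 0) ∨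
        s'.natReg 5 = 1 ∧ ∃ w < i, s.natArr 18 w ≠ 0)) (N := n) (B := 40) rfl
    (fun s' hf => by exact (hf.natReg 0 rfl).trans hn) ?_ ?_).mono ?_ ?_
  · exact ⟨fun w => by simp [Store.writeNat], Or.inl ⟨h5, fun w hw => absurd hw (Nat.not_lt_zero w)⟩⟩
  · rintro i s₁ hi ⟨h1, h2⟩ hreg hf
    have e18 : s₁.natArr 18 = s.natArr 18 := hf.natArr 18 rfl
    refine Runs.of_effect rfl (by decide) ?_
    obtain ⟨s₂, heff, e14, e15, e12, e5⟩ : ∃ s₂, normalizeBody.effect s₁ = subtract.effect s₂ ∧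
        s₂.natArr 14 = s₁.natArr 14 ∧ s₂.natArr 15 = s₁.natArr 15 ∧ s₂.natReg 12 = i ∧
        s₂.natReg 5 = if 1 ≤ s.natArr 18 i then 1 else s₁.natReg 5 := by
      by_cases h0 : 1 ≤ s.natArr 18 i
      · refine ⟨s₁.writeNat 5 1, congrArg subtract.effect (if_pos ?_), rfl, rfl, hreg, ?_⟩
        · show 1 ≤ s₁.natArr 18 (s₁.natReg 12)
          rw [e18, hreg]; exact h0
        · rw [if_pos h0]; rfl
      · refine ⟨s₁, congrArg subtract.effect (if_neg ?_), rfl, rfl, hreg, (if_neg h0).symm⟩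
        show ¬ 1 ≤ s₁.natArr 18 (s₁.natReg 12)
        rw [e18, hreg]; exact h0
    have E14 : (normalizeBody.effect s₁).natArr 14 = Function.update (s₁.natArr 14) i
        (s₁.natArr 14 i - s₁.natArr 15 i) := by
      rw [heff, ← e14, ← e15, ← e12]; rfl
    have E15 : (normalizeBody.effect s₁).natArr 15 = Function.update (s₁.natArr 15) i
        (s₁.natArr 15 i - s₁.natArr 14 i) := by
      rw [heff, ← e14, ← e15, ← e12]; rfl
    have E5 : (normalizeBody.effect s₁).natReg 5 =
        if 1 ≤ s.natArr 18 i then 1 else s₁.natReg 5 := by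
      rw [heff, ← e5]; rfl
    simp only [Store.writeNat, E14, E15]
    obtain ⟨h3, h4⟩ := h1 i
    rw [if_neg (lt_irrefl i)] at h3 h4
    refine ⟨fun w => ?_, ?_⟩
    · rw [h3, h4]
      obtain ⟨h5, h6⟩ := h1 w
      by_cases hw : w = i
      · subst hw; simp
      · rw [Function.update_of_ne hw, Function.update_of_ne hw, h5, h6]
        have : w < i + 1 ↔ w < i := by omega
        simp only [this, and_self]
    · rw [Function.update_of_ne (by omega), E5]
      by_cases h0 : 1 ≤ s.natArr 18 i
      · rw [if_pos h0]
        exact Or.inr ⟨rfl, i, by omega, by omega⟩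
      · rw [if_neg h0]
        rcases h2 with ⟨h5, h6⟩ | ⟨h5, w, h6, h7⟩
        · refine Or.inl ⟨h5, fun w hw => ?_⟩
          rcases Nat.lt_succ_iff_lt_or_eq.1 hw with h | h
          · exact h6 w h
          · rw [h]; omega
        · exact Or.inr ⟨h5, w, by omega, h7⟩
  · simp only [NatExpr.size]; omega
  · rintro s' ⟨h1, h2⟩ -
    refine ⟨fun w hw => ?_, h2⟩
    obtain ⟨h3, h4⟩ := h1 w
    rw [if_pos hw] at h3 h4
    exact ⟨h3, h4⟩

end Program

namespace Net

open Program

variable {N : Net}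

/-- The zero flow with zero potential is a valid start: costs are nonnegative, and the opposites of
all arcs have residual capacity 0. -/
theorem runs_init {s : Store} (hs : N.Static 2 s) (hA : s.natReg 2 = N.A)
    (h14 : ∀ w, s.natArr 14 w = 0) (h15 : ∀ w, s.natArr 15 w = 0) (h18 : ∀ w, s.natArr 18 w = 0)
    (hπ : ∀ w, s.realArr 11 w = 0) (hopp : ∀ j < N.A, s.natArr 13 (N.A + j) = 0)
    (hdvd : ∀ j < N.A, 2 ∣ s.natArr 13 j)
    (hcap : ∀ j, N.F ≤ j → j < N.A → s.natArr 13 j = N.cap j) (hco : ∀ j < N.A, 0 ≤ N.co j)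
    (hb : ∀ v < N.n, N.b v = ((Finset.range N.A).filter
        (fun j => 0 < s.natArr 13 j ∧ N.hd j = v)).card - ((Finset.range N.A).filter
        (fun j => 0 < s.natArr 13 j ∧ N.tl j = v)).card) :
    (seq count normalize).Runs s (70 * N.size N.A) (fun s' => ∃ u, 0 < u ∧ N.Static u s' ∧
      N.State u N.A (s'.natArr 13) (s'.natArr 14) (s'.natArr 15) (s'.realArr 11) ∧
      ((∀ v < N.n, Even (N.b v)) → u = 2)) := by
  refine Runs.mono (Runs.seq (T₂ := N.n * 50 + 10) (runs_count hs hA h14 h15 h18) fun s₁ h₁ hf₁ =>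
    (runs_normalize ((hf₁.natReg 0 rfl).trans hs.n) ((hf₁.natReg 5 rfl).trans hs.u)).mono le_rfl ?_)
    (by unfold size; omega) (fun s' h _ => h)
  rintro s₃ ⟨h4, h5⟩ hf₃
  have hf : Frame (seq count normalize) s s₃ := hf₁.seq_left.trans hf₃.seq_right
  have hF := N.F_le
  have e13 : s₃.natArr 13 = s.natArr 13 := hf.natArr 13 rfl
  have e11 : s₃.realArr 11 = s.realArr 11 := hf.realArr 11 rfl
  have hu : (s₃.natReg 5 = 1 ∨ s₃.natReg 5 = 2) ∧
      (∀ w < N.n, s₃.natReg 5 ∣ s₃.natArr 14 w ∧ s₃.natReg 5 ∣ s₃.natArr 15 w) ∧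
      ((∀ v < N.n, Even (N.b v)) → s₃.natReg 5 = 2) := by
    rcases h5 with ⟨h5, h6⟩ | ⟨h5, v, hv, h6⟩
    · refine ⟨Or.inr h5, fun w hw => ?_, fun _ => h5⟩
      have h7 := h6 w hw
      rw [(h₁ w).2.2] at h7
      rw [(h4 w hw).1, (h4 w hw).2, h5]
      -- The two counts may both be odd; an even sum still makes their differences even.
      omega
    · refine ⟨Or.inl h5, fun w hw => by simp [h5], fun heven => absurd ?_ h6⟩
      obtain ⟨k, hk⟩ := heven v hv
      rw [hb v hv, ← (h₁ v).1, ← (h₁ v).2.1] at hk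
      rw [(h₁ v).2.2]
      omega
  refine ⟨s₃.natReg 5, by omega, ?_, ?_, hu.2.2⟩
  · refine ⟨(hf.natReg 0 rfl).trans hs.n, (hf.natReg 3 rfl).trans hs.A,
      (hf.natReg 4 rfl).trans hs.F, rfl, ?_, ?_, ?_, ?_⟩
    · rw [hf.natArr 10 rfl]; exact hs.tl
    · rw [hf.natArr 11 rfl]; exact hs.hd
    · rw [hf.natArr 12 rfl]; exact hs.opp
    · rw [hf.realArr 10 rfl]; exact hs.co
  · rw [e13, e11]
    have hK : ∀ r < N.A + N.A, 2 ∣ s.natArr 13 r := by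
      intro r hr
      rcases lt_or_ge r N.A with h | h
      · exact hdvd r h
      · obtain ⟨j, rfl⟩ := Nat.exists_eq_add_of_le h
        rw [hopp j (by omega)]; exact dvd_zero 2
    refine ⟨⟨fun r hr hav => ?_, fun r hr => ?_, fun j hj hjA => ?_, fun v hv => ?_⟩,
      fun w hw => (hu.2.1 w hw).1, fun w hw => (hu.2.1 w hw).2, ?_, fun w hw => ?_⟩
    · rw [rc, hπ, hπ, add_zero, sub_zero]
      rcases lt_or_ge r N.A with h | h
      · exact hco r h
      · obtain ⟨j, rfl⟩ := Nat.exists_eq_add_of_le h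
        rcases hav with h6 | h6
        · omega
        · rw [hopp j (by omega)] at h6; omega
    · rcases hu.1 with h6 | h6 <;> rw [h6]
      · exact one_dvd _
      · exact hK r hr
    · rw [hopp j hjA, hcap j hj hjA, add_zero]
    · have h6 : N.net (s.natArr 13) v = 0 := Finset.sum_eq_zero fun j hj => by
        rw [hopp j (Finset.mem_range.1 hj)]; simp
      rw [h6, hb v hv, ← (h₁ v).1, ← (h₁ v).2.1, (h4 v hv).1, (h4 v hv).2]
      omega
    -- Tails and heads each count every arc with a positive entry once, so the totals agree before
    -- the cancellation; `h8` carries this over.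
    · have hsum : ∀ q : ℕ → ℕ, (∀ j < N.A, q j < N.n) → ∑ w ∈ Finset.range N.n,
          ((Finset.range N.A).filter (fun j => 0 < s.natArr 13 j ∧ q j = w)).card =
          ((Finset.range N.A).filter (fun j => 0 < s.natArr 13 j)).card := by
        intro q hq
        rw [Finset.card_eq_sum_card_fiberwise (f := q) (t := Finset.range N.n)]
        · simp only [Finset.filter_filter]
        · intro j hj
          simp only [Finset.coe_filter, Finset.mem_range, Set.mem_ofPred_eq] at hj
          simpa using hq j hj.1
      have h6 := hsum N.tl fun j hj => N.tl_lt j (by omega)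
      have h7 := hsum N.hd fun j hj => N.hd_lt j (by omega)
      simp only [← (h₁ _).1] at h6
      simp only [← (h₁ _).2.1] at h7
      have h8 : ∑ w ∈ Finset.range N.n, (s₃.natArr 14 w + s₁.natArr 15 w) =
          ∑ w ∈ Finset.range N.n, (s₃.natArr 15 w + s₁.natArr 14 w) := by
        refine Finset.sum_congr rfl fun w hw => ?_
        obtain ⟨h9, h10⟩ := h4 w (Finset.mem_range.1 hw)
        omega
      rw [Finset.sum_add_distrib, Finset.sum_add_distrib] at h8
      omega
    · have h6 := (h4 w hw).1
      have h7 := (h₁ w).1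
      have h8 := Finset.card_filter_le (Finset.range N.A)
        (fun j => 0 < s.natArr 13 j ∧ N.tl j = w)
      rw [Finset.card_range] at h8
      omega

end Net

/-! ### The network of an input graph -/

namespace LineCoverage

variable {n m : ℕ}

section input

variable (G : LineCoverage n m) (e : Fin m)

@[simp] theorem input_src : G.input.natArr 0 e = G.src e := by simp [input]

@[simp] theorem input_tgt : G.input.natArr 1 e = G.tgt e := by simp [input]

@[simp] theorem input_req : G.input.natArr 2 e = if e ∈ G.req then 1 else 0 := by simp [input]

@[simp] theorem input_service : G.input.realArr 0 e = G.serviceCost (e, true) := by simp [input]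

@[simp] theorem input_service' : G.input.realArr 1 e = G.serviceCost (e, false) := by simp [input]

@[simp] theorem input_deadhead : G.input.realArr 2 e = G.deadheadCost (e, true) := by simp [input]

@[simp] theorem input_deadhead' : G.input.realArr 3 e = G.deadheadCost (e, false) := by
  simp [input]

end input

/-- The number of an arc of the flow digraph. -/
def arcIndex : Arc m ⊕ Fin m → ℕ
  | .inl (e, true) => e
  | .inl (e, false) => m + e
  | .inr e => m + m + e

theorem arcIndex_lt (a : Arc m ⊕ Fin m) : arcIndex a < m + m + m := by
  rcases a with ⟨e, _ | _⟩ | e <;> simp only [arcIndex] <;> omega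

theorem arcIndex_inl_lt (a : Arc m) : arcIndex (.inl a) < m + m := by
  rcases a with ⟨e, _ | _⟩ <;> simp only [arcIndex] <;> omega

theorem exists_arcIndex {j : ℕ} (hj : j < m + m + m) : ∃ a : Arc m ⊕ Fin m, arcIndex a = j := by
  by_cases h1 : j < m
  · exact ⟨.inl (⟨j, h1⟩, true), rfl⟩
  · by_cases h2 : j < m + m
    · exact ⟨.inl (⟨j - m, by omega⟩, false), by simp only [arcIndex]; omega⟩
    · exact ⟨.inr ⟨j - (m + m), by omega⟩, by simp only [arcIndex]; omega⟩

theorem sum_arcIndex {M : Type*} [AddCommMonoid M] (w : ℕ → M) :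
    ∑ j ∈ Finset.range (m + m + m), w j = ∑ a : Arc m ⊕ Fin m, w (arcIndex a) := by
  rw [Finset.sum_range_add, Finset.sum_range_add, Finset.sum_range, Finset.sum_range,
    Finset.sum_range, Fintype.sum_sum_type, Fintype.sum_prod_type, ← Finset.sum_add_distrib]
  simp [arcIndex]

/-- Extends the flow digraph by reversal arcs for the edges that are not required; they never carry
flow. -/
noncomputable def flowTail (G : LineCoverage n m) : Arc m ⊕ Fin m → Fin n :=
  Sum.elim G.tail (fun e => G.head (G.minArc e))

noncomputable def flowHead (G : LineCoverage n m) : Arc m ⊕ Fin m → Fin n :=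
  Sum.elim G.head (fun e => G.tail (G.minArc e))

theorem input_arcTail (G : LineCoverage n m) (a : Arc m ⊕ Fin m) :
    G.input.arcTail m (arcIndex a) = G.flowTail a := by
  rcases a with ⟨e, _ | _⟩ | e
  · simp [Store.arcTail, arcIndex, flowTail, tail]
  · simp [Store.arcTail, arcIndex, flowTail, tail]
  · simp only [Store.arcTail, arcIndex, flowTail, minArc, Sum.elim_inr, Nat.add_sub_cancel_left,
      input_service, input_service', input_src, input_tgt]
    rw [if_neg (by omega), if_neg (by omega)]
    split_ifs <;> rfl

theorem input_arcHead (G : LineCoverage n m) (a : Arc m ⊕ Fin m) :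
    G.input.arcHead m (arcIndex a) = G.flowHead a := by
  rcases a with ⟨e, _ | _⟩ | e
  · simp [Store.arcHead, arcIndex, flowHead, head]
  · simp [Store.arcHead, arcIndex, flowHead, head]
  · simp only [Store.arcHead, arcIndex, flowHead, minArc, Sum.elim_inr, Nat.add_sub_cancel_left,
      input_service, input_service', input_src, input_tgt]
    rw [if_neg (by omega), if_neg (by omega)]
    split_ifs <;> rfl

theorem input_arcCost_inl (G : LineCoverage n m) (a : Arc m) :
    G.input.arcCost m (arcIndex (.inl a)) = 2 * G.deadheadCost a := by
  rcases a with ⟨e, _ | _⟩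
  · simp [Store.arcCost, arcIndex]; ring
  · simp [Store.arcCost, arcIndex]; ring

theorem input_arcCost_inr (G : LineCoverage n m) (e : Fin m) :
    G.input.arcCost m (arcIndex (.inr e)) =
      G.serviceCost (G.minArc e).rev - G.serviceCost (G.minArc e) := by
  simp only [Store.arcCost, arcIndex, minArc, Nat.add_sub_cancel_left,
    input_service, input_service']
  rw [if_neg (by omega), if_neg (by omega)]
  split_ifs <;> rfl

theorem serviceCost_minArc_le (G : LineCoverage n m) (e : Fin m) :
    G.serviceCost (G.minArc e) ≤ G.serviceCost (G.minArc e).rev := by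
  unfold minArc
  split_ifs with h
  · exact h
  · exact (not_le.1 h).le

theorem input_arcCost_nonneg (G : LineCoverage n m) {j : ℕ} (hj : j < m + m + m) :
    0 ≤ G.input.arcCost m j := by
  obtain ⟨a | e, rfl⟩ := exists_arcIndex hj
  · rw [input_arcCost_inl]; have := G.deadheadCost_pos a; positivity
  · rw [input_arcCost_inr]; exact sub_nonneg.2 (G.serviceCost_minArc_le e)

theorem input_arcCap_inl (G : LineCoverage n m) (a : Arc m) :
    G.input.arcCap m (arcIndex (.inl a)) = 0 :=
  if_pos (arcIndex_inl_lt a)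

theorem input_arcCap_inr (G : LineCoverage n m) (e : Fin m) :
    G.input.arcCap m (arcIndex (.inr e)) = if e ∈ G.req then 2 else 0 := by
  rw [Store.arcCap, arcIndex, if_neg (by omega), Nat.add_sub_cancel_left, input_req]
  split_ifs <;> rfl

/-- Every edge can be deadheaded both ways, so connectivity gives an arc leaving any proper nonempty
set; this is the field `conn` of the network. -/
theorem Connected.exists_crossing {G : LineCoverage n m} (hG : G.Connected) (S : Fin n → Prop)
    (h1 : ∃ w, S w) (h2 : ∃ w, ¬ S w) : ∃ a, S (G.tail a) ∧ ¬ S (G.head a) := by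
  by_contra hne
  push Not at hne
  obtain ⟨u, hu⟩ := h1
  obtain ⟨w, hw⟩ := h2
  have h := hG.preconnected u w
  rw [SimpleGraph.reachable_iff_reflTransGen] at h
  refine hw ?_
  clear hw
  induction h with
  | refl => exact hu
  | @tail x y _ h3 ih =>
    rw [SimpleGraph.fromRel_adj] at h3
    rcases h3.2 with ⟨e, rfl, rfl⟩ | ⟨e, rfl, rfl⟩
    · exact hne (e, true) ih
    · exact hne (e, false) ih

/-- The network of the minimum cost flow problem, with doubled costs. -/
noncomputable def toNet (G : LineCoverage n m) (hG : G.Connected) : Net where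
  n := n
  A := m + m + m
  F := m + m
  tl := fun r => if r < m + m + m then G.input.arcTail m r
    else G.input.arcHead m (r - (m + m + m))
  hd := fun r => if r < m + m + m then G.input.arcHead m r
    else G.input.arcTail m (r - (m + m + m))
  co := fun r => if r < m + m + m then G.input.arcCost m r
    else - G.input.arcCost m (r - (m + m + m))
  cap := G.input.arcCap m
  b := fun v => ∑ j ∈ Finset.range (m + m + m), (if 0 < G.input.arcCap m j then 1 else 0) *
    ((if G.input.arcHead m j = v then 1 else 0) - (if G.input.arcTail m j = v then 1 else 0))
  F_le := by omega
  tl_lt := fun r hr => by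
    split_ifs with h
    · obtain ⟨a, rfl⟩ := exists_arcIndex h
      rw [input_arcTail]; exact (G.flowTail a).2
    · obtain ⟨a, ha⟩ := exists_arcIndex (show r - (m + m + m) < m + m + m by omega)
      rw [← ha, input_arcHead]; exact (G.flowHead a).2
  hd_lt := fun r hr => by
    split_ifs with h
    · obtain ⟨a, rfl⟩ := exists_arcIndex h
      rw [input_arcHead]; exact (G.flowHead a).2
    · obtain ⟨a, ha⟩ := exists_arcIndex (show r - (m + m + m) < m + m + m by omega)
      rw [← ha, input_arcTail]; exact (G.flowTail a).2
  tl_opp := fun j hj => by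
    rw [if_neg (by omega), if_pos hj, Nat.add_sub_cancel_left]
  hd_opp := fun j hj => by
    rw [if_neg (by omega), if_pos hj, Nat.add_sub_cancel_left]
  co_opp := fun j hj => by
    rw [if_neg (by omega), if_pos hj, Nat.add_sub_cancel_left]
  conn := by
    rintro S ⟨u, hu, hSu⟩ ⟨w, hw, hSw⟩
    obtain ⟨a, h1, h2⟩ := hG.exists_crossing (fun v => S v) ⟨⟨u, hu⟩, hSu⟩ ⟨⟨w, hw⟩, hSw⟩
    have h3 := arcIndex_lt (Sum.inl a : Arc m ⊕ Fin m)
    refine ⟨arcIndex (.inl a), arcIndex_inl_lt a, ?_, ?_⟩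
    · rw [if_pos h3, input_arcTail]; exact h1
    · rw [if_pos h3, input_arcHead]; exact h2

/-- Complementary slackness: a flow with a suitable node potential has minimum cost. -/
theorem isMinCostFlow_of_potential {G : LineCoverage n m} {f : G.FlowArc → ℝ}
    (hf : f ∈ G.flowDigraph.feasible) (p : Fin n → ℝ)
    (h1 : ∀ a, 0 ≤ 2 * G.deadheadCost a + p (G.tail a) - p (G.head a))
    (h2 : ∀ a, 0 < f (Sum.inl a) → 2 * G.deadheadCost a + p (G.tail a) - p (G.head a) ≤ 0)
    (h3 : ∀ e : {e // e ∈ G.req}, f (Sum.inr e) < 2 →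
      0 ≤ G.serviceCost (G.minArc e).rev - G.serviceCost (G.minArc e) +
        p (G.head (G.minArc e)) - p (G.tail (G.minArc e)))
    (h4 : ∀ e : {e // e ∈ G.req}, 0 < f (Sum.inr e) →
      G.serviceCost (G.minArc e).rev - G.serviceCost (G.minArc e) +
        p (G.head (G.minArc e)) - p (G.tail (G.minArc e)) ≤ 0) :
    G.flowDigraph.IsMinCostFlow f := by
  refine ⟨hf, fun g hg => ?_⟩
  -- On feasible flows, replacing doubled costs by reduced costs changes the total by a constant, by
  -- conservation tested with `p`. Then `f` is minimal arc by arc.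
  have hcost : ∀ g ∈ G.flowDigraph.feasible, 2 * G.flowDigraph.flowCost g =
      ∑ a, (2 * G.deadheadCost a + p (G.tail a) - p (G.head a)) * g (Sum.inl a) +
      ∑ e : {e // e ∈ G.req}, (G.serviceCost (G.minArc e).rev - G.serviceCost (G.minArc e) +
        p (G.head (G.minArc e)) - p (G.tail (G.minArc e))) * g (Sum.inr e) +
      ∑ e : {e // e ∈ G.req}, (p (G.tail (G.minArc e)) - p (G.head (G.minArc e))) := by
    intro g hg
    rw [← ((G.mem_feasible_flowDigraph_iff g).1 hg).2.2 p, flowCost_flowDigraph, mul_add,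
      Finset.mul_sum, Finset.mul_sum, add_add_add_comm, ← Finset.sum_add_distrib,
      ← Finset.sum_add_distrib]
    congr 1 <;> exact Finset.sum_congr rfl fun _ _ => by ring
  have h5 := hcost f hf
  have h6 := hcost g hg
  obtain ⟨f1, f2, -⟩ := (G.mem_feasible_flowDigraph_iff f).1 hf
  obtain ⟨g1, g2, -⟩ := (G.mem_feasible_flowDigraph_iff g).1 hg
  have h7 : ∑ a, (2 * G.deadheadCost a + p (G.tail a) - p (G.head a)) * f (Sum.inl a) ≤
      ∑ a, (2 * G.deadheadCost a + p (G.tail a) - p (G.head a)) * g (Sum.inl a) := by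
    refine Finset.sum_le_sum fun a _ => ?_
    rcases (f1 a).eq_or_lt with h | h
    · rw [← h, mul_zero]; exact mul_nonneg (h1 a) (g1 a)
    · rw [le_antisymm (h2 a h) (h1 a), zero_mul, zero_mul]
  have h8 : ∑ e : {e // e ∈ G.req}, (G.serviceCost (G.minArc e).rev - G.serviceCost (G.minArc e) +
        p (G.head (G.minArc e)) - p (G.tail (G.minArc e))) * f (Sum.inr e) ≤
      ∑ e : {e // e ∈ G.req}, (G.serviceCost (G.minArc e).rev - G.serviceCost (G.minArc e) +
        p (G.head (G.minArc e)) - p (G.tail (G.minArc e))) * g (Sum.inr e) := by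
    refine Finset.sum_le_sum fun e _ => ?_
    obtain ⟨f3, f4⟩ := f2 e
    obtain ⟨g3, g4⟩ := g2 e
    have h9 := h3 e
    have h10 := h4 e
    rcases f3.eq_or_lt with h | h
    · rw [← h, mul_zero]; exact mul_nonneg (h9 (by rw [← h]; norm_num)) g3
    · rcases f4.eq_or_lt with h' | h'
      · rw [h']; exact mul_le_mul_of_nonpos_left g4 (h10 h)
      · rw [le_antisymm (h10 h) (h9 h'), zero_mul, zero_mul]
  linarith

/-- Translates vertexwise balances of the numbered network into tests against potentials; used for
the demand and for the flow. -/
theorem sum_net_mul (G : LineCoverage n m) (w : ℕ → ℤ) (φ : Fin n → ℝ) :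
    ∑ v : Fin n, ((∑ j ∈ Finset.range (m + m + m), w j *
      ((if G.input.arcHead m j = v then 1 else 0) -
        (if G.input.arcTail m j = v then 1 else 0)) : ℤ) : ℝ) * φ v =
      ∑ a : Arc m ⊕ Fin m, (w (arcIndex a) : ℝ) * (φ (G.flowHead a) - φ (G.flowTail a)) := by
  simp only [sum_arcIndex, input_arcHead, input_arcTail, Fin.val_inj]
  push_cast
  simp only [Finset.sum_mul]
  rw [Finset.sum_comm]
  refine Finset.sum_congr rfl fun a _ => ?_
  simp only [mul_assoc, ← Finset.mul_sum, sub_mul, Finset.sum_sub_distrib, ite_mul, one_mul,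
    zero_mul, Finset.sum_ite_eq, Finset.mem_univ, if_true]

theorem toNet_b (G : LineCoverage n m) (hG : G.Connected) (v : Fin n) :
    (G.toNet hG).b v = G.imbalance G.minCostDigraph v := by
  have key : ∀ φ : Fin n → ℝ, ∑ v : Fin n, ((G.toNet hG).b v : ℝ) * φ v =
      ∑ v, (G.imbalance G.minCostDigraph v : ℝ) * φ v := by
    intro φ
    rw [sum_imbalance_mul]
    refine (G.sum_net_mul (fun j => if 0 < G.input.arcCap m j then 1 else 0) φ).trans ?_
    rw [Fintype.sum_sum_type]
    simp only [input_arcCap_inl, input_arcCap_inr, lt_irrefl, if_false, Int.cast_zero, zero_mul,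
      Finset.sum_const_zero, zero_add, flowHead, flowTail, Sum.elim_inr]
    rw [← Finset.sum_filter_add_sum_filter_not Finset.univ (· ∈ G.req), Finset.filter_univ_mem,
      Finset.sum_eq_zero (s := Finset.filter (fun e => ¬ e ∈ G.req) Finset.univ), add_zero]
    · exact Finset.sum_congr rfl fun e he => by simp [he]
    · intro e he
      simp [(Finset.mem_filter.1 he).2]
  have h := key (fun w => if w = v then 1 else 0)
  simp only [mul_ite, mul_one, mul_zero, Finset.sum_ite_eq', Finset.mem_univ, if_true] at h
  exact_mod_cast h

/-- The flow with the residual capacities `K`. -/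
def flowOfResidual (G : LineCoverage n m) (K : ℕ → ℕ) : G.FlowArc → ℝ :=
  Sum.elim (fun a => (K (m + m + m + arcIndex (.inl a)) : ℝ))
    (fun e => (K (m + m + m + arcIndex (.inr e.1)) : ℝ))

/-- Bounds the reversal flow by 2 on required edges and forces it to 0 on all others. -/
theorem residual_add {G : LineCoverage n m} {hG : G.Connected} {u : ℕ} {K : ℕ → ℕ} {d : ℕ → ℤ}
    {π : ℕ → ℝ} (h : (G.toNet hG).Good u K d π) (e : Fin m) :
    K (arcIndex (.inr e)) + K (m + m + m + arcIndex (.inr e)) = if e ∈ G.req then 2 else 0 := by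
  rw [← input_arcCap_inr]
  exact h.cap (arcIndex (.inr e)) (by simp only [toNet, arcIndex]; omega) (arcIndex_lt _)

theorem flowOfResidual_mem_feasible {G : LineCoverage n m} {hG : G.Connected} {u : ℕ} {K : ℕ → ℕ}
    {π : ℕ → ℝ} (h : (G.toNet hG).Good u K (fun _ => 0) π) :
    G.flowOfResidual K ∈ G.flowDigraph.feasible := by
  rw [mem_feasible_flowDigraph_iff]
  refine ⟨fun a => Nat.cast_nonneg _, fun e => ⟨Nat.cast_nonneg _, ?_⟩, fun φ => ?_⟩
  · have h1 := residual_add h e.1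
    rw [if_pos e.2] at h1
    have h2 : K (m + m + m + arcIndex (.inr e.1)) ≤ 2 := by omega
    show (K (m + m + m + arcIndex (.inr e.1)) : ℝ) ≤ 2
    exact_mod_cast h2
  · have h1 := G.sum_net_mul (fun j => K (m + m + m + j)) φ
    have h2 : ∀ v : Fin n, (∑ j ∈ Finset.range (m + m + m), (K (m + m + m + j) : ℤ) *
        ((if G.input.arcHead m j = v then 1 else 0) -
        (if G.input.arcTail m j = v then 1 else 0)) : ℤ) = G.imbalance G.minCostDigraph v := by
      intro v
      rw [← G.toNet_b hG, ← h.bal v v.2, add_zero]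
      refine Finset.sum_congr rfl fun j hj => ?_
      have hj' : j < m + m + m := Finset.mem_range.1 hj
      simp only [toNet, hj', if_true]
    rw [Finset.sum_congr rfl fun v _ => by rw [h2 v], sum_imbalance_mul,
      Fintype.sum_sum_type] at h1
    simp only [flowHead, flowTail, Sum.elim_inl, Sum.elim_inr, Int.cast_natCast] at h1
    simp only [flowOfResidual, Sum.elim_inl, Sum.elim_inr]
    rw [Finset.sum_coe_sort G.req
      (fun e => φ (G.tail (G.minArc e)) - φ (G.head (G.minArc e))), h1,
      Finset.sum_coe_sort G.req (fun e => (K (m + m + m + arcIndex (.inr e)) : ℝ) *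
        (φ (G.tail (G.minArc e)) - φ (G.head (G.minArc e))))]
    congr 1
    rw [← Finset.sum_subset (Finset.subset_univ G.req)]
    · intro e _ he
      have h3 := residual_add h e
      rw [if_neg he] at h3
      have h4 : K (m + m + m + arcIndex (.inr e)) = 0 := by omega
      simp [h4]

/-- Remaining capacity makes the arc available and its reduced cost nonnegative; positive flow makes
the opposite available and the reduced cost nonpositive. This is complementary slackness. -/
theorem isMinCostFlow_flowOfResidual {G : LineCoverage n m} {hG : G.Connected} {u : ℕ} {K : ℕ → ℕ}
    {π : ℕ → ℝ} (h : (G.toNet hG).Good u K (fun _ => 0) π) :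
    G.flowDigraph.IsMinCostFlow (G.flowOfResidual K) := by
  have hrc : ∀ a : Arc m ⊕ Fin m, (G.toNet hG).rc π (arcIndex a) =
      G.input.arcCost m (arcIndex a) + π (G.flowTail a) - π (G.flowHead a) := by
    intro a
    have h1 := arcIndex_lt a
    simp only [Net.rc, toNet, h1, if_true, input_arcTail, input_arcHead]
  have hfor : ∀ a : Arc m ⊕ Fin m, (G.toNet hG).Avail K (arcIndex a) →
      0 ≤ G.input.arcCost m (arcIndex a) + π (G.flowTail a) - π (G.flowHead a) := by
    intro a ha
    rw [← hrc]
    exact h.slack _ ((arcIndex_lt a).trans_le (Nat.le_add_right _ _)) ha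
  have hback : ∀ a : Arc m ⊕ Fin m, 0 < (K (m + m + m + arcIndex a) : ℝ) →
      G.input.arcCost m (arcIndex a) + π (G.flowTail a) - π (G.flowHead a) ≤ 0 := by
    intro a ha
    have h1 : arcIndex a < (G.toNet hG).A := arcIndex_lt a
    have h2 := Net.rc_opp (N := G.toNet hG) π (h1.trans_le (Nat.le_add_right _ _))
    rw [Net.opp, if_pos h1, hrc] at h2
    have h3 := h.slack ((G.toNet hG).A + arcIndex a) (by omega) (Or.inr (by exact_mod_cast ha))
    linarith
  refine isMinCostFlow_of_potential (flowOfResidual_mem_feasible h) (fun v => π v) (fun a => ?_)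
    (fun a ha => ?_) (fun e he => ?_) (fun e he => ?_)
  · have := hfor (.inl a) (Or.inl (arcIndex_inl_lt a))
    rwa [input_arcCost_inl] at this
  · have := hback (.inl a) ha
    rwa [input_arcCost_inl] at this
  · have h1 := residual_add h e.1
    rw [if_pos e.2] at h1
    have he' : (K (m + m + m + arcIndex (.inr e.1)) : ℝ) < 2 := he
    have h2 : K (m + m + m + arcIndex (.inr e.1)) < 2 := by exact_mod_cast he'
    have := hfor (.inr e.1) (Or.inr (by omega))
    rwa [input_arcCost_inr] at this
  · have := hback (.inr e.1) he
    rwa [input_arcCost_inr] at this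

end LineCoverage

/-! ### The output, and the whole program -/

namespace Program

def outputDeadhead : Program :=
  seq (setNatArr 5 (.reg 14) (.arr 13 (.add (.reg 2) (.reg 14))))
    (seq (setNatArr 6 (.reg 14) (.arr 13 (.add (.reg 2) (.add (.reg 1) (.reg 14)))))
      (setNat 13 (.arr 13 (.add (.reg 2) (.add (.reg 4) (.reg 14))))))

def outputService (a b c d : NatExpr) : Program :=
  seq (setNatArr 3 (.reg 14) a) (seq (setNatArr 4 (.reg 14) b)
    (seq (setNatArr 7 (.reg 14) c) (setNatArr 8 (.reg 14) d)))

/-- With the reversal flow 0, 1 or 2 in register 13, truncated subtraction gives the indicators of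
0, of 2 and, in `ambiguousExpr`, of 1. -/
def keptExpr : NatExpr := .sub (.const 1) (.reg 13)

def reversedExpr : NatExpr := .sub (.reg 13) (.const 1)

def ambiguousExpr : NatExpr := .sub (.const 1) (.add keptExpr reversedExpr)

def outputBody : Program :=
  seq outputDeadhead (branch (.natLe (.const 1) (.arr 2 (.reg 14)))
    (branch (.realLe (.arr 0 (.reg 14)) (.arr 1 (.reg 14)))
      (outputService keptExpr reversedExpr ambiguousExpr (.const 0))
      (outputService reversedExpr keptExpr (.const 0) ambiguousExpr))
    (outputService (.const 0) (.const 0) (.const 0) (.const 0)))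

def output : Program := forLoop 14 (.reg 1) outputBody

end Program

namespace LineCoverage

open Program

variable {n m : ℕ}

theorem mem_minCostDigraph (G : LineCoverage n m) (a : Arc m) :
    a ∈ G.minCostDigraph ↔ a.1 ∈ G.req ∧ a = G.minArc a.1 := by
  simp only [minCostDigraph, Finset.mem_image]
  constructor
  · rintro ⟨e, he, rfl⟩
    rw [minArc_fst]; exact ⟨he, rfl⟩
  · rintro ⟨h1, h2⟩
    exact ⟨a.1, h1, h2.symm⟩

theorem lpOutput_service (G : LineCoverage n m) (K : ℕ → ℕ) (e : Fin m) (d : Bool)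
    (hK : e ∈ G.req → K (m + m + m + (m + m + e)) ≤ 2) :
    (G.lpOutput (G.flowOfResidual K)).service (e, d) =
      if e ∈ G.req then
        if (e, d) = G.minArc e then 1 - K (m + m + m + (m + m + e))
        else K (m + m + m + (m + m + e)) - 1
      else 0 := by
  by_cases he : e ∈ G.req
  · have h1 := hK he
    simp only [lpOutput, he, dif_pos, if_true, flowOfResidual, Sum.elim_inr, arcIndex]
    have h2 : K (m + m + m + (m + m + e)) = 0 ∨ K (m + m + m + (m + m + e)) = 1 ∨
        K (m + m + m + (m + m + e)) = 2 := by omega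
    rcases h2 with h2 | h2 | h2 <;> simp [h2]
  · simp [lpOutput, he]

open Classical in
theorem lpOutput_ambiguous (G : LineCoverage n m) (K : ℕ → ℕ) (e : Fin m) (d : Bool)
    (hK : e ∈ G.req → K (m + m + m + (m + m + e)) ≤ 2) :
    (if (e, d) ∈ (G.lpOutput (G.flowOfResidual K)).ambiguous then 1 else 0) =
      if e ∈ G.req then
        if (e, d) = G.minArc e then 1 - (1 - K (m + m + m + (m + m + e)) +
          (K (m + m + m + (m + m + e)) - 1)) else 0
      else 0 := by
  by_cases he : e ∈ G.req
  · have h1 := hK he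
    have h2 : (e, d) ∈ (G.lpOutput (G.flowOfResidual K)).ambiguous ↔
        (e, d) = G.minArc e ∧ K (m + m + m + (m + m + e)) = 1 := by
      simp [lpOutput, mem_minCostDigraph, he, flowOfResidual, arcIndex]
    by_cases h3 : (e, d) = G.minArc e
    · rw [if_congr (h2.trans (and_iff_right h3)) rfl rfl, if_pos he, if_pos h3]
      split_ifs <;> omega
    · simp [h2, h3]
  · simp [lpOutput, mem_minCostDigraph, he]

theorem runs_output {G : LineCoverage n m} {s : Store} (hs : Prepared G.input n m s)
    (hK : ∀ e ∈ G.req, s.natArr 13 (m + m + m + (m + m + e)) ≤ 2) :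
    output.Runs s (m * 150 + 10) (fun s' =>
      s'.Holds (G.lpOutput (G.flowOfResidual (s.natArr 13)))) := by
  classical
  let D := G.lpOutput (G.flowOfResidual (s.natArr 13))
  refine (Runs.forLoop (Inv := fun i s' => ∀ e : Fin m, (e : ℕ) < i →
    s'.natArr 3 e = D.service (e, true) ∧ s'.natArr 4 e = D.service (e, false) ∧
    s'.natArr 5 e = D.deadhead (e, true) ∧ s'.natArr 6 e = D.deadhead (e, false) ∧
    s'.natArr 7 e = (if (e, true) ∈ D.ambiguous then 1 else 0) ∧
    s'.natArr 8 e = (if (e, false) ∈ D.ambiguous then 1 else 0)) (N := m) (B := 140) rfl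
    (fun s' hf => by exact (hs.frame hf rfl).edges) (fun e he => absurd he (Nat.not_lt_zero _))
    ?_).mono (by simp only [NatExpr.size]; omega) (fun s' h _ e => by convert h e e.2)
  intro i s₁ hi hinv hreg hf
  have hp := hs.frame hf rfl
  have e13 : s₁.natArr 13 = s.natArr 13 := hf.natArr 13 rfl
  refine Runs.of_effect rfl (by decide) ?_
  let e : Fin m := ⟨i, hi⟩
  have hx := fun he => hK e he
  -- The body changes each output array only at the index `i`, so earlier entries persist.
  suffices H : (outputBody.effect s₁).natArr 3 =
        Function.update (s₁.natArr 3) i (D.service (e, true)) ∧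
      (outputBody.effect s₁).natArr 4 =
        Function.update (s₁.natArr 4) i (D.service (e, false)) ∧
      (outputBody.effect s₁).natArr 5 =
        Function.update (s₁.natArr 5) i (D.deadhead (e, true)) ∧
      (outputBody.effect s₁).natArr 6 =
        Function.update (s₁.natArr 6) i (D.deadhead (e, false)) ∧
      (outputBody.effect s₁).natArr 7 =
        Function.update (s₁.natArr 7) i (if (e, true) ∈ D.ambiguous then 1 else 0) ∧
      (outputBody.effect s₁).natArr 8 =
        Function.update (s₁.natArr 8) i (if (e, false) ∈ D.ambiguous then 1 else 0) by
    obtain ⟨H3, H4, H5, H6, H7, H8⟩ := H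
    intro e' he'
    simp only [Store.writeNat, H3, H4, H5, H6, H7, H8]
    by_cases h : (e' : ℕ) = i
    · have : e' = e := Fin.ext h
      subst this
      rw [show ((e : Fin m) : ℕ) = i from rfl]
      simp only [Function.update_self]
      exact ⟨trivial, trivial, trivial, trivial, trivial, trivial⟩
    · simp only [Function.update_of_ne h]
      exact hinv e' (by omega)
  have hd : D.deadhead (e, true) = s.natArr 13 (m + m + m + i) ∧
      D.deadhead (e, false) = s.natArr 13 (m + m + m + (m + i)) := by
    constructor <;> exact Nat.floor_natCast _
  have h5 : (outputDeadhead.effect s₁).natArr 5 =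
      Function.update (s₁.natArr 5) i (D.deadhead (e, true)) := by
    rw [hd.1, ← e13, ← hreg, ← hp.arcs]; rfl
  have h6 : (outputDeadhead.effect s₁).natArr 6 =
      Function.update (s₁.natArr 6) i (D.deadhead (e, false)) := by
    show Function.update (s₁.natArr 6) (s₁.natReg 14)
      (s₁.natArr 13 (s₁.natReg 2 + (s₁.natReg 1 + s₁.natReg 14))) = _
    rw [hp.arcs, hp.edges, hreg, e13, hd.2]
  have h13 : (outputDeadhead.effect s₁).natReg 13 = s.natArr 13 (m + m + m + (m + m + e)) := by
    show s₁.natArr 13 (s₁.natReg 2 + (s₁.natReg 4 + s₁.natReg 14)) = _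
    rw [e13, hp.arcs, hp.freeArcs, hreg]
  have hserv := fun d => G.lpOutput_service (s.natArr 13) e d hx
  have hamb := fun d => G.lpOutput_ambiguous (s.natArr 13) e d hx
  change ∀ d, D.service (e, d) = _ at hserv
  change ∀ d, (if (e, d) ∈ D.ambiguous then 1 else 0) = _ at hamb
  have hreq : s₁.natArr 2 (s₁.natReg 14) = if e ∈ G.req then 1 else 0 := by
    rw [hp.req, hreg]; exact G.input_req e
  by_cases he : e ∈ G.req
  · have ht : Test.eval (outputDeadhead.effect s₁) (.natLe (.const 1) (.arr 2 (.reg 14))) := by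
      show 1 ≤ s₁.natArr 2 (s₁.natReg 14)
      rw [hreq, if_pos he]
    have hcost : Test.eval (outputDeadhead.effect s₁) (.realLe (.arr 0 (.reg 14))
        (.arr 1 (.reg 14))) ↔ G.serviceCost (e, true) ≤ G.serviceCost (e, false) := by
      show s₁.realArr 0 (s₁.natReg 14) ≤ s₁.realArr 1 (s₁.natReg 14) ↔ _
      rw [hp.service, hp.service', hreg]
      exact iff_of_eq (congrArg₂ _ (G.input_service e) (G.input_service' e))
    rw [hserv, hserv, hamb, hamb, if_pos he, if_pos he, if_pos he, if_pos he, ← h13, ← hreg]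
    rw [← hreg] at h5 h6
    by_cases hc : G.serviceCost (e, true) ≤ G.serviceCost (e, false)
    · have hmin : G.minArc e = (e, true) := if_pos hc
      have heff : outputBody.effect s₁ =
          (outputService keptExpr reversedExpr ambiguousExpr (.const 0)).effect
            (outputDeadhead.effect s₁) := (if_pos ht).trans (if_pos (hcost.2 hc))
      rw [heff, hmin, if_pos rfl, if_pos rfl, if_neg (by simp), if_neg (by simp)]
      exact ⟨rfl, rfl, h5, h6, rfl, rfl⟩
    · have hmin : G.minArc e = (e, false) := if_neg hc
      have heff : outputBody.effect s₁ =
          (outputService reversedExpr keptExpr (.const 0) ambiguousExpr).effect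
            (outputDeadhead.effect s₁) := (if_pos ht).trans (if_neg (mt hcost.1 hc))
      rw [heff, hmin, if_pos rfl, if_pos rfl, if_neg (by simp), if_neg (by simp)]
      exact ⟨rfl, rfl, h5, h6, rfl, rfl⟩
  · have ht : ¬ Test.eval (outputDeadhead.effect s₁) (.natLe (.const 1) (.arr 2 (.reg 14))) := by
      show ¬ 1 ≤ s₁.natArr 2 (s₁.natReg 14)
      rw [hreq, if_neg he]; omega
    have heff : outputBody.effect s₁ =
        (outputService (.const 0) (.const 0) (.const 0) (.const 0)).effect
          (outputDeadhead.effect s₁) := if_neg ht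
    rw [hserv, hserv, hamb, hamb, if_neg he, if_neg he, if_neg he, if_neg he, heff, ← hreg]
    rw [← hreg] at h5 h6
    exact ⟨rfl, rfl, h5, h6, rfl, rfl⟩

/-- LP-Solve. -/
def lpSolve : Program :=
  seq prep (seq build (seq (seq count normalize) (seq solve output)))

theorem prepared_prep (G : LineCoverage n m) : Prepared G.input n m (prep.effect G.input) :=
  ⟨rfl, rfl, rfl, rfl, rfl, rfl, rfl, rfl, rfl, rfl, rfl, rfl⟩

theorem static_of_built {G : LineCoverage n m} (hG : G.Connected) {s : Store}
    (hp : Prepared G.input n m s) (hb : Built G.input m (m + m + m) s) (h5 : s.natReg 5 = 2) :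
    (G.toNet hG).Static 2 s := by
  have hcases : ∀ r, r < m + m + m + (m + m + m) → r < m + m + m ∨
      ∃ j < m + m + m, r = m + m + m + j := fun r hr => by
    by_cases h : r < m + m + m
    · exact Or.inl h
    · exact Or.inr ⟨r - (m + m + m), by omega, by omega⟩
  refine ⟨hp.vertices, hp.residualArcs, hp.freeArcs, h5, fun r hr => ?_, fun r hr => ?_,
    fun r hr => ?_, fun r hr => ?_⟩ <;>
  rcases hcases r hr with h | ⟨j, h, rfl⟩ <;>
  obtain ⟨b1, b2, b3, b4, b5, b6, b7, b8, -⟩ := hb.arcs _ h <;>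
  simp [toNet, Net.opp, *]

theorem runs_lpSolve {G : LineCoverage n m} (hG : G.Connected) :
    lpSolve.Runs G.input (3000000 * (n + m + 1) ^ 4) (fun s => ∃ u π,
      (G.toNet hG).Good u (s.natArr 13) (fun _ => 0) π ∧
      s.Holds (G.lpOutput (G.flowOfResidual (s.natArr 13))) ∧ (G.RequiredEulerian → u = 2)) := by
  have hA : (G.toNet hG).A = m + m + m := rfl
  refine (Runs.seq (T₁ := 30) (R := fun s' => s' = prep.effect G.input)
    (Runs.of_effect rfl (by decide) rfl) fun s₁ h₁ hf₁ => ?_).mono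
    (T := 30 + ((m + m + m) * 230 + 10 + (70 * (G.toNet hG).size (G.toNet hG).A +
      (330 * (G.toNet hG).size (G.toNet hG).A ^ 4 + (m * 150 + 10))))) ?_ (fun s' h _ => h)
  · have hp₁ : Prepared G.input n m s₁ := h₁ ▸ G.prepared_prep
    have h5 : s₁.natReg 5 = 2 := by rw [h₁]; rfl
    refine Runs.seq (runs_build hp₁ fun j => by rw [h₁]; simp [prep, effect, Store.writeNat, input])
      fun s₂ h₂ hf₂ => ?_
    have hp₂ := hp₁.frame hf₂ rfl
    have hzero : ∀ x, 14 ≤ x → x ≤ 18 → ∀ w, G.input.natArr x w = 0 := by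
      intro x hx _ w
      simp only [input]
      split_ifs <;> omega
    have hcap : ∀ j < m + m + m, s₂.natArr 13 j = G.input.arcCap m j := fun j hj =>
      (h₂.arcs j hj).2.2.2.2.2.2.2.2
    refine Runs.seq (Net.runs_init (static_of_built hG hp₂ h₂ ((hf₂.natReg 5 rfl).trans h5))
      hp₂.arcs ?_ ?_ ?_ ?_ (fun j hj => h₂.opp _ (Nat.le_add_right _ _)) ?_
      (fun j _ hj => hcap j hj) ?_ ?_) fun s₃ h₃ hf₃ => ?_
    · rw [hf₂.natArr 14 rfl, hf₁.natArr 14 rfl]; exact hzero 14 (by omega) (by omega)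
    · rw [hf₂.natArr 15 rfl, hf₁.natArr 15 rfl]; exact hzero 15 (by omega) (by omega)
    · rw [hf₂.natArr 18 rfl, hf₁.natArr 18 rfl]; exact hzero 18 (by omega) (by omega)
    · rw [hf₂.realArr 11 rfl, hf₁.realArr 11 rfl]; intro w; simp [input]
    · intro j hj
      rw [hcap j hj, Store.arcCap]
      split_ifs
      · exact dvd_zero 2
      · exact ⟨G.input.natArr 2 (j - (m + m)), by ring⟩
    · intro j hj
      have : (G.toNet hG).co j = G.input.arcCost m j := if_pos hj
      rw [this]
      exact G.input_arcCost_nonneg hj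
    · intro v hv
      rw [Finset.card_filter, Finset.card_filter]
      push_cast
      rw [← Finset.sum_sub_distrib]
      change (∑ j ∈ Finset.range (m + m + m), (if 0 < G.input.arcCap m j then (1 : ℤ) else 0) *
        ((if G.input.arcHead m j = v then 1 else 0) -
          (if G.input.arcTail m j = v then 1 else 0))) = _
      refine Finset.sum_congr rfl fun j hj => ?_
      have hj' : j < m + m + m := Finset.mem_range.1 hj
      have h6 : (G.toNet hG).hd j = G.input.arcHead m j := if_pos hj'
      have h7 : (G.toNet hG).tl j = G.input.arcTail m j := if_pos hj'
      rw [h6, h7, hcap j hj']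
      by_cases h8 : 0 < G.input.arcCap m j <;> simp [h8]
    · obtain ⟨u, hu, hs₃, hst, heven⟩ := h₃
      refine Runs.seq (Net.runs_solve hu hs₃ hst) fun s₄ h₄ hf₄ => ?_
      have hp₄ := (hp₂.frame hf₃ rfl).frame hf₄ rfl
      refine (runs_output hp₄ fun e he => ?_).mono le_rfl fun s₅ h₅ hf₅ => ?_
      · have h6 := residual_add h₄ e
        rw [if_pos he, arcIndex] at h6
        omega
      · rw [hf₅.natArr 13 rfl]
        refine ⟨u, _, h₄, h₅, fun hE => heven fun v hv => ?_⟩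
        rw [G.toNet_b hG ⟨v, hv⟩]
        exact hE.even_imbalance _
  -- The size is n + 9m + 1, and 330 · 9^4 = 2165130; the remaining terms are linear and fit into
  -- the constant 3000000.
  · have h1 : (G.toNet hG).size (G.toNet hG).A ≤ 9 * (n + m + 1) := by
      simp only [Net.size, toNet]; omega
    have h2 : (G.toNet hG).size (G.toNet hG).A ^ 4 ≤ (9 * (n + m + 1)) ^ 4 :=
      Nat.pow_le_pow_left h1 4
    have h3 : (9 * (n + m + 1)) ^ 4 = 6561 * (n + m + 1) ^ 4 := by ring
    have h4 : n + m + 1 ≤ (n + m + 1) ^ 4 := Nat.le_self_pow (by norm_num) _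
    omega

end LineCoverage

/-- The first part: a program `P` carries out LP-Solve (on every connected input graph), in a number
of steps that is polynomial in the numbers of vertices and edges, and if the required graph is
Eulerian, the flow it computes has reversal variables `0` or `2` and integer deadhead variables, and
its output is an optimal coverage tour. The second part: the latter holds for LP-Solve with any basic
minimum cost flow. -/
theorem mainTheorem3 :
    (∃ (P : Program) (C k : ℕ), ∀ (n m : ℕ) (G : LineCoverage n m), G.Connected →
      ∃ (t : ℕ) (s : Store) (f : G.FlowArc → ℝ),
        t ≤ C * (n + m + 1) ^ k ∧
        P.Exec G.input t s ∧
        G.flowDigraph.IsMinCostFlow f ∧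
        (∀ a, ∃ j : ℕ, f a = (j : ℝ)) ∧
        s.Holds (G.lpOutput f) ∧
        (G.RequiredEulerian → G.SolvedBy f)) ∧
    (∀ (n m : ℕ) (G : LineCoverage n m), G.Connected → G.RequiredEulerian →
      ∀ f : G.FlowArc → ℝ, G.flowDigraph.IsBasicMinCostFlow f → G.SolvedBy f) := by
  refine ⟨⟨LineCoverage.lpSolve, 3000000, 4, fun n m G hG => ?_⟩,
    fun n m G hG hE f hf => LineCoverage.solvedBy_of_isBasicMinCostFlow hG hE hf⟩
  obtain ⟨t, s, ht, hexec, u, π, hgood, hout, heven⟩ := LineCoverage.runs_lpSolve hG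
  have hmin := LineCoverage.isMinCostFlow_flowOfResidual hgood
  refine ⟨t, s, G.flowOfResidual (s.natArr 13), ht, hexec, hmin, ?_, hout, fun hE => ?_⟩
  · rintro (a | e)
    · exact ⟨_, rfl⟩
    · exact ⟨_, rfl⟩
  · refine LineCoverage.solvedBy_of_even hG hE hmin fun a => ?_
    -- In the Eulerian case the unit is 2, and it divides every residual capacity, hence every flow
    -- value.
    have hdvd : ∀ b : Arc m ⊕ Fin m, (s.natArr 13 (m + m + m + LineCoverage.arcIndex b) : ℝ) ∈
        AddSubgroup.zmultiples (2 : ℝ) := by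
      intro b
      have h1 := LineCoverage.arcIndex_lt b
      obtain ⟨j, hj⟩ := hgood.dvd (m + m + m + LineCoverage.arcIndex b)
        (Nat.add_lt_add_left h1 _)
      rw [heven hE] at hj
      refine AddSubgroup.mem_zmultiples_iff.2 ⟨j, ?_⟩
      rw [hj]
      push_cast
      simp [mul_comm]
    rcases a with a | e
    · exact hdvd (.inl a)
    · exact hdvd (.inr e.1)
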